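/- Let $d\in\{2,3\}$ and let $\Omega\subset\mathbb R^d$ be an open set with $\Omega=\operatorname{int}\overline\Omega$ (for instance a bounded connected polygonal/polyhedral domain with Lipschitz boundary), and let $\mathcal T_h$ be a matching simplicial mesh of $\Omega$: a finite set of nondegenerate closed simplices with union $\overline\Omega$, any two of which meet in the (possibly empty) simplex spanned by their common vertices. Let $\mathcal F_h$ be the set of $(d-1)$-dimensional faces of the elements, $\mathcal F_T\subset\mathcal F_h$ the set of faces of $T\in\mathcal T_h$, $n_{TF}$ the unit normal to $F\in\mathcal F_T$ pointing out of $T$, and call $F$ a boundary face if $F\subset\partial\Omega$. For $Y\in\mathcal T_h\cup\mathcal F_h$ let $\mathcal P^\ell(Y)$ be the space of restrictions to $Y$ of polynomials of total degree $\le\ell$ ($\mathcal P^{-1}(Y)=\{0\}$), and $\pi^\ell_Y$ the $L^2(Y)$-orthogonal projector on it (acting componentwise on vector fields). Let $\mathcal{RTN}^{\ell}(T)=\mathcal P^{\ell-1}(T)^d+x\,\mathcal P^{\ell-1}(T)$. Let $k\ge0$ be an integer and $$\underline U_h^k=\{((v_T)_{T\in\mathcal T_h},(v_F)_{F\in\mathcal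 F_h}):v_T\in\mathcal{RTN}^{k+1}(T),\ v_F\in\mathcal P^k(F)^d\},$$ $$\underline P_h^k=\{((q_T)_{T\in\mathcal T_h},(q_F)_{F\in\mathcal F_h}):q_T\in\mathcal P^k(T),\ q_F\in\mathcal P^k(F)\},$$ $$\underline U_{h,0}^k=\{\underline v_h\in\underline U_h^k: v_F=0\text{ for all boundary faces }F\},\qquad \underline P_{h,0}^k=\Big\{\underline q_h\in\underline P_h^k:\sum_{T\in\mathcal T_h}\int_T q_T=0\Big\}.$$ For $\underline q_h\in\underline P_h^k$ and $T\in\mathcal T_h$ let $G_T^k\underline q_T\in\mathcal{RTN}^{k+1}(T)$ be defined by $$\int_T G_T^k\underline q_T\cdot z=-\int_T q_T\,(\nabla\cdot z)+\sum_{F\in\mathcal F_T}\int_F q_F\,(z\cdot n_{TF})\qquad\forall z\in\mathcal{RTN}^{k+1}(T),$$ and set $b_h(\underline v_h,\underline q_h)=\sum_{T\in\mathcal T_h}\int_T v_T\cdot G_T^k\underline q_T$ and $\underline Z_{h,0}^k=\{\underline v_h\in\underline U_{h,0}^k: b_h(\underline v_h,\underline q_h)=0\ \ \forall\underline q_h\in\underline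 P_h^k\}$. Let $w\in H_0^1(\Omega)^d$ satisfy $\nabla\cdot w=0$ in $\Omega$. The hybrid interpolant $\underline I_{U,h}^kw=((v_T)_T,(v_F)_F)\in\underline U_h^k$ of $w$ is defined by $\pi^{k-1}_Tv_T=\pi^{k-1}_Tw$ and $v_T\cdot n_{TF}=\pi^k_F(w\cdot n_{TF})$ for all $T\in\mathcal T_h$ and $F\in\mathcal F_T$, and $v_F=\pi^k_Fw$ for all $F\in\mathcal F_h$, where on faces $w$ is understood in the sense of traces. Then $\underline I_{U,h}^kw$ is well defined (exactly one element of $\underline U_h^k$ satisfies these conditions), and $\underline I_{U,h}^kw\in\underline Z_{h,0}^k$; in particular $b_h(\underline I_{U,h}^kw,\underline q_h)=0$ for all $\underline q_h\in\underline P_{h,0}^k$. Moreover, an element $\underline v_h\in\underline U_{h,0}^k$ lies in $\underline Z_{h,0}^k$ if and only if $b_h(\underline v_h,\underline q_h)=0$ for all $\underline q_h\in\underline P_{h,0}^k$. -/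

import Mathlib

open MeasureTheory Filter Topology
open scoped ContDiff

/-- `ℝ^d` with its Euclidean norm. -/
abbrev Space (d : ℕ) : Type := EuclideanSpace ℝ (Fin d)

section Sobolev

variable {d : ℕ} {V : Type} [NormedAddCommGroup V] [NormedSpace ℝ V]

/-- `φ ∈ C_c^∞(U)`, with values in `V`. -/
def IsTestFunction (U : Set (Space d)) (φ : Space d → V) : Prop :=
  ContDiff ℝ ∞ φ ∧ HasCompactSupport φ ∧ tsupport φ ⊆ U

/-- `G` is the weak (distributional) derivative of `u` in the open set `U`. -/
def HasWeakFDeriv (U : Set (Space d)) (u : Space d → V) (G : Space d → Space d →L[ℝ] V) : Prop :=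
  ∀ φ : Space d → ℝ, IsTestFunction U φ → ∀ e : Space d,
    ∫ x in U, (fderiv ℝ φ x e) • u x = -∫ x in U, φ x • G x e

/-- `u ∈ H^1(U)` and the smooth functions `φ n` converge to `u` in `H^1(U)`. -/
def IsH1Limit (U : Set (Space d)) (φ : ℕ → Space d → V) (u : Space d → V) : Prop :=
  ∃ G : Space d → Space d →L[ℝ] V,
    MemLp u 2 (volume.restrict U) ∧ MemLp G 2 (volume.restrict U) ∧ HasWeakFDeriv U u G ∧
    Tendsto (fun n => eLpNorm (fun x => φ n x - u x) 2 (volume.restrict U)) atTop (𝓝 0) ∧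
    Tendsto (fun n => eLpNorm (fun x => fderiv ℝ (φ n) x - G x) 2 (volume.restrict U)) atTop (𝓝 0)

/-- `u ∈ H_0^1(U)`: the closure of `C_c^∞(U)` in `H^1(U)`. -/
def MemH10 (U : Set (Space d)) (u : Space d → V) : Prop :=
  ∃ φ : ℕ → Space d → V, (∀ n, IsTestFunction U (φ n)) ∧ IsH1Limit U φ u

/-- `∇ · w = 0` in the open set `U`, in the sense of distributions. -/
def IsDivergenceFree (U : Set (Space d)) (w : Space d → Space d) : Prop :=
  ∀ φ : Space d → ℝ, IsTestFunction U φ → ∫ x in U, fderiv ℝ φ x (w x) = 0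

end Sobolev

noncomputable section

section Polynomials

variable {d : ℕ}

/-- A polynomial in the space variables, as a function on `Y ⊆ ℝ^d`. -/
def restrictPoly (Y : Set (Space d)) : MvPolynomial (Fin d) ℝ →ₗ[ℝ] (Y → ℝ) where
  toFun p x := MvPolynomial.eval (fun i => x.1 i) p
  map_add' p q := by ext x; simp
  map_smul' c p := by ext x; simp

/-- `P^ℓ(Y)`: restrictions to `Y` of the polynomials of total degree `≤ ℓ`; it is `{0}` for
`ℓ = -1`. -/
def polySpace (ℓ : ℤ) (Y : Set (Space d)) : Submodule ℝ (Y → ℝ) :=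
  (MvPolynomial.restrictSupport ℝ {α : Fin d →₀ ℕ | ((∑ i, α i : ℕ) : ℤ) ≤ ℓ}).map (restrictPoly Y)

/-- `P^ℓ(Y)^d`. -/
def polyVecSpace (ℓ : ℤ) (Y : Set (Space d)) : Submodule ℝ (Y → Space d) where
  carrier := {v | ∀ i, (fun x => v x i) ∈ polySpace ℓ Y}
  add_mem' ha hb i := (polySpace ℓ Y).add_mem (ha i) (hb i)
  zero_mem' _ := (polySpace ℓ Y).zero_mem
  smul_mem' c _ ha i := (polySpace ℓ Y).smul_mem c (ha i)

/-- `q ↦ (x ↦ q(x) x)`. -/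
def mulPosition (Y : Set (Space d)) : (Y → ℝ) →ₗ[ℝ] (Y → Space d) where
  toFun q x := q x • x.1
  map_add' p q := by ext x; simp [add_mul]
  map_smul' c p := by ext x; simp [mul_assoc]

/-- The Raviart--Thomas--Nédélec space `RTN^ℓ(Y) = P^{ℓ-1}(Y)^d + x P^{ℓ-1}(Y)`. -/
def rtnSpace (ℓ : ℤ) (Y : Set (Space d)) : Submodule ℝ (Y → Space d) :=
  polyVecSpace (ℓ - 1) Y ⊔ (polySpace (ℓ - 1) Y).map (mulPosition Y)

/-- `p` is the orthogonal projection `π^ℓ_Y q` of `q`, for the `L^2(μ)` product. -/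
def IsL2Proj (ℓ : ℤ) (Y : Set (Space d)) (μ : Measure Y) (q p : Y → ℝ) : Prop :=
  p ∈ polySpace ℓ Y ∧ ∀ r ∈ polySpace ℓ Y, ∫ x, p x * r x ∂μ = ∫ x, q x * r x ∂μ

/-- `p = π^ℓ_Y q` for vector fields, componentwise. -/
def IsL2ProjVec (ℓ : ℤ) (Y : Set (Space d)) (μ : Measure Y) (q p : Y → Space d) : Prop :=
  ∀ i, IsL2Proj ℓ Y μ (fun x => q x i) (fun x => p x i)

/-- The divergence of a vector field that is only defined on `Y`; used for closed simplices, where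
derivatives within `Y` are unique at every point of `Y`. -/
def divergenceOn (Y : Set (Space d)) (v : Y → Space d) (x : Y) : ℝ :=
  ∑ i, (fderivWithin ℝ (Function.extend Subtype.val v 0) Y x.1 (EuclideanSpace.single i 1)) i

end Polynomials

section Mesh

variable {d : ℕ}

/-- The closed simplex (element or face) with the given set of vertices. -/
abbrev cell (s : Finset (Space d)) : Set (Space d) := convexHull ℝ (s : Set (Space d))

/-- The Lebesgue measure on the element `T`. -/
def volumeMeasure (T : Finset (Space d)) : Measure (cell T) :=
  (volume : Measure (Space d)).comap Subtype.val

/-- The `(d-1)`-dimensional surface measure on the face `F`. -/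
def surfaceMeasure (F : Finset (Space d)) : Measure (cell F) :=
  (μHE[d - 1] : Measure (Space d)).comap Subtype.val

/-- `n` is the unit normal to the face `F` of the simplex `T` pointing out of `T`. -/
def IsOutwardNormal (T F : Finset (Space d)) (n : Space d) : Prop :=
  ‖n‖ = 1 ∧ (∀ x ∈ F, ∀ y ∈ F, inner ℝ n (x - y) = 0) ∧ ∀ x ∈ T, ∀ y ∈ F, inner ℝ n (x - y) ≤ 0

/-- `n_{TF}`, the unique vector with this property when `T` is a nondegenerate simplex. -/
def outwardNormal (T F : Finset (Space d)) : Space d :=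
  Classical.epsilon (IsOutwardNormal T F)

/-- The restriction to the face `F` of `T` of a vector field on `T`. -/
def restrictToFace {T F : Finset (Space d)} (h : F ⊆ T) (v : cell T → Space d) :
    cell F → Space d :=
  fun x => v ⟨x.1, convexHull_mono (Finset.coe_subset.2 h) x.2⟩

/-- `g` is the trace on the face `F` of `T` of `u ∈ H^1(T)^d`: the limit in `L^2(F)` of the
restrictions of smooth functions that converge to `u` in `H^1(T)`. -/
def IsTrace (T F : Finset (Space d)) (u : Space d → Space d) (g : cell F → Space d) : Prop :=
  MemLp g 2 (surfaceMeasure F) ∧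
  ∃ φ : ℕ → Space d → Space d, (∀ n, ContDiff ℝ ∞ (φ n)) ∧ IsH1Limit (interior (cell T)) φ u ∧
    Tendsto (fun n => eLpNorm (fun x : cell F => φ n x.1 - g x) 2 (surfaceMeasure F)) atTop (𝓝 0)

/-- A matching simplicial mesh of `Ω`: finitely many nondegenerate closed simplices (given by their
vertices) that cover the closure of `Ω`, any two of which meet in the simplex spanned by their
common vertices (which is empty if there are none). -/
structure SimplicialMesh (Ω : Set (Space d)) where
  elements : Finset (Finset (Space d))
  card_vertices : ∀ T ∈ elements, T.card = d + 1
  affineIndependent : ∀ T ∈ elements, AffineIndependent ℝ (fun x : T => (x : Space d))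
  inter_eq : ∀ T ∈ elements, ∀ T' ∈ elements,
    cell T ∩ cell T' = convexHull ℝ ((T : Set (Space d)) ∩ T')
  iUnion_eq : ⋃ T ∈ elements, cell T = closure Ω

variable {Ω : Set (Space d)}

open Classical in
/-- The set `F_h` of the `(d-1)`-dimensional faces of the elements. -/
def SimplicialMesh.faces (M : SimplicialMesh Ω) : Finset (Finset (Space d)) :=
  M.elements.biUnion (fun T => T.powersetCard d)

/-- The set `F_T` of the faces of the element `T`. -/
abbrev SimplicialMesh.FacesOf (M : SimplicialMesh Ω) (T : M.elements) : Type :=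
  {F : M.faces // F.1 ⊆ T.1}

instance (M : SimplicialMesh Ω) (T : M.elements) : Fintype (M.FacesOf T) :=
  Fintype.ofFinite _

/-- Boundary faces: those contained in `∂Ω`. -/
def SimplicialMesh.IsBoundaryFace (M : SimplicialMesh Ω) (F : M.faces) : Prop :=
  cell F.1 ⊆ frontier Ω

end Mesh

section Scheme

variable {d : ℕ} {Ω : Set (Space d)} (M : SimplicialMesh Ω) (k : ℕ)

/-- The space `U_h^k` of pairs `((v_T)_T, (v_F)_F)`, `v_T ∈ RTN^{k+1}(T)`, `v_F ∈ P^k(F)^d`. -/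
abbrev VelocitySpace : Type :=
  ((T : M.elements) → rtnSpace (k + 1 : ℤ) (cell T.1)) ×
    ((F : M.faces) → polyVecSpace (k : ℤ) (cell F.1))

/-- The space `P_h^k` of pairs `((q_T)_T, (q_F)_F)`, `q_T ∈ P^k(T)`, `q_F ∈ P^k(F)`. -/
abbrev PressureSpace : Type :=
  ((T : M.elements) → polySpace (k : ℤ) (cell T.1)) ×
    ((F : M.faces) → polySpace (k : ℤ) (cell F.1))

/-- `U_{h,0}^k`. -/
def velocitySpaceZero : Set (VelocitySpace M k) :=
  {v | ∀ F : M.faces, M.IsBoundaryFace F → v.2 F = 0}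

/-- `P_{h,0}^k`; the integral of the piecewise polynomial `q_h` over `Ω` is the sum of its integrals
over the elements. -/
def pressureSpaceZero : Set (PressureSpace M k) :=
  {q | ∑ T : M.elements, ∫ x : cell T.1, (q.1 T).1 x ∂(volumeMeasure T.1) = 0}

/-- `g = G_T^k q_T`, where `q_T` is the restriction of `q` to the element `T`. -/
def IsPressureGradient (T : M.elements) (q : PressureSpace M k)
    (g : rtnSpace (k + 1 : ℤ) (cell T.1)) : Prop :=
  ∀ w : rtnSpace (k + 1 : ℤ) (cell T.1),
    ∫ x : cell T.1, inner ℝ (g.1 x) (w.1 x) ∂(volumeMeasure T.1) =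
      -(∫ x : cell T.1, (q.1 T).1 x * divergenceOn (cell T.1) w.1 x ∂(volumeMeasure T.1)) +
      ∑ F : M.FacesOf T, ∫ x : cell F.1.1, (q.2 F.1).1 x *
        inner ℝ (restrictToFace F.2 w.1 x) (outwardNormal T.1 F.1.1) ∂(surfaceMeasure F.1.1)

/-- The pressure gradient `G_T^k q_T`, which is uniquely determined by its defining property since
the `L^2(T)` product is positive definite on the finite-dimensional space `RTN^{k+1}(T)`. -/
def pressureGradient (T : M.elements) (q : PressureSpace M k) :
    rtnSpace (k + 1 : ℤ) (cell T.1) :=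
  Classical.epsilon (IsPressureGradient M k T q)

/-- The velocity--pressure coupling `b_h`. -/
def couplingForm (v : VelocitySpace M k) (q : PressureSpace M k) : ℝ :=
  ∑ T : M.elements,
    ∫ x : cell T.1, inner ℝ ((v.1 T).1 x) ((pressureGradient M k T q).1 x) ∂(volumeMeasure T.1)

/-- The discrete space `Z_{h,0}^k` of divergence-free functions. -/
def discreteDivFree : Set (VelocitySpace M k) :=
  {v | v ∈ velocitySpaceZero M k ∧ ∀ q : PressureSpace M k, couplingForm M k v q = 0}

/-- `v` is the interpolant of `w ∈ H^1(T)^d` in `RTN^ℓ(T)`: both have the same projection on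
`P^{ℓ-2}(T)^d`, and the normal component of `v` on each face `F` of `T` is the projection on
`P^{ℓ-1}(F)` of the normal trace of `w`. -/
def IsRTNInterpolant (ℓ : ℤ) (T : Finset (Space d)) (w : Space d → Space d)
    (v : cell T → Space d) : Prop :=
  v ∈ rtnSpace ℓ (cell T) ∧
  (∃ p : cell T → Space d, IsL2ProjVec (ℓ - 2) (cell T) (volumeMeasure T) v p ∧
    IsL2ProjVec (ℓ - 2) (cell T) (volumeMeasure T) (fun x => w x.1) p) ∧
  ∀ (F : Finset (Space d)) (h : F ⊆ T), F.card = d →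
    ∃ g : cell F → Space d, IsTrace T F w g ∧
      IsL2Proj (ℓ - 1) (cell F) (surfaceMeasure F)
        (fun x => inner ℝ (g x) (outwardNormal T F))
        (fun x => inner ℝ (restrictToFace h v x) (outwardNormal T F))

/-- `v` is the hybrid interpolant `I_{U,h}^k w`: `v_T` is the interpolant of `w` in `RTN^{k+1}(T)`
for all elements `T`, and `v_F` is the projection on `P^k(F)^d` of the trace of `w` on `F` (which
is the trace from each element that has `F` as a face) for all faces `F`. -/
def IsHybridInterpolant (w : Space d → Space d) (v : VelocitySpace M k) : Prop :=
  (∀ T : M.elements, IsRTNInterpolant (k + 1 : ℤ) T.1 w (v.1 T).1) ∧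
  ∀ F : M.faces, ∃ g : cell F.1 → Space d,
    (∀ T : M.elements, F.1 ⊆ T.1 → IsTrace T.1 F.1 w g) ∧
    IsL2ProjVec (k : ℤ) (cell F.1) (surfaceMeasure F.1) g (v.2 F).1

end Scheme

end

/-!
The hybrid interpolant `v` of a divergence-free `w ∈ H_0^1(Ω)^d` exists, is unique and is discretely
divergence free, for the following reasons.

*Well-posedness.* The fields of the Raviart--Thomas--Nédélec space are determined by their interior
moments and the moments of their normal components on the faces (`IsSimplex.field_eq_zero`): without
moments, the normal components and then, by Green's formula, the divergence vanish; Euler's identity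
lowers the degree of the field, so that its component in the direction of the normal to a face is
`λ S` with the barycentric coordinate `λ` that vanishes there and a polynomial `S`, and the interior
moments against `S` give `∫ λ S² = 0`. Comparing dimensions gives existence
(`IsSimplex.exists_moments`). Traces are limits in `L^2(F)` of smooth approximations
(`IsFace.exists_trace`, `IsFace.trace_ae_eq`). The trace inequality behind them, and the divergence
theorem on a simplex (`IsSimplex.divergence_theorem`), come from one formula on cones
(`cone_identity`), which is integration along the rays from a vertex.

*Vanishing of the coupling.* By the definition of the pressure gradient, `b_h(v, q)` is a sum of
integrals of `q_T ∇ · v_T` on elements and of `q_F (v_T · n_{TF})` on faces (`couplingForm_eq`). The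
former vanish since the moments of `v_T` are those of `w`, and `w` satisfies Green's formula as a limit
of smooth functions (`IsRTNInterpolant.integral_mul_divergenceOn_eq_zero`). In the latter, `v_T` may be
replaced by the trace `g_F` of `w`, which is the same from all adjacent elements, so that the terms of
a face `F` add up to the integral of `q_F (g_F · c_F)`, where `c_F` is the sum of the outward normals
of the elements with face `F`. Testing the divergence theorem on `Ω` with test functions supported
near a point of `F` shows that `c_F = 0` unless `F ∩ Ω` has surface measure zero
(`SimplicialMesh.normalSum_eq_zero_or`), and in that case `g_F = 0` as a limit of functions that vanish
outside `Ω` (`trace_ae_eq_zero`). The same argument gives `v_F = 0` on boundary faces. In this way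
the geometry of the mesh, in particular the number of elements adjacent to a face, is not needed.

*Mean values.* The coupling does not change when a constant is added to the pressure, by the
divergence theorem on each element (`couplingForm_add_constPressure`); hence it suffices to test with
pressures of mean value zero.
-/

/-! ### Integration over a cone -/

section Cone

variable {d : ℕ}

open scoped ENNReal

theorem finrank_orthogonal_unit {n : Space d} (hn : ‖n‖ = 1) :
    Module.finrank ℝ (ℝ ∙ n)ᗮ = d - 1 := by
  have h := (ℝ ∙ n).finrank_add_finrank_orthogonal
  rw [finrank_span_singleton (by rintro rfl; simp at hn), finrank_euclideanSpace_fin] at h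
  omega

/-- Cartesian coordinates with origin `a` along the unit vector `n` and its orthogonal
complement. -/
theorem measurePreserving_slices {n : Space d} (hn : ‖n‖ = 1) (a : Space d) :
    MeasurePreserving (fun p : ℝ × (ℝ ∙ n)ᗮ => a + p.1 • n + (p.2 : Space d))
      (volume.prod volume) volume := by
  have h1 := ((ℝ ∙ n).measurePreserving_measurableEquivProd a).symm
  rw [InnerProductSpace.euclideanHausdorffMeasure_eq_volume, Measure.volume_eq_prod] at h1
  have h2 := (LinearIsometryEquiv.toSpanUnitSingleton (𝕜 := ℝ) n hn).measurePreserving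
  have h3 := h1.comp (h2.prod (MeasurePreserving.id (volume : Measure (ℝ ∙ n)ᗮ)))
  have e : (fun p : ℝ × (ℝ ∙ n)ᗮ => a + p.1 • n + (p.2 : Space d)) =
      ((ℝ ∙ n).measurableEquivProd a).symm ∘
        Prod.map (LinearIsometryEquiv.toSpanUnitSingleton (𝕜 := ℝ) n hn) id := by
    funext p
    simp [add_comm, add_left_comm]
  rw [e]
  exact h3

theorem lintegral_comp_smul_scaling {V : Type*} [NormedAddCommGroup V] [InnerProductSpace ℝ V]
    [FiniteDimensional ℝ V] [MeasurableSpace V] [BorelSpace V] {t : ℝ} (ht : 0 < t)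
    (g : V → ℝ≥0∞) (hg : Measurable g) :
    ∫⁻ y, g y = ENNReal.ofReal (t ^ Module.finrank ℝ V) * ∫⁻ z, g (t • z) := by
  have h := Measure.map_addHaar_smul (volume : Measure V) ht.ne'
  have h2 : ∫⁻ z, g (t • z) = ∫⁻ y, g y ∂(Measure.map (t • ·) (volume : Measure V)) :=
    (lintegral_map hg (measurable_const_smul t)).symm
  rw [h2, h, lintegral_smul_measure, smul_eq_mul, ← mul_assoc, ← ENNReal.ofReal_mul (by positivity),
    abs_of_pos (by positivity), mul_inv_cancel₀ (by positivity)]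
  simp

/-- The surface integral over a set `K` in the hyperplane at distance `h` from `a`, computed in the
orthogonal complement of the normal `n`: the parametrization is an isometry, and the normalized
Hausdorff measure of full dimension is the volume. -/
theorem lintegral_face_eq {n : Space d} (hn : ‖n‖ = 1) {a : Space d} {h : ℝ} {K : Set (Space d)}
    (hK : MeasurableSet K) (hKn : ∀ y ∈ K, inner ℝ n (y - a) = h) (g : Space d → ℝ≥0∞)
    (hg : Measurable g) :
    ∫⁻ y in K, g y ∂μHE[d - 1] =
      ∫⁻ z : (ℝ ∙ n)ᗮ, K.indicator g (a + h • n + z) := by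
  have hiso : Isometry (fun z : (ℝ ∙ n)ᗮ => a + h • n + (z : Space d)) :=
    Isometry.of_dist_eq fun z z' => by simp [dist_eq_norm]
  have hsub : K ⊆ Set.range (fun z : (ℝ ∙ n)ᗮ => a + h • n + (z : Space d)) := by
    intro y hy
    refine ⟨⟨y - a - h • n, ?_⟩, by simp⟩
    rw [Submodule.mem_orthogonal_singleton_iff_inner_right, inner_sub_right, hKn y hy,
      inner_smul_right, real_inner_self_eq_norm_sq, hn]
    simp
  have h1 := hiso.map_euclideanHausdorffMeasure (d := d - 1)
  have h2 : (μHE[d - 1] : Measure (ℝ ∙ n)ᗮ) = volume := by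
    rw [← finrank_orthogonal_unit hn, InnerProductSpace.euclideanHausdorffMeasure_eq_volume]
  rw [h2] at h1
  rw [← lintegral_map (hg.indicator hK) hiso.continuous.measurable, h1, ← lintegral_indicator hK,
    ← lintegral_indicator hiso.isClosedEmbedding.isClosed_range.measurableSet]
  congr 1
  ext y
  by_cases hy : y ∈ K
  · simp [hy, hsub hy]
  · classical
    rw [Set.indicator_of_notMem hy, Set.indicator_apply]
    split_ifs <;> simp [hy]

theorem inner_eq_of_mem_cell {a n : Space d} {h : ℝ} {F : Finset (Space d)}
    (hF : ∀ y ∈ F, inner ℝ n (y - a) = h) {y : Space d} (hy : y ∈ cell F) :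
    inner ℝ n (y - a) = h := by
  have hc : Convex ℝ {y : Space d | inner ℝ n (y - a) = h} := by
    intro x hx y hy s t hs ht hst
    simp only [Set.mem_ofPred_eq] at *
    have : s • x + t • y - a = s • (x - a) + t • (y - a) := by
      rw [smul_sub, smul_sub, sub_add_sub_comm, ← add_smul, hst, one_smul]
    rw [this, inner_add_right, inner_smul_right, inner_smul_right, hx, hy, ← add_mul, hst, one_mul]
  exact convexHull_min (fun y hy => hF y hy) hc hy

theorem exists_of_mem_cone {a : Space d} {F : Finset (Space d)} (hne : F.Nonempty) {x : Space d}
    (hx : x ∈ convexHull ℝ (insert a (F : Set (Space d)))) :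
    ∃ s ∈ Set.Icc (0 : ℝ) 1, ∃ y ∈ cell F, x = a + s • (y - a) := by
  rw [convexHull_insert (by simpa using hne), mem_convexJoin] at hx
  obtain ⟨a', ha', y, hy, hyz⟩ := hx
  obtain rfl : a' = a := by simpa using ha'
  obtain ⟨s, hs, rfl⟩ := (segment_eq_image ℝ a' y ▸ hyz)
  exact ⟨s, hs, y, hy, by module⟩

theorem mem_cone {a : Space d} {F : Finset (Space d)} {t : ℝ} (ht : 0 ≤ t) (ht1 : t ≤ 1)
    {y : Space d} (hy : y ∈ cell F) :
    a + t • (y - a) ∈ convexHull ℝ (insert a (F : Set (Space d))) := by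
  have h1 : a ∈ convexHull ℝ (insert a (F : Set (Space d))) :=
    subset_convexHull _ _ (Set.mem_insert _ _)
  have h2 : y ∈ convexHull ℝ (insert a (F : Set (Space d))) :=
    convexHull_mono (Set.subset_insert _ _) hy
  exact (convex_convexHull ℝ _).add_smul_sub_mem h1 h2 ⟨ht, ht1⟩

/-- The section of a cone by a hyperplane parallel to its base is a scaled copy of the base. -/
theorem mem_cone_iff {a n : Space d} {h : ℝ} (hh : 0 < h) {F : Finset (Space d)}
    (hne : F.Nonempty)
    (hF : ∀ y ∈ F, inner ℝ n (y - a) = h) {t : ℝ} (ht : 0 < t) (ht1 : t ≤ 1) {y : Space d}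
    (hy : inner ℝ n (y - a) = h) :
    a + t • (y - a) ∈ convexHull ℝ (insert a (F : Set (Space d))) ↔ y ∈ cell F := by
  refine ⟨fun hx => ?_, fun hx => mem_cone ht.le ht1 hx⟩
  obtain ⟨s, -, y', hy', e⟩ := exists_of_mem_cone hne hx
  have e' := add_left_cancel e
  have h2 := congrArg (inner ℝ n) e'
  rw [inner_smul_right, inner_smul_right, hy, inner_eq_of_mem_cell hF hy'] at h2
  obtain rfl := mul_right_cancel₀ hh.ne' h2
  obtain rfl : y = y' := by simpa using smul_right_injective _ ht.ne' e'
  exact hy'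

theorem isCompact_cell (F : Finset (Space d)) : IsCompact (cell F) :=
  F.finite_toSet.isCompact_convexHull (𝕜 := ℝ)

theorem measurableSet_cell (F : Finset (Space d)) : MeasurableSet (cell F) :=
  (isCompact_cell F).measurableSet

/-- Integration over the cone with apex `a`, base `F` and height `h`: slices parallel to the base
are scaled copies of it, with surface measure proportional to `t ^ (d - 1)`. -/
theorem lintegral_cone {a n : Space d} {h : ℝ} (hh : 0 < h) (hn : ‖n‖ = 1) {F : Finset (Space d)}
    (hne : F.Nonempty)
    (hF : ∀ y ∈ F, inner ℝ n (y - a) = h) (f : Space d → ℝ≥0∞) (hf : Measurable f) :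
    ∫⁻ x in convexHull ℝ (insert a (F : Set (Space d))), f x =
      ∫⁻ t in Set.Ioo (0 : ℝ) 1, ENNReal.ofReal (h * t ^ (d - 1)) *
        ∫⁻ y in cell F, f (a + t • (y - a)) ∂μHE[d - 1] := by
  set C := convexHull ℝ (insert a (F : Set (Space d))) with hC
  have hCm : MeasurableSet C :=
    ((F.finite_toSet.insert a).isCompact_convexHull (𝕜 := ℝ)).measurableSet
  have hmp := measurePreserving_slices hn a
  have hfm : Measurable (C.indicator f) := hf.indicator hCm
  rw [← lintegral_indicator hCm, ← hmp.lintegral_comp hfm,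
    lintegral_prod (fun p : ℝ × (ℝ ∙ n)ᗮ => C.indicator f (a + p.1 • n + (p.2 : Space d)))
    (hfm.comp hmp.measurable).aemeasurable]
  rw [lintegral_comp_smul_scaling hh
    (fun s : ℝ => ∫⁻ y : (ℝ ∙ n)ᗮ, C.indicator f (a + s • n + (y : Space d)))
    ((hfm.comp hmp.measurable).lintegral_prod_right' (ν := (volume : Measure (ℝ ∙ n)ᗮ)))]
  -- the slice at distance `h t` from the apex; it is empty for `t` outside `[0, 1]`
  have key : ∀ t : ℝ, t ≠ 0 → t ≠ 1 →
      ENNReal.ofReal h * ∫⁻ y : (ℝ ∙ n)ᗮ, C.indicator f (a + (h • t) • n + (y : Space d)) =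
      (Set.Ioo (0 : ℝ) 1).indicator (fun t => ENNReal.ofReal (h * t ^ (d - 1)) *
        ∫⁻ y in cell F, f (a + t • (y - a)) ∂μHE[d - 1]) t := by
    intro t ht0 ht1
    by_cases ht : t ∈ Set.Ioo (0 : ℝ) 1
    · rw [Set.indicator_of_mem ht, lintegral_comp_smul_scaling ht.1 _ (by fun_prop),
        finrank_orthogonal_unit hn, ← mul_assoc, ← ENNReal.ofReal_mul hh.le,
        lintegral_face_eq hn (measurableSet_cell F) (fun y hy => inner_eq_of_mem_cell hF hy) _
          (by fun_prop)]
      congr 2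
      ext z
      have hz : inner ℝ n (z : Space d) = 0 :=
        (Submodule.mem_orthogonal_singleton_iff_inner_right).1 z.2
      have e : a + (h • t) • n + ((t • z : (ℝ ∙ n)ᗮ) : Space d) =
          a + t • ((a + h • n + (z : Space d)) - a) := by
        simp only [Submodule.coe_smul, smul_eq_mul]
        module
      have hi := mem_cone_iff hh hne hF ht.1 ht.2.le (y := a + h • n + (z : Space d)) (by
        rw [add_sub_right_comm, add_sub_cancel_left, inner_add_right, inner_smul_right,
          real_inner_self_eq_norm_sq, hn, hz]; simp)
      rw [e]
      by_cases hm : a + h • n + (z : Space d) ∈ cell F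
      · rw [Set.indicator_of_mem hm, Set.indicator_of_mem (hi.2 hm)]
      · rw [Set.indicator_of_notMem hm, Set.indicator_of_notMem (fun h => hm (hi.1 h))]
    · rw [Set.indicator_of_notMem ht]
      rw [lintegral_eq_zero_of_ae_eq_zero, mul_zero]
      refine Eventually.of_forall fun z => ?_
      refine Set.indicator_of_notMem (fun hmem => ht ?_) _
      have hz : inner ℝ n (z : Space d) = 0 :=
        (Submodule.mem_orthogonal_singleton_iff_inner_right).1 z.2
      have hin : inner ℝ n (a + (h • t) • n + (z : Space d) - a) = h * t := by
        rw [add_sub_right_comm, add_sub_cancel_left, inner_add_right, inner_smul_right,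
          real_inner_self_eq_norm_sq, hn, hz]; simp
      obtain ⟨s, hs, y, hy, e⟩ := exists_of_mem_cone hne hmem
      have h3 : h * t = s * h := by
        rw [← hin, e, add_sub_cancel_left, inner_smul_right, inner_eq_of_mem_cell hF hy]
      have : t = s := by
        rw [mul_comm] at h3
        exact mul_right_cancel₀ hh.ne' h3
      subst this
      exact ⟨lt_of_le_of_ne hs.1 (Ne.symm ht0), lt_of_le_of_ne hs.2 ht1⟩
  rw [← lintegral_indicator measurableSet_Ioo, Module.finrank_self, pow_one,
    ← lintegral_const_mul' _ _ ENNReal.ofReal_ne_top]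
  refine lintegral_congr_ae ?_
  have h0 : ∀ᵐ t : ℝ, t ≠ 0 := by simp [ae_iff]
  have h1 : ∀ᵐ t : ℝ, t ≠ 1 := by simp [ae_iff]
  filter_upwards [h0, h1] with t ht0 ht1
  exact key t ht0 ht1

end Cone

section ConeConsequences

variable {d : ℕ}

open scoped ENNReal

theorem measure_cell_lt_top {a n : Space d} {h : ℝ} (hn : ‖n‖ = 1) {F : Finset (Space d)}
    (hF : ∀ y ∈ F, inner ℝ n (y - a) = h) : μHE[d - 1] (cell F) < ⊤ := by
  have hm := measurableSet_cell F
  have e := lintegral_face_eq hn hm (fun y hy => inner_eq_of_mem_cell hF hy) (fun _ => 1)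
    measurable_const
  have hiso : Isometry (fun z : (ℝ ∙ n)ᗮ => a + h • n + (z : Space d)) :=
    Isometry.of_dist_eq fun z z' => by simp [dist_eq_norm]
  have hK := hiso.isClosedEmbedding.isCompact_preimage (isCompact_cell F)
  have e2 : (fun z : (ℝ ∙ n)ᗮ => (cell F).indicator (fun _ => (1 : ℝ≥0∞)) (a + h • n + z)) =
    ((fun z : (ℝ ∙ n)ᗮ => a + h • n + (z : Space d)) ⁻¹' (cell F)).indicator 1 := rfl
  rw [e2, lintegral_indicator_one hK.measurableSet, setLIntegral_one] at e
  rw [e]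
  exact hK.measure_lt_top

/-- The volume on a cone is the image of a product measure on height and base. -/
theorem volume_cone_eq {a n : Space d} {h : ℝ} (hh : 0 < h) (hn : ‖n‖ = 1) {F : Finset (Space d)}
    (hne : F.Nonempty) (hF : ∀ y ∈ F, inner ℝ n (y - a) = h) :
    volume.restrict (convexHull ℝ (insert a (F : Set (Space d)))) =
      Measure.map (fun p : ℝ × Space d => a + p.1 • (p.2 - a))
        (((volume.restrict (Set.Ioo (0 : ℝ) 1)).withDensity
          (fun t => ENNReal.ofReal (h * t ^ (d - 1)))).prod (μHE[d - 1].restrict (cell F))) := by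
  have : IsFiniteMeasure ((μHE[d - 1] : Measure (Space d)).restrict (cell F)) :=
    ⟨by simpa using measure_cell_lt_top hn hF⟩
  refine Measure.ext_of_lintegral _ fun f hf => ?_
  rw [lintegral_cone hh hn hne hF f hf, lintegral_map hf (by fun_prop),
    lintegral_prod _ (by fun_prop), lintegral_withDensity_eq_lintegral_mul _ (by fun_prop)]
  · simp
  · exact Measurable.lintegral_prod_right' (f := fun p : ℝ × Space d => f (a + p.1 • (p.2 - a)))
      (by fun_prop)

/-- A base of a cone without volume has no surface. -/
theorem measure_cell_eq_zero {a n : Space d} {h : ℝ} (hh : 0 < h) (hn : ‖n‖ = 1)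
    {F : Finset (Space d)} (hF : ∀ y ∈ F, inner ℝ n (y - a) = h)
    (h0 : volume (convexHull ℝ (insert a (F : Set (Space d)))) = 0) :
    μHE[d - 1] (cell F) = 0 := by
  rcases F.eq_empty_or_nonempty with rfl | hne
  · simp [cell]
  have e := lintegral_cone hh hn hne hF (fun _ => 1) measurable_const
  simp only [setLIntegral_one, h0] at e
  have := (lintegral_eq_zero_iff (by fun_prop)).1 e.symm
  rw [EventuallyEq, ae_restrict_iff' measurableSet_Ioo] at this
  have h3 : ∃ᵐ t : ℝ, t ∈ Set.Ioo (0 : ℝ) 1 := by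
    rw [Filter.Frequently, ← MeasureTheory.measure_eq_zero_iff_ae_notMem]
    simp
  obtain ⟨t, ht, ht'⟩ := (h3.and_eventually this).exists
  have h4 := ht' ht
  simp only [Pi.zero_apply, mul_eq_zero, ENNReal.ofReal_eq_zero] at h4
  refine h4.resolve_left (not_le.2 ?_)
  have := ht.1
  positivity

/-- Open sets that meet the base of a cone with interior meet it in positive surface measure:
otherwise the cone over the intersection, which contains an open set, would have no volume. -/
theorem measure_inter_cell_pos {a n : Space d} {h : ℝ} (hh : 0 < h) (hn : ‖n‖ = 1)
    {F : Finset (Space d)} (hF : ∀ y ∈ F, inner ℝ n (y - a) = h)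
    (hint : (interior (convexHull ℝ (insert a (F : Set (Space d))))).Nonempty)
    {U : Set (Space d)} (hU : IsOpen U) (hUF : (U ∩ cell F).Nonempty) :
    0 < μHE[d - 1] (U ∩ cell F) := by
  have hne : F.Nonempty := by
    obtain ⟨y, -, hy⟩ := hUF
    by_contra hc
    rw [Finset.not_nonempty_iff_eq_empty] at hc
    simp [hc, cell] at hy
  rw [pos_iff_ne_zero]
  intro h0
  set C := convexHull ℝ (insert a (F : Set (Space d)))
  -- the open cone over `U` with apex `a`
  set W : Set (Space d) := {x | 0 < inner ℝ n (x - a)} ∩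
    {x | a + (h / inner ℝ n (x - a)) • (x - a) ∈ U} with hW
  have hWo : IsOpen W := by
    have h1 : IsOpen {x : Space d | 0 < inner ℝ n (x - a)} :=
      isOpen_lt continuous_const (by fun_prop)
    refine ContinuousOn.isOpen_inter_preimage
      (f := fun x => a + (h / inner ℝ n (x - a)) • (x - a)) ?_ h1 hU
    have hc : Continuous fun x : Space d => inner ℝ n (x - a) := by fun_prop
    exact continuousOn_const.add ((continuousOn_const.div hc.continuousOn
      fun x hx => ne_of_gt hx).smul (by fun_prop))
  have hmem : ∀ t ∈ Set.Ioo (0 : ℝ) 1, ∀ y ∈ cell F, (a + t • (y - a) ∈ W ↔ y ∈ U) := by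
    intro t ht y hy
    have e : inner ℝ n (t • (y - a)) = t * h := by
      rw [inner_smul_right, inner_eq_of_mem_cell hF hy]
    simp only [hW, Set.mem_inter_iff, Set.mem_ofPred_eq, add_sub_cancel_left, e, smul_smul]
    have ht0 := ht.1
    rw [show h / (t * h) * t = 1 by field_simp, one_smul, add_sub_cancel]
    exact ⟨fun h => h.2, fun h => ⟨by positivity, h⟩⟩
  have hvol : volume (W ∩ C) = 0 := by
    have e := lintegral_cone hh hn hne hF (W.indicator 1)
      (measurable_one.indicator hWo.measurableSet)
    rw [lintegral_indicator_one hWo.measurableSet, Measure.restrict_apply hWo.measurableSet] at e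
    rw [e, lintegral_eq_zero_iff' (by
      refine AEMeasurable.mul (by fun_prop) ?_
      have : IsFiniteMeasure ((μHE[d - 1] : Measure (Space d)).restrict (cell F)) :=
        ⟨by simpa using measure_cell_lt_top hn hF⟩
      exact (Measurable.lintegral_prod_right' (f := fun p : ℝ × Space d =>
        W.indicator (1 : Space d → ℝ≥0∞) (a + p.1 • (p.2 - a)))
        ((measurable_one.indicator hWo.measurableSet).comp (by fun_prop))).aemeasurable),
      EventuallyEq, ae_restrict_iff' measurableSet_Ioo]
    refine Eventually.of_forall fun t ht => ?_
    simp only [Pi.zero_apply, mul_eq_zero]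
    right
    have : ∫⁻ y in cell F, W.indicator (1 : Space d → ℝ≥0∞) (a + t • (y - a)) ∂μHE[d - 1] =
        ∫⁻ y in cell F, U.indicator 1 y ∂μHE[d - 1] := by
      refine setLIntegral_congr_fun (measurableSet_cell F) fun y hy => ?_
      by_cases hyU : y ∈ U
      · simp [hyU, (hmem t ht y hy).2 hyU]
      · simp [hyU, mt (hmem t ht y hy).1 hyU]
    rw [this, lintegral_indicator_one hU.measurableSet, Measure.restrict_apply hU.measurableSet, h0]
  obtain ⟨y, hyU, hyF⟩ := hUF
  have hC : Convex ℝ C := convex_convexHull ℝ _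
  have hyC : a + (1 / 2 : ℝ) • (y - a) ∈ C := mem_cone (by norm_num) (by norm_num) hyF
  have hcl : a + (1 / 2 : ℝ) • (y - a) ∈ closure (interior C) := by
    rw [hC.closure_interior_eq_closure_of_nonempty_interior hint]
    exact subset_closure hyC
  have hyW : a + (1 / 2 : ℝ) • (y - a) ∈ W :=
    (hmem (1 / 2) ⟨by norm_num, by norm_num⟩ y hyF).2 hyU
  have hne2 := mem_closure_iff.1 hcl W hWo hyW
  have hpos := (hWo.inter isOpen_interior).measure_pos volume hne2
  exact hpos.ne' (measure_mono_null (Set.inter_subset_inter_right _ interior_subset) hvol)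

/-- The divergence theorem on a cone for the field `ψ(x) (x - a)`, whose normal component vanishes
on the lateral boundary: `h` is the distance from the apex `a` to the base. -/
theorem cone_identity (hd : 0 < d) {a n : Space d} {h : ℝ} (hh : 0 < h) (hn : ‖n‖ = 1)
    {F : Finset (Space d)} (hne : F.Nonempty) (hF : ∀ y ∈ F, inner ℝ n (y - a) = h)
    {ψ : Space d → ℝ} (hψ : ContDiff ℝ 1 ψ) :
    h * ∫ y in cell F, ψ y ∂μHE[d - 1] =
      ∫ x in convexHull ℝ (insert a (F : Set (Space d))), (d * ψ x + fderiv ℝ ψ x (x - a)) := by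
  have hfin : IsFiniteMeasure ((μHE[d - 1] : Measure (Space d)).restrict (cell F)) :=
    ⟨by simpa using measure_cell_lt_top hn hF⟩
  have hcd : Continuous (fderiv ℝ ψ) := hψ.continuous_fderiv one_ne_zero
  have hcψ := hψ.continuous
  have hc : Continuous fun x => (d * ψ x + fderiv ℝ ψ x (x - a)) := by fun_prop
  have hint : IntegrableOn (fun x => (d * ψ x + fderiv ℝ ψ x (x - a)))
      (convexHull ℝ (insert a (F : Set (Space d)))) :=
    hc.continuousOn.integrableOn_compact ((F.finite_toSet.insert a).isCompact_convexHull (𝕜 := ℝ))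
  rw [IntegrableOn, volume_cone_eq hh hn hne hF,
    integrable_map_measure hc.aestronglyMeasurable (by fun_prop)] at hint
  rw [volume_cone_eq hh hn hne hF, integral_map (by fun_prop) hc.aestronglyMeasurable]
  rw [Function.comp_def] at hint
  rw [integral_prod_symm _ hint, ← integral_const_mul]
  congr 1
  ext y
  rw [integral_withDensity_eq_integral_toReal_smul (by fun_prop) (by simp),
    ← integral_Ioc_eq_integral_Ioo, ← intervalIntegral.integral_of_le zero_le_one]
  have hder : ∀ t ∈ Set.uIcc (0 : ℝ) 1, HasDerivAt (fun t : ℝ => h * (t ^ d * ψ (a + t • (y - a))))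
      (h * t ^ (d - 1) * (d * ψ (a + t • (y - a)) +
        fderiv ℝ ψ (a + t • (y - a)) (a + t • (y - a) - a))) t := by
    intro t _
    have h1 : HasDerivAt (fun t : ℝ => a + t • (y - a)) (y - a) t := by
      simpa using ((hasDerivAt_id t).smul_const (y - a)).const_add a
    have h2 := ((hψ.differentiable one_ne_zero (a + t • (y - a))).hasFDerivAt).comp_hasDerivAt t h1
    have h3 := ((hasDerivAt_pow d t).mul h2).const_mul h
    refine h3.congr_deriv ?_
    rw [add_sub_cancel_left, map_smul, smul_eq_mul]
    obtain ⟨m, rfl⟩ : ∃ m, d = m + 1 := ⟨d - 1, by omega⟩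
    simp only [Nat.add_sub_cancel, pow_succ, Function.comp_apply]
    ring
  have hFTC := intervalIntegral.integral_eq_sub_of_hasDerivAt hder (by
    apply Continuous.intervalIntegrable
    fun_prop)
  rw [show h * ψ y = h * (1 ^ d * ψ (a + (1 : ℝ) • (y - a))) -
    h * (0 ^ d * ψ (a + (0 : ℝ) • (y - a))) by simp [hd.ne'], ← hFTC]
  refine intervalIntegral.integral_congr_ae (Eventually.of_forall fun t ht => ?_)
  rw [Set.uIoc_of_le zero_le_one] at ht
  have := ht.1
  rw [ENNReal.toReal_ofReal (by positivity), smul_eq_mul]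

end ConeConsequences

/-! ### The divergence theorem on a simplex -/

section Simplex

variable {d : ℕ}

theorem Continuous.integrableOn_cell {V : Type*} [NormedAddCommGroup V] {f : Space d → V}
    (hf : Continuous f) (T : Finset (Space d)) : IntegrableOn f (cell T) :=
  hf.continuousOn.integrableOn_compact (isCompact_cell T)

/-- `T` is the vertex set of a nondegenerate simplex of full dimension. -/
structure IsSimplex (T : Finset (Space d)) : Prop where
  card_eq : T.card = d + 1
  affineIndependent : AffineIndependent ℝ (fun x : T => (x : Space d))

namespace IsSimplex

variable {T : Finset (Space d)}

/-- The vertices of a simplex as an affine basis; its coordinates are the barycentric ones. -/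
noncomputable def basis (hT : IsSimplex T) : AffineBasis T ℝ (Space d) where
  toFun x := x
  ind' := hT.affineIndependent
  tot' := by
    rw [hT.affineIndependent.affineSpan_eq_top_iff_card_eq_finrank_add_one]
    simp [hT.card_eq]

@[simp] theorem basis_apply (hT : IsSimplex T) (x : T) : hT.basis x = x := rfl

theorem range_basis (hT : IsSimplex T) : Set.range hT.basis = (T : Set (Space d)) := by
  ext x; simp

theorem interior_nonempty (hT : IsSimplex T) : (interior (cell T)).Nonempty := by
  rw [cell, ← hT.range_basis]
  exact ⟨_, hT.basis.centroid_mem_interior_convexHull⟩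

theorem mem_cell_iff (hT : IsSimplex T) {x : Space d} :
    x ∈ cell T ↔ ∀ i : T, 0 ≤ hT.basis.coord i x := by
  rw [cell, ← hT.range_basis, hT.basis.convexHull_eq_nonneg_coord]; rfl

theorem coord_sub (hT : IsSimplex T) (i : T) (x y : Space d) :
    hT.basis.coord i x - hT.basis.coord i y = (hT.basis.coord i).linear (x - y) :=
  ((hT.basis.coord i).linearMap_vsub x y).symm

theorem sum_linear_coord (hT : IsSimplex T) (u : Space d) :
    ∑ i : T, (hT.basis.coord i).linear u = 0 := by
  have h1 := hT.basis.sum_coord_apply_eq_one u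
  have h2 := hT.basis.sum_coord_apply_eq_one 0
  have h3 : ∀ i : T, (hT.basis.coord i).linear u =
      hT.basis.coord i u - hT.basis.coord i 0 := fun i => by rw [coord_sub, sub_zero]
  simp_rw [h3, Finset.sum_sub_distrib, h1, h2, sub_self]

/-- The identity is `∑ (i - x) ⊗ ∇λ_i`, with the barycentric coordinates `λ_i`. -/
theorem sum_linear_coord_smul (hT : IsSimplex T) (u x : Space d) :
    ∑ i : T, (hT.basis.coord i).linear u • ((i : Space d) - x) = u := by
  have h1 := hT.basis.linear_combination_coord_eq_self u
  have h2 := hT.basis.linear_combination_coord_eq_self (0 : Space d)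
  have h3 : ∀ i : T, (hT.basis.coord i).linear u =
      hT.basis.coord i u - hT.basis.coord i 0 := fun i => by rw [coord_sub, sub_zero]
  simp_rw [smul_sub, Finset.sum_sub_distrib, ← Finset.sum_smul, sum_linear_coord, zero_smul,
    sub_zero, h3, sub_smul, Finset.sum_sub_distrib]
  simp only [basis_apply] at h1 h2
  rw [h1, h2, sub_zero]

theorem coord_apply_self (hT : IsSimplex T) (a : T) : hT.basis.coord a (a : Space d) = 1 := by
  have := hT.basis.coord_apply_eq a
  simpa using this

variable [DecidableEq (Space d)]

theorem insert_erase_coe {a : Space d} (ha : a ∈ T) :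
    insert a ((T.erase a : Finset (Space d)) : Set (Space d)) = T := by
  rw [← Finset.coe_insert, Finset.insert_erase ha]

theorem card_erase (hT : IsSimplex T) {a : Space d} (ha : a ∈ T) : (T.erase a).card = d := by
  rw [Finset.card_erase_of_mem ha, hT.card_eq, Nat.add_sub_cancel]

theorem coord_apply_mem_erase (hT : IsSimplex T) (a : T) {x : Space d}
    (hx : x ∈ T.erase (a : Space d)) :
    hT.basis.coord a x = 0 := by
  have hx' := Finset.mem_erase.1 hx
  have := hT.basis.coord_apply_ne (i := a) (j := ⟨x, hx'.2⟩) (by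
    intro h; exact hx'.1 (congrArg Subtype.val h).symm)
  simpa using this

theorem erase_nonempty (hT : IsSimplex T) (hd : 0 < d) {a : Space d} (ha : a ∈ T) :
    (T.erase a).Nonempty := by
  rw [← Finset.card_pos, hT.card_erase ha]; exact hd

theorem linear_coord_self_sub (hT : IsSimplex T) (a : T) {y : Space d}
    (hy : y ∈ T.erase (a : Space d)) : (hT.basis.coord a).linear ((a : Space d) - y) = 1 := by
  rw [← coord_sub, hT.coord_apply_self, hT.coord_apply_mem_erase a hy, sub_zero]

theorem exists_isOutwardNormal (hT : IsSimplex T) (hd : 0 < d) (a : T) :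
    ∃ n, IsOutwardNormal T (T.erase (a : Space d)) n := by
  obtain ⟨y₀, hy₀⟩ := hT.erase_nonempty hd a.2
  set L : Space d →L[ℝ] ℝ := LinearMap.toContinuousLinearMap (hT.basis.coord a).linear
  set g := (InnerProductSpace.toDual ℝ (Space d)).symm L
  have hg : ∀ u, inner ℝ g u = (hT.basis.coord a).linear u := fun u => by
    rw [InnerProductSpace.toDual_symm_apply]; rfl
  have hg0 : g ≠ 0 := by
    intro h0
    have := hg ((a : Space d) - y₀)
    rw [hT.linear_coord_self_sub a hy₀, h0, inner_zero_left] at this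
    exact zero_ne_one this
  have hn : 0 < ‖g‖ := norm_pos_iff.2 hg0
  refine ⟨-(‖g‖⁻¹ • g), ?_, ?_, ?_⟩
  · rw [norm_neg, norm_smul, norm_inv, norm_norm, inv_mul_cancel₀ hn.ne']
  · intro x hx y hy
    rw [inner_neg_left, real_inner_smul_left, hg, ← coord_sub, hT.coord_apply_mem_erase a hx,
      hT.coord_apply_mem_erase a hy]
    simp
  · intro x hx y hy
    rw [inner_neg_left, real_inner_smul_left, hg, ← coord_sub, hT.coord_apply_mem_erase a hy,
      sub_zero]
    have : 0 ≤ hT.basis.coord a x := hT.mem_cell_iff.1 (subset_convexHull ℝ _ hx) a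
    have := mul_nonneg (inv_nonneg.2 hn.le) this
    linarith

theorem isOutwardNormal_outwardNormal (hT : IsSimplex T) (hd : 0 < d) (a : T) :
    IsOutwardNormal T (T.erase (a : Space d)) (outwardNormal T (T.erase (a : Space d))) :=
  Classical.epsilon_spec (hT.exists_isOutwardNormal hd a)

/-- The outward normal on the face opposite to the vertex `a` is `-h ∇λ_a`, where `h` is the height
of the simplex over that face and `λ_a` the barycentric coordinate of `a`. -/
theorem exists_height (hT : IsSimplex T) (hd : 0 < d) (a : T) :
    ∃ h : ℝ, 0 < h ∧
      (∀ y ∈ T.erase (a : Space d),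
        inner ℝ (outwardNormal T (T.erase (a : Space d))) (y - a) = h) ∧
      ∀ u, inner ℝ (outwardNormal T (T.erase (a : Space d))) u =
        -h * (hT.basis.coord a).linear u := by
  obtain ⟨hn, hn1, hn2⟩ := hT.isOutwardNormal_outwardNormal hd a
  set n := outwardNormal T (T.erase (a : Space d))
  obtain ⟨y₀, hy₀⟩ := hT.erase_nonempty hd a.2
  have hlin : ∀ u, inner ℝ n u = -(inner ℝ n (y₀ - a)) * (hT.basis.coord a).linear u := by
    intro u
    conv_lhs => rw [← hT.sum_linear_coord_smul u y₀]
    rw [inner_sum, Finset.sum_eq_single a]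
    · rw [inner_smul_right, ← neg_sub y₀ (a : Space d), inner_neg_right]; ring
    · intro b _ hb
      rw [inner_smul_right, hn1 b (Finset.mem_erase.2 ⟨fun h => hb (Subtype.ext h), b.2⟩) y₀ hy₀,
        mul_zero]
    · simp
  refine ⟨inner ℝ n (y₀ - a), lt_of_le_of_ne ?_ ?_, ?_, hlin⟩
  · have := hn2 a a.2 y₀ hy₀
    rw [← neg_sub, inner_neg_right] at this
    linarith
  · intro h0
    have := hlin n
    rw [← h0, real_inner_self_eq_norm_sq, hn] at this
    simp at this
  · intro y hy
    have := hn1 y hy y₀ hy₀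
    rw [← sub_eq_zero, ← inner_sub_right, sub_sub_sub_cancel_right, this]

/-- The height of the simplex `T` over the face opposite to the vertex `a`. -/
noncomputable def height (hT : IsSimplex T) (hd : 0 < d) (a : T) : ℝ :=
  (hT.exists_height hd a).choose

theorem height_pos (hT : IsSimplex T) (hd : 0 < d) (a : T) : 0 < hT.height hd a :=
  (hT.exists_height hd a).choose_spec.1

theorem inner_outwardNormal_sub (hT : IsSimplex T) (hd : 0 < d) (a : T) :
    ∀ y ∈ T.erase (a : Space d),
      inner ℝ (outwardNormal T (T.erase (a : Space d))) (y - a) = hT.height hd a :=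
  (hT.exists_height hd a).choose_spec.2.1

theorem inner_outwardNormal (hT : IsSimplex T) (hd : 0 < d) (a : T) (u : Space d) :
    inner ℝ (outwardNormal T (T.erase (a : Space d))) u =
      -hT.height hd a * (hT.basis.coord a).linear u :=
  (hT.exists_height hd a).choose_spec.2.2 u

theorem norm_outwardNormal (hT : IsSimplex T) (hd : 0 < d) (a : T) :
    ‖outwardNormal T (T.erase (a : Space d))‖ = 1 :=
  (hT.isOutwardNormal_outwardNormal hd a).1

theorem cell_eq_cone {a : Space d} (ha : a ∈ T) :
    cell T = convexHull ℝ (insert a ((T.erase a : Finset (Space d)) : Set (Space d))) := by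
  rw [insert_erase_coe ha]

/-- The cone identity for a simplex, as the cone over the face opposite to `a`. -/
theorem face_identity (hT : IsSimplex T) (hd : 0 < d) (a : T) {ψ : Space d → ℝ}
    (hψ : ContDiff ℝ 1 ψ) :
    hT.height hd a * ∫ y in cell (T.erase (a : Space d)), ψ y ∂μHE[d - 1] =
      ∫ x in cell T, (d * ψ x + fderiv ℝ ψ x (x - a)) := by
  rw [cell_eq_cone a.2]
  exact cone_identity hd (hT.height_pos hd a) (hT.norm_outwardNormal hd a)
    (hT.erase_nonempty hd a.2) (hT.inner_outwardNormal_sub hd a) hψ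

theorem measure_face_lt_top (hT : IsSimplex T) (hd : 0 < d) (a : T) :
    μHE[d - 1] (cell (T.erase (a : Space d))) < ⊤ :=
  measure_cell_lt_top (hT.norm_outwardNormal hd a) (hT.inner_outwardNormal_sub hd a)

theorem measure_inter_face_pos (hT : IsSimplex T) (hd : 0 < d) (a : T) {U : Set (Space d)}
    (hU : IsOpen U) (hUF : (U ∩ cell (T.erase (a : Space d))).Nonempty) :
    0 < μHE[d - 1] (U ∩ cell (T.erase (a : Space d))) :=
  measure_inter_cell_pos (hT.height_pos hd a) (hT.norm_outwardNormal hd a)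
    (hT.inner_outwardNormal_sub hd a) (by rw [← cell_eq_cone a.2]; exact hT.interior_nonempty)
    hU hUF

theorem volume_cell_eq_zero_of_ssubset (hT : IsSimplex T) {S : Finset (Space d)} (hS : S ⊂ T) :
    volume (cell S) = 0 := by
  obtain ⟨b, hb, hbS⟩ := Finset.exists_of_ssubset hS
  have hsub : cell S ⊆ (affineSpan ℝ (S : Set (Space d)) : Set (Space d)) :=
    convexHull_subset_affineSpan _
  refine measure_mono_null hsub (Measure.addHaar_affineSubspace volume _ fun htop => ?_)
  have hz : ∀ x ∈ affineSpan ℝ (S : Set (Space d)), hT.basis.coord ⟨b, hb⟩ x = 0 := by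
    intro x hx
    have hle : affineSpan ℝ (S : Set (Space d)) ≤
        (AffineSubspace.mk' (0:ℝ) ⊥).comap (hT.basis.coord ⟨b, hb⟩) := by
      rw [affineSpan_le]
      intro y hy
      simp only [AffineSubspace.coe_comap, Set.mem_preimage, SetLike.mem_coe,
        AffineSubspace.mem_mk']
      have := hT.coord_apply_mem_erase ⟨b, hb⟩ (Finset.mem_erase.2
        ⟨fun h : y = b => hbS (h ▸ hy), hS.1 hy⟩)
      simp [this]
    have := hle hx
    simpa [AffineSubspace.mem_comap, AffineSubspace.mem_mk'] using this
  have := hz b (htop ▸ AffineSubspace.mem_top _ _ _)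
  have h1 := hT.coord_apply_self ⟨b, hb⟩
  rw [this] at h1
  exact zero_ne_one h1

theorem measure_cell_eq_zero_of_ssubset_face (hT : IsSimplex T) (hd : 0 < d) (a : T)
    {S : Finset (Space d)} (hS : S ⊂ T.erase (a : Space d)) : μHE[d - 1] (cell S) = 0 := by
  refine measure_cell_eq_zero (hT.height_pos hd a) (hT.norm_outwardNormal hd a)
    (fun y hy => hT.inner_outwardNormal_sub hd a y (hS.1 hy)) ?_
  rw [← Finset.coe_insert]
  refine hT.volume_cell_eq_zero_of_ssubset ?_
  obtain ⟨b, hb, hbS⟩ := Finset.exists_of_ssubset hS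
  have hb' := Finset.mem_erase.1 hb
  refine Finset.ssubset_iff_subset_ne.2 ⟨?_, fun h => ?_⟩
  · exact Finset.insert_subset a.2 (hS.1.trans (Finset.erase_subset _ _))
  · have : b ∈ insert (a : Space d) S := by rw [h]; exact hb'.2
    rcases Finset.mem_insert.1 this with h | h
    · exact hb'.1 h
    · exact hbS h

end IsSimplex

/-- The divergence of a vector field. -/
noncomputable def divergence (u : Space d → Space d) (x : Space d) : ℝ :=
  ∑ i, (fderiv ℝ u x (EuclideanSpace.single i 1)) i

theorem continuous_divergence {u : Space d → Space d} (hu : ContDiff ℝ 1 u) :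
    Continuous (divergence u) := by
  have := hu.continuous_fderiv one_ne_zero
  unfold divergence
  fun_prop

variable {T : Finset (Space d)}

/-- The trace of `A` by means of the derivatives of the barycentric coordinates. -/
theorem IsSimplex.sum_coord_apply (hT : IsSimplex T) (A : Space d →L[ℝ] Space d) (x : Space d) :
    ∑ a : T, (hT.basis.coord a).linear (A (x - a)) =
      -∑ i, (A (EuclideanSpace.single i 1)) i := by
  have h1 : ∀ v : Space d, A v = ∑ j, v j • A (EuclideanSpace.single j 1) := by
    intro v
    conv_lhs => rw [← (EuclideanSpace.basisFun (Fin d) ℝ).sum_repr v]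
    simp
  have h2 : ∀ a : T, (hT.basis.coord a).linear (A (x - a)) =
      -∑ j, ((hT.basis.coord a).linear (A (EuclideanSpace.single j 1)) •
        ((a : Space d) - x)) j := by
    intro a
    rw [h1, map_sum, ← Finset.sum_neg_distrib]
    refine Finset.sum_congr rfl fun j _ => ?_
    simp
    ring
  simp_rw [h2]
  rw [Finset.sum_neg_distrib, Finset.sum_comm]
  congr 1
  refine Finset.sum_congr rfl fun j _ => ?_
  conv_rhs => rw [← hT.sum_linear_coord_smul (A (EuclideanSpace.single j 1)) x]
  simp

variable [DecidableEq (Space d)]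

/-- The divergence theorem on a simplex: with barycentric coordinates `λ_a`, every field `u` is the
sum of the fields `-(∇λ_a · u) (x - a)`, to which the cone identity applies. -/
theorem IsSimplex.divergence_theorem (hT : IsSimplex T) (hd : 0 < d) {u : Space d → Space d}
    (hu : ContDiff ℝ 1 u) :
    ∫ x in cell T, divergence u x =
      ∑ a : T, ∫ y in cell (T.erase (a : Space d)),
        inner ℝ (u y) (outwardNormal T (T.erase (a : Space d))) ∂μHE[d - 1] := by
  have hL : ∀ a : T, ∃ L : Space d →L[ℝ] ℝ, ∀ u, L u = (hT.basis.coord a).linear u :=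
    fun a => ⟨LinearMap.toContinuousLinearMap (hT.basis.coord a).linear, fun _ => rfl⟩
  choose L hL using hL
  have hψ : ∀ a : T, ContDiff ℝ 1 fun x => L a (u x) := fun a => (L a).contDiff.comp hu
  have h1 : ∀ a : T, ∫ y in cell (T.erase (a : Space d)),
        inner ℝ (u y) (outwardNormal T (T.erase (a : Space d))) ∂μHE[d - 1] =
      ∫ x in cell T, -(d * L a (u x) + L a (fderiv ℝ u x (x - a))) := by
    intro a
    have h2 := hT.face_identity hd a (hψ a)
    have h3 : ∀ x, fderiv ℝ (fun x => L a (u x)) x = (L a).comp (fderiv ℝ u x) := fun x =>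
      ((L a).hasFDerivAt.comp x ((hu.differentiable one_ne_zero) x).hasFDerivAt).fderiv
    simp only [h3, ContinuousLinearMap.comp_apply] at h2
    rw [integral_neg, ← h2, ← integral_const_mul, ← integral_neg]
    congr 1
    ext y
    rw [real_inner_comm, hT.inner_outwardNormal hd a, hL]
    ring
  have hcu := hu.continuous
  have hcd := hu.continuous_fderiv one_ne_zero
  simp_rw [h1]
  rw [← integral_finsetSum]
  · refine setIntegral_congr_fun (measurableSet_cell T) fun x _ => ?_
    have h4 := hT.sum_coord_apply (fderiv ℝ u x) x
    have h5 := hT.sum_linear_coord (u x)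
    simp_rw [← hL] at h4 h5
    simp only [divergence]
    rw [Finset.sum_neg_distrib, Finset.sum_add_distrib, ← Finset.mul_sum, h5, h4]
    ring
  · intro a _
    exact Continuous.integrableOn_cell (by fun_prop) T

end Simplex

/-! ### Element and face measures -/

section Measures

variable {d : ℕ}

instance compactSpace_cell (F : Finset (Space d)) : CompactSpace (cell F) :=
  isCompact_iff_compactSpace.1 (isCompact_cell F)

/-- `F` is the vertex set of a face of codimension one of the simplex with vertex set `T`. -/
structure IsFace (T F : Finset (Space d)) : Prop where
  isSimplex : IsSimplex T
  subset : F ⊆ T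
  card_eq : F.card = d
  dim_pos : 0 < d

namespace IsFace

variable {T F : Finset (Space d)}

theorem exists_eq_erase [DecidableEq (Space d)] (h : IsFace T F) :
    ∃ a : T, F = T.erase (a : Space d) := by
  obtain ⟨a, ha, haF⟩ := Finset.exists_of_ssubset (Finset.ssubset_iff_subset_ne.2
    ⟨h.subset, fun e => by have := h.card_eq; rw [e, h.isSimplex.card_eq] at this; omega⟩)
  refine ⟨⟨a, ha⟩, Finset.eq_of_subset_of_card_le (fun x hx => Finset.mem_erase.2
    ⟨fun e : x = a => haF (e ▸ hx), h.subset hx⟩) ?_⟩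
  rw [h.isSimplex.card_erase ha, h.card_eq]

theorem isOutwardNormal (h : IsFace T F) : IsOutwardNormal T F (outwardNormal T F) := by
  classical
  obtain ⟨a, rfl⟩ := h.exists_eq_erase
  exact h.isSimplex.isOutwardNormal_outwardNormal h.dim_pos a

theorem measure_lt_top (h : IsFace T F) : μHE[d - 1] (cell F) < ⊤ := by
  classical
  obtain ⟨a, rfl⟩ := h.exists_eq_erase
  exact h.isSimplex.measure_face_lt_top h.dim_pos a

theorem measure_inter_pos (h : IsFace T F) {U : Set (Space d)} (hU : IsOpen U)
    (hUF : (U ∩ cell F).Nonempty) : 0 < μHE[d - 1] (U ∩ cell F) := by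
  classical
  obtain ⟨a, rfl⟩ := h.exists_eq_erase
  exact h.isSimplex.measure_inter_face_pos h.dim_pos a hU hUF

theorem measure_eq_zero_of_ssubset (h : IsFace T F) {S : Finset (Space d)} (hS : S ⊂ F) :
    μHE[d - 1] (cell S) = 0 := by
  classical
  obtain ⟨a, rfl⟩ := h.exists_eq_erase
  exact h.isSimplex.measure_cell_eq_zero_of_ssubset_face h.dim_pos a hS

theorem isFiniteMeasure (h : IsFace T F) : IsFiniteMeasure (surfaceMeasure F) := by
  refine ⟨?_⟩
  rw [surfaceMeasure, comap_subtype_coe_apply (measurableSet_cell F)]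
  simpa using h.measure_lt_top

theorem isOpenPosMeasure (h : IsFace T F) : (surfaceMeasure F).IsOpenPosMeasure := by
  refine ⟨fun U hU hne => ?_⟩
  obtain ⟨V, hV, rfl⟩ := isOpen_induced_iff.1 hU
  rw [surfaceMeasure, comap_subtype_coe_apply (measurableSet_cell F), Subtype.image_preimage_coe,
    Set.inter_comm]
  refine (h.measure_inter_pos hV ?_).ne'
  obtain ⟨x, hx⟩ := hne
  exact ⟨x, hx, x.2⟩

end IsFace

theorem integral_surfaceMeasure {V : Type*} [NormedAddCommGroup V] [NormedSpace ℝ V]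
    (F : Finset (Space d)) (f : Space d → V) :
    ∫ x : cell F, f x ∂(surfaceMeasure F) = ∫ x in cell F, f x ∂μHE[d - 1] :=
  integral_subtype_comap (measurableSet_cell F) f

theorem integral_volumeMeasure {V : Type*} [NormedAddCommGroup V] [NormedSpace ℝ V]
    (T : Finset (Space d)) (f : Space d → V) :
    ∫ x : cell T, f x ∂(volumeMeasure T) = ∫ x in cell T, f x :=
  integral_subtype_comap (measurableSet_cell T) f

instance isFiniteMeasure_volumeMeasure (T : Finset (Space d)) :
    IsFiniteMeasure (volumeMeasure T) := by
  refine ⟨?_⟩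
  rw [volumeMeasure, comap_subtype_coe_apply (measurableSet_cell T)]
  simpa using (isCompact_cell T).measure_lt_top

theorem IsSimplex.isOpenPosMeasure {T : Finset (Space d)} (h : IsSimplex T) :
    (volumeMeasure T).IsOpenPosMeasure := by
  refine ⟨fun U hU hne => ?_⟩
  obtain ⟨V, hV, rfl⟩ := isOpen_induced_iff.1 hU
  rw [volumeMeasure, comap_subtype_coe_apply (measurableSet_cell T), Subtype.image_preimage_coe]
  obtain ⟨x, hx⟩ := hne
  have hcl : (x : Space d) ∈ closure (interior (cell T)) := by
    rw [(convex_convexHull ℝ _).closure_interior_eq_closure_of_nonempty_interior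
      h.interior_nonempty]
    exact subset_closure x.2
  have hpos := (hV.inter isOpen_interior).measure_pos volume (mem_closure_iff.1 hcl V hV hx)
  exact (hpos.trans_le (measure_mono
    (fun y hy => ⟨interior_subset hy.2, hy.1⟩ : V ∩ interior (cell T) ⊆ cell T ∩ V))).ne'

theorem restrict_interior_cell (T : Finset (Space d)) :
    (volume : Measure (Space d)).restrict (interior (cell T)) = volume.restrict (cell T) :=
  Measure.restrict_congr_set
    (interior_ae_eq_of_null_frontier ((convex_convexHull ℝ _).addHaar_frontier volume))

theorem memLp_two_cell {V : Type*} [NormedAddCommGroup V] {f : Space d → V}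
    (hf : Continuous f) [SecondCountableTopologyEither (Space d) V] (T : Finset (Space d)) :
    MemLp f 2 (volume.restrict (interior (cell T))) := by
  rw [restrict_interior_cell, memLp_two_iff_integrable_sq_norm hf.aestronglyMeasurable]
  exact (hf.norm.pow 2).integrableOn_cell T

theorem memLp_subtype {V : Type*} [NormedAddCommGroup V] {F : Finset (Space d)}
    {f : cell F → V} (hf : Continuous f) {p : ENNReal} (μ : Measure (cell F)) [IsFiniteMeasure μ] :
    MemLp f p μ :=
  hf.memLp_of_hasCompactSupport (HasCompactSupport.of_compactSpace f)

theorem eLpNorm_two_eq_sqrt {α V : Type*} [NormedAddCommGroup V] {mα : MeasurableSpace α}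
    {μ : Measure α} {f : α → V} (hf : MemLp f 2 μ) :
    eLpNorm f 2 μ = ENNReal.ofReal (Real.sqrt (∫ x, ‖f x‖ ^ 2 ∂μ)) := by
  rw [hf.eLpNorm_eq_integral_rpow_norm two_ne_zero ENNReal.ofNat_ne_top]
  simp [Real.sqrt_eq_rpow]

end Measures

/-! ### Traces -/

section Traces

variable {d : ℕ} {T F : Finset (Space d)}

/-- The trace inequality, obtained from the cone identity for the function `‖φ‖²`. -/
theorem IsFace.trace_inequality (h : IsFace T F) : ∃ C : NNReal, ∀ φ : Space d → Space d,
    ContDiff ℝ 1 φ → eLpNorm (fun x : cell F => φ x) 2 (surfaceMeasure F) ≤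
      C * (eLpNorm φ 2 (volume.restrict (interior (cell T))) +
        eLpNorm (fderiv ℝ φ) 2 (volume.restrict (interior (cell T)))) := by
  classical
  have hfin := h.isFiniteMeasure
  obtain ⟨a, rfl⟩ := h.exists_eq_erase
  obtain ⟨R, hR⟩ := (isCompact_cell T).isBounded.exists_norm_le
  have hh := h.isSimplex.height_pos h.dim_pos a
  set H := h.isSimplex.height h.dim_pos a
  set R' := R + ‖(a : Space d)‖ with hR'
  have hRx : ∀ x ∈ cell T, ‖x - a‖ ≤ R' := fun x hx =>
    (norm_sub_le _ _).trans (add_le_add_left (hR x hx) _)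
  have hR0 : 0 ≤ R' := by
    obtain ⟨x, hx⟩ := h.isSimplex.interior_nonempty
    exact (norm_nonneg _).trans (hRx x (interior_subset hx))
  set K := (d + R') / H with hK
  have hK0 : 0 ≤ K := by positivity
  refine ⟨(Real.sqrt K).toNNReal, fun φ hφ => ?_⟩
  have hcφ := hφ.continuous
  have hcd := hφ.continuous_fderiv one_ne_zero
  have m1 := memLp_subtype (p := 2) (f := fun x : cell (T.erase (a : Space d)) => φ x)
    (hcφ.comp continuous_subtype_val) (surfaceMeasure _)
  have m2 := memLp_two_cell hcφ T
  have m3 := memLp_two_cell hcd T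
  rw [eLpNorm_two_eq_sqrt m1, eLpNorm_two_eq_sqrt m2, eLpNorm_two_eq_sqrt m3,
    ← ENNReal.ofReal_add (Real.sqrt_nonneg _) (Real.sqrt_nonneg _),
    show (((Real.sqrt K).toNNReal : NNReal) : ENNReal) = ENNReal.ofReal (Real.sqrt K) from rfl,
    ← ENNReal.ofReal_mul (Real.sqrt_nonneg _)]
  refine ENNReal.ofReal_le_ofReal ?_
  rw [integral_surfaceMeasure _ (fun x => ‖φ x‖ ^ 2), restrict_interior_cell]
  set A := ∫ x in cell (T.erase (a : Space d)), ‖φ x‖ ^ 2 ∂μHE[d - 1]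
  set B := ∫ x in cell T, ‖φ x‖ ^ 2 with hB
  set D := ∫ x in cell T, ‖fderiv ℝ φ x‖ ^ 2 with hD
  have hB0 : 0 ≤ B := integral_nonneg fun x => by positivity
  have hD0 : 0 ≤ D := integral_nonneg fun x => by positivity
  have id1 := h.isSimplex.face_identity h.dim_pos a (ψ := fun x => ‖φ x‖ ^ 2) (hφ.norm_sq ℝ)
  have hder : ∀ x v, fderiv ℝ (fun x => ‖φ x‖ ^ 2) x v = 2 * inner ℝ (φ x) (fderiv ℝ φ x v) := by
    intro x v
    rw [((hφ.differentiable one_ne_zero x).hasFDerivAt.norm_sq).fderiv]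
    simp
  have hle : H * A ≤ (d + R') * B + R' * D := by
    rw [id1, hB, hD, ← integral_const_mul, ← integral_const_mul, ← integral_add
      (Continuous.integrableOn_cell (by fun_prop) T) (Continuous.integrableOn_cell (by fun_prop) T)]
    refine setIntegral_mono_on (Continuous.integrableOn_cell ?_ T)
      (Continuous.integrableOn_cell (by fun_prop) T) (measurableSet_cell T) fun x hx => ?_
    · simp_rw [hder]; fun_prop
    · rw [hder]
      have h1 : inner ℝ (φ x) (fderiv ℝ φ x (x - a)) ≤ ‖φ x‖ * (‖fderiv ℝ φ x‖ * R') :=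
        (real_inner_le_norm _ _).trans (mul_le_mul_of_nonneg_left
          (((fderiv ℝ φ x).le_opNorm _).trans (mul_le_mul_of_nonneg_left (hRx x hx)
            (norm_nonneg _))) (norm_nonneg _))
      nlinarith [mul_nonneg hR0 (sq_nonneg (‖φ x‖ - ‖fderiv ℝ φ x‖))]
  have hA : A ≤ K * (B + D) := by
    rw [hK, div_mul_eq_mul_div, le_div_iff₀ hh]
    nlinarith [mul_nonneg (Nat.cast_nonneg (α := ℝ) d) hD0]
  calc Real.sqrt A ≤ Real.sqrt (K * (B + D)) := Real.sqrt_le_sqrt hA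
    _ = Real.sqrt K * Real.sqrt (B + D) := Real.sqrt_mul hK0 _
    _ ≤ Real.sqrt K * (Real.sqrt B + Real.sqrt D) :=
      mul_le_mul_of_nonneg_left (Real.sqrt_le_iff.2 ⟨by positivity, by
        nlinarith [Real.sq_sqrt hB0, Real.sq_sqrt hD0,
          mul_nonneg (Real.sqrt_nonneg B) (Real.sqrt_nonneg D)]⟩) (Real.sqrt_nonneg _)

variable {V : Type} [NormedAddCommGroup V] [NormedSpace ℝ V]

theorem IsTestFunction.mono {U U' : Set (Space d)} (hU : U ⊆ U') {φ : Space d → V}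
    (hφ : IsTestFunction U φ) : IsTestFunction U' φ := ⟨hφ.1, hφ.2.1, hφ.2.2.trans hU⟩

theorem HasWeakFDeriv.mono {U U' : Set (Space d)} (hU : U ⊆ U') {u : Space d → V}
    {G : Space d → Space d →L[ℝ] V} (h : HasWeakFDeriv U' u G) : HasWeakFDeriv U u G := by
  intro φ hφ e
  have h1 := h φ (hφ.mono hU) e
  have e1 : ∀ x ∉ U, fderiv ℝ φ x = 0 := fun x hx => by
    by_contra hne
    exact hx (hφ.2.2 (support_fderiv_subset ℝ hne))
  have e2 : ∀ x ∉ U, φ x = 0 := fun x hx => by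
    by_contra hne
    exact hx (hφ.2.2 (subset_tsupport _ hne))
  rwa [setIntegral_eq_integral_of_forall_compl_eq_zero (s := U') (fun x hx => by
      rw [e1 x (fun h => hx (hU h))]; simp),
    setIntegral_eq_integral_of_forall_compl_eq_zero (s := U') (fun x hx => by
      rw [e2 x (fun h => hx (hU h))]; simp),
    ← setIntegral_eq_integral_of_forall_compl_eq_zero (s := U) (fun x hx => by
      rw [e1 x hx]; simp),
    ← setIntegral_eq_integral_of_forall_compl_eq_zero (s := U) (f := fun x => φ x • G x e)
      (fun x hx => by rw [e2 x hx]; simp)] at h1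

theorem IsH1Limit.mono {U U' : Set (Space d)} (hU : U ⊆ U') {φ : ℕ → Space d → V}
    {u : Space d → V} (h : IsH1Limit U' φ u) : IsH1Limit U φ u := by
  obtain ⟨G, h1, h2, h3, h4, h5⟩ := h
  have hm := Measure.restrict_mono_set (volume : Measure (Space d)) hU
  exact ⟨G, h1.mono_measure hm, h2.mono_measure hm, h3.mono hU,
    tendsto_of_tendsto_of_tendsto_of_le_of_le tendsto_const_nhds h4 (fun _ => zero_le)
      (fun n => eLpNorm_mono_measure _ hm),
    tendsto_of_tendsto_of_tendsto_of_le_of_le tendsto_const_nhds h5 (fun _ => zero_le)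
      (fun n => eLpNorm_mono_measure _ hm)⟩

/-- Weak derivatives are unique. -/
theorem HasWeakFDeriv.ae_eq [FiniteDimensional ℝ V] {U : Set (Space d)} (hU : IsOpen U)
    (hfin : volume U ≠ ⊤)
    {u : Space d → V} {G G' : Space d → Space d →L[ℝ] V} (h : HasWeakFDeriv U u G)
    (h' : HasWeakFDeriv U u G') (hG : MemLp G 2 (volume.restrict U))
    (hG' : MemLp G' 2 (volume.restrict U)) : G =ᵐ[volume.restrict U] G' := by
  have : IsFiniteMeasure (volume.restrict U) := ⟨by simpa using hfin.lt_top⟩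
  have key : ∀ e, ∀ᵐ x ∂(volume.restrict U), G x e = G' x e := by
    intro e
    have i1 : Integrable (fun x => G x e) (volume.restrict U) :=
      ((hG.integrable one_le_two).apply_continuousLinearMap e)
    have i2 : Integrable (fun x => G' x e) (volume.restrict U) :=
      ((hG'.integrable one_le_two).apply_continuousLinearMap e)
    have := hU.ae_eq_zero_of_integral_contDiff_smul_eq_zero (μ := volume.restrict U)
      (f := fun x => G x e - G' x e)
      ((i1.sub i2).locallyIntegrable.locallyIntegrableOn U) fun g hg hgc hgs => ?_
    · filter_upwards [this, ae_restrict_mem hU.measurableSet] with x hx hxU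
      exact sub_eq_zero.1 (hx hxU)
    · obtain ⟨C, hC⟩ := hgc.exists_bound_of_continuous hg.continuous
      have e1 := h g ⟨hg, hgc, hgs⟩ e
      have e2 := h' g ⟨hg, hgc, hgs⟩ e
      simp_rw [smul_sub]
      rw [integral_sub]
      · rw [e1] at e2; rw [neg_injective e2, sub_self]
      · exact i1.bdd_smul C hg.continuous.aestronglyMeasurable (Eventually.of_forall hC)
      · exact i2.bdd_smul C hg.continuous.aestronglyMeasurable (Eventually.of_forall hC)
  have key2 : ∀ᵐ x ∂(volume.restrict U), ∀ i : Fin d,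
      G x (EuclideanSpace.single i 1) = G' x (EuclideanSpace.single i 1) :=
    ae_all_iff.2 fun i => key _
  filter_upwards [key2] with x hx
  refine ContinuousLinearMap.coe_injective
    ((EuclideanSpace.basisFun (Fin d) ℝ).toBasis.ext fun i => ?_)
  simpa using hx i

/-- Smooth approximations of the same function in `H^1` of a simplex have the same limit in `L^2` of
a face. -/
theorem IsFace.tendsto_trace_sub (h : IsFace T F) {ι : Type*} {l : Filter ι}
    {φ ψ : ι → Space d → Space d} {u : Space d → Space d} {G : Space d → Space d →L[ℝ] Space d}
    (hφ : ∀ i, ContDiff ℝ ∞ (φ i)) (hψ : ∀ i, ContDiff ℝ ∞ (ψ i))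
    (hu : AEStronglyMeasurable u (volume.restrict (interior (cell T))))
    (hG : AEStronglyMeasurable G (volume.restrict (interior (cell T))))
    (h1 : Tendsto (fun i => eLpNorm (fun x => φ i x - u x) 2
      (volume.restrict (interior (cell T)))) l (𝓝 0))
    (h2 : Tendsto (fun i => eLpNorm (fun x => ψ i x - u x) 2
      (volume.restrict (interior (cell T)))) l (𝓝 0))
    (h3 : Tendsto (fun i => eLpNorm (fun x => fderiv ℝ (φ i) x - G x) 2
      (volume.restrict (interior (cell T)))) l (𝓝 0))
    (h4 : Tendsto (fun i => eLpNorm (fun x => fderiv ℝ (ψ i) x - G x) 2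
      (volume.restrict (interior (cell T)))) l (𝓝 0)) :
    Tendsto (fun i => eLpNorm (fun x : cell F => φ i x - ψ i x) 2 (surfaceMeasure F)) l (𝓝 0) := by
  obtain ⟨C, hC⟩ := h.trace_inequality
  have hlim := ENNReal.Tendsto.const_mul ((h1.add h2).add (h3.add h4))
    (Or.inr (ENNReal.coe_ne_top (r := C)))
  simp only [add_zero, mul_zero] at hlim
  refine tendsto_of_tendsto_of_tendsto_of_le_of_le tendsto_const_nhds hlim (fun _ => zero_le)
    fun i => ?_
  have d1 := (hφ i).differentiable (by simp)
  have d2 := (hψ i).differentiable (by simp)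
  have c1 := (hφ i).continuous.aestronglyMeasurable (μ := volume.restrict (interior (cell T)))
  have c2 := (hψ i).continuous.aestronglyMeasurable (μ := volume.restrict (interior (cell T)))
  have c3 := ((hφ i).continuous_fderiv (by simp)).aestronglyMeasurable
    (μ := volume.restrict (interior (cell T)))
  have c4 := ((hψ i).continuous_fderiv (by simp)).aestronglyMeasurable
    (μ := volume.restrict (interior (cell T)))
  refine (hC (fun x => φ i x - ψ i x) (((hφ i).sub (hψ i)).of_le (by simp))).trans ?_
  gcongr
  · have e : (fun x => φ i x - ψ i x) = (fun x => φ i x - u x) - (fun x => ψ i x - u x) := by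
      ext1 x; simp
    rw [e]
    exact eLpNorm_sub_le (c1.sub hu) (c2.sub hu) one_le_two
  · have e : fderiv ℝ (fun x => φ i x - ψ i x) =
        (fun x => fderiv ℝ (φ i) x - G x) - (fun x => fderiv ℝ (ψ i) x - G x) := by
      ext1 x
      rw [fderiv_fun_sub (d1 x) (d2 x)]
      simp
    rw [e]
    exact eLpNorm_sub_le (c3.sub hG) (c4.sub hG) one_le_two

/-- Traces exist: by the trace inequality, the restrictions of the approximations to the face form a
Cauchy sequence. -/
theorem IsFace.exists_trace (h : IsFace T F) {φ : ℕ → Space d → Space d} {u : Space d → Space d}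
    (hφ : ∀ n, ContDiff ℝ ∞ (φ n)) (hu : IsH1Limit (interior (cell T)) φ u) :
    ∃ g : cell F → Space d, MemLp g 2 (surfaceMeasure F) ∧
      Tendsto (fun n => eLpNorm (fun x : cell F => φ n x - g x) 2 (surfaceMeasure F)) atTop
        (𝓝 0) := by
  have hfin := h.isFiniteMeasure
  obtain ⟨G, h1, h2, h3, h4, h5⟩ := hu
  have hm : ∀ n, MemLp (fun x : cell F => φ n x) 2 (surfaceMeasure F) := fun n =>
    memLp_subtype ((hφ n).continuous.comp continuous_subtype_val) _
  have hfst : Tendsto (Prod.fst : ℕ × ℕ → ℕ) atTop atTop := tendsto_fst.mono_left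
    (by rw [prod_atTop_atTop_eq])
  have hsnd : Tendsto (Prod.snd : ℕ × ℕ → ℕ) atTop atTop := tendsto_snd.mono_left
    (by rw [prod_atTop_atTop_eq])
  have hc : CauchySeq fun n => (hm n).toLp := by
    rw [Lp.cauchySeq_Lp_iff_cauchySeq_eLpNorm]
    refine (h.tendsto_trace_sub (l := atTop) (φ := fun p : ℕ × ℕ => φ p.1)
      (ψ := fun p : ℕ × ℕ => φ p.2) (fun p => hφ p.1) (fun p => hφ p.2) h1.1 h2.1 (h4.comp hfst)
      (h4.comp hsnd) (h5.comp hfst) (h5.comp hsnd)).congr fun p => ?_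
    exact eLpNorm_congr_ae ((hm p.1).coeFn_toLp.sub (hm p.2).coeFn_toLp).symm
  obtain ⟨g, hg⟩ := cauchySeq_tendsto_of_complete hc
  refine ⟨g, Lp.memLp g, ?_⟩
  rw [← Lp.toLp_coeFn g (Lp.memLp g), Lp.tendsto_Lp_iff_tendsto_eLpNorm''] at hg
  exact hg

/-- The trace does not depend on the approximation. -/
theorem IsFace.trace_ae_eq (h : IsFace T F) {u : Space d → Space d} {g g' : cell F → Space d}
    (hg : IsTrace T F u g) (hg' : IsTrace T F u g') : g =ᵐ[surfaceMeasure F] g' := by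
  have hfin := h.isFiniteMeasure
  obtain ⟨m, φ, hφ, ⟨G, h1, h2, h3, h4, h5⟩, h6⟩ := hg
  obtain ⟨m', φ', hφ', ⟨G', h1', h2', h3', h4', h5'⟩, h6'⟩ := hg'
  have hGG := h3.ae_eq isOpen_interior
    ((measure_mono interior_subset).trans_lt (isCompact_cell T).measure_lt_top).ne h3' h2 h2'
  have h5'' : Tendsto (fun i => eLpNorm (fun x => fderiv ℝ (φ' i) x - G x) 2
      (volume.restrict (interior (cell T)))) atTop (𝓝 0) := by
    refine h5'.congr fun n => eLpNorm_congr_ae ?_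
    filter_upwards [hGG] with x hx
    rw [hx]
  have key := h.tendsto_trace_sub hφ hφ' h1.1 h2.1 h4 h4' h5 h5''
  have hlim := (h6.add key).add h6'
  simp only [add_zero] at hlim
  have hz : eLpNorm (g - g') 2 (surfaceMeasure F) = 0 := by
    refine le_antisymm (ge_of_tendsto' hlim fun n => ?_) zero_le
    have c1 : AEStronglyMeasurable (fun x : cell F => φ n x) (surfaceMeasure F) :=
      ((hφ n).continuous.comp continuous_subtype_val).aestronglyMeasurable
    have c2 : AEStronglyMeasurable (fun x : cell F => φ' n x) (surfaceMeasure F) :=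
      ((hφ' n).continuous.comp continuous_subtype_val).aestronglyMeasurable
    have e : g - g' = ((fun x : cell F => φ n x - φ' n x) - fun x : cell F => φ n x - g x) +
        fun x : cell F => φ' n x - g' x := by
      ext1 x; simp
    rw [e]
    refine (eLpNorm_add_le ((c1.sub c2).sub (c1.sub m.1)) (c2.sub m'.1) one_le_two).trans ?_
    refine add_le_add_left ?_ _
    refine (eLpNorm_sub_le (c1.sub c2) (c1.sub m.1) one_le_two).trans_eq ?_
    rw [add_comm]
    rfl
  rw [eLpNorm_eq_zero_iff (m.1.sub m'.1) two_ne_zero] at hz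
  filter_upwards [hz] with x hx
  simpa [sub_eq_zero] using hx

end Traces

/-! ### Polynomials -/

section PolynomialAlgebra

open MvPolynomial

variable {d : ℕ}

/-- The polynomials in `d` variables of total degree at most `ℓ`, zero for negative `ℓ`. -/
noncomputable def polyDeg (d : ℕ) (ℓ : ℤ) : Submodule ℝ (MvPolynomial (Fin d) ℝ) :=
  MvPolynomial.restrictSupport ℝ {α : Fin d →₀ ℕ | ((∑ i, α i : ℕ) : ℤ) ≤ ℓ}

theorem mem_polyDeg {ℓ : ℤ} {P : MvPolynomial (Fin d) ℝ} :
    P ∈ polyDeg d ℓ ↔ ∀ α : Fin d →₀ ℕ, coeff α P ≠ 0 → ((∑ i, α i : ℕ) : ℤ) ≤ ℓ := by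
  rw [polyDeg, mem_restrictSupport_iff]
  simp [Set.subset_def]

theorem polyDeg_mono {ℓ ℓ' : ℤ} (h : ℓ ≤ ℓ') : polyDeg d ℓ ≤ polyDeg d ℓ' := fun _ hP =>
  mem_polyDeg.2 fun α hα => (mem_polyDeg.1 hP α hα).trans h

theorem mul_mem_polyDeg {a b : ℤ} {P Q : MvPolynomial (Fin d) ℝ} (hP : P ∈ polyDeg d a)
    (hQ : Q ∈ polyDeg d b) : P * Q ∈ polyDeg d (a + b) := by
  classical
  refine mem_polyDeg.2 fun α hα => ?_
  rw [coeff_mul] at hα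
  obtain ⟨⟨i, j⟩, hij, hne⟩ := Finset.exists_ne_zero_of_sum_ne_zero hα
  have h1 := mem_polyDeg.1 hP i (left_ne_zero_of_mul hne)
  have h2 := mem_polyDeg.1 hQ j (right_ne_zero_of_mul hne)
  rw [Finset.HasAntidiagonal.mem_antidiagonal] at hij
  rw [← hij]
  simp only [Finsupp.add_apply, Finset.sum_add_distrib, Nat.cast_add]
  exact add_le_add h1 h2

theorem C_mem_polyDeg (c : ℝ) : (C c : MvPolynomial (Fin d) ℝ) ∈ polyDeg d 0 := by
  classical
  refine mem_polyDeg.2 fun α hα => ?_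
  rw [coeff_C] at hα
  have : 0 = α := by by_contra h; simp [h] at hα
  simp [← this]

theorem one_mem_polyDeg : (1 : MvPolynomial (Fin d) ℝ) ∈ polyDeg d 0 := by
  simpa using C_mem_polyDeg (d := d) 1

theorem C_mul_mem_polyDeg {ℓ : ℤ} (c : ℝ) {P : MvPolynomial (Fin d) ℝ} (hP : P ∈ polyDeg d ℓ) :
    C c * P ∈ polyDeg d ℓ := by
  simpa using mul_mem_polyDeg (C_mem_polyDeg c) hP

theorem X_mem_polyDeg (i : Fin d) : (X i : MvPolynomial (Fin d) ℝ) ∈ polyDeg d 1 := by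
  classical
  refine mem_polyDeg.2 fun α hα => ?_
  rw [coeff_X] at hα
  have : Finsupp.single i 1 = α := by by_contra h; simp [h] at hα
  simp [← this, Finsupp.single_apply]

theorem X_mul_mem_polyDeg {ℓ : ℤ} (i : Fin d) {P : MvPolynomial (Fin d) ℝ}
    (hP : P ∈ polyDeg d (ℓ - 1)) : X i * P ∈ polyDeg d ℓ := by
  simpa using mul_mem_polyDeg (X_mem_polyDeg i) hP

theorem mem_polyDeg_of_X_mul_mem {ℓ : ℤ} (i : Fin d) {P : MvPolynomial (Fin d) ℝ}
    (hP : X i * P ∈ polyDeg d ℓ) : P ∈ polyDeg d (ℓ - 1) := by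
  refine mem_polyDeg.2 fun α hα => ?_
  have := mem_polyDeg.1 hP (Finsupp.single i 1 + α) (by rwa [coeff_X_mul])
  simp only [Finsupp.add_apply, Finset.sum_add_distrib, Finsupp.single_apply, Finset.sum_ite_eq,
    Finset.mem_univ, if_true] at this
  push_cast at this ⊢
  linarith

theorem pderiv_mem_polyDeg {ℓ : ℤ} (i : Fin d) {P : MvPolynomial (Fin d) ℝ}
    (hP : P ∈ polyDeg d ℓ) : pderiv i P ∈ polyDeg d (ℓ - 1) := by
  refine mem_polyDeg.2 fun α hα => ?_
  rw [coeff_pderiv] at hα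
  have := mem_polyDeg.1 hP (α + Finsupp.single i 1) (left_ne_zero_of_mul hα)
  simp only [Finsupp.add_apply, Finset.sum_add_distrib, Finsupp.single_apply, Finset.sum_ite_eq,
    Finset.mem_univ, if_true] at this
  push_cast at this ⊢
  linarith

theorem finite_degree_le (d : ℕ) (ℓ : ℤ) :
    {α : Fin d →₀ ℕ | ((∑ i, α i : ℕ) : ℤ) ≤ ℓ}.Finite := by
  refine (Set.finite_Iic (Finsupp.equivFunOnFinite.symm fun _ : Fin d => ℓ.toNat)).subset
    fun α hα i => ?_
  have h1 : α i ≤ ∑ i, α i := Finset.single_le_sum (f := fun i => α i) (fun _ _ => Nat.zero_le _)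
    (Finset.mem_univ i)
  have h2 : ((∑ i, α i : ℕ) : ℤ) ≤ ℓ := hα
  simp only [Finsupp.equivFunOnFinite_symm_apply_apply]
  omega

instance finiteDimensional_polyDeg (d : ℕ) (ℓ : ℤ) : FiniteDimensional ℝ (polyDeg d ℓ) :=
  have : Finite {α : Fin d →₀ ℕ | ((∑ i, α i : ℕ) : ℤ) ≤ ℓ} := finite_degree_le d ℓ
  Module.Finite.of_basis (basisRestrictSupport ℝ {α : Fin d →₀ ℕ | ((∑ i, α i : ℕ) : ℤ) ≤ ℓ})

/-- If the field `P + x Q` with `P, Q` of degree at most `ℓ` is divergence free, then the degree of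
`Q` drops: by Euler's identity, the part of degree `ℓ` of the divergence is `(ℓ + d)` times that of
`Q`. -/
theorem mem_polyDeg_of_divergence_eq_zero (hd : 0 < d) {ℓ : ℤ} {P : Fin d → MvPolynomial (Fin d) ℝ}
    {Q : MvPolynomial (Fin d) ℝ} (hP : ∀ i, P i ∈ polyDeg d ℓ) (hQ : Q ∈ polyDeg d ℓ)
    (h : ∑ i, pderiv i (P i + X i * Q) = 0) : Q ∈ polyDeg d (ℓ - 1) := by
  classical
  refine mem_polyDeg.2 fun α hα => ?_
  have hle := mem_polyDeg.1 hQ α hα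
  by_contra hlt
  have heq : ((∑ i, α i : ℕ) : ℤ) = ℓ := by omega
  have hc := congrArg (coeff α) h
  have h1 : ∀ i, coeff α (pderiv i (P i)) = 0 := fun i => by
    by_contra hne
    have := mem_polyDeg.1 (pderiv_mem_polyDeg i (hP i)) α hne
    omega
  have h2 : ∀ i, coeff α (pderiv i (X i * Q)) = (1 + α i) * coeff α Q := fun i => by
    rw [coeff_pderiv, add_comm α, coeff_X_mul]
    simp [add_comm, mul_comm]
  simp only [map_add, coeff_sum, coeff_add, h1, h2, zero_add, coeff_zero, ← Finset.sum_mul] at hc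
  have hpos : 0 < ∑ i : Fin d, (1 + (α i : ℝ)) := by
    have : Nonempty (Fin d) := ⟨⟨0, hd⟩⟩
    exact Finset.sum_pos (fun i _ => by positivity) Finset.univ_nonempty
  exact hα ((mul_eq_zero.1 hc).resolve_left hpos.ne')

/-- Composition with the affine map `x ↦ x - L(x) e`. -/
noncomputable def projHom (L : MvPolynomial (Fin d) ℝ) (e : Space d) :
    MvPolynomial (Fin d) ℝ →ₐ[ℝ] MvPolynomial (Fin d) ℝ :=
  aeval fun i => X i - C (e i) * L

/-- The case of monomials, by the product rule for `P ↦ P - projHom L e P`. -/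
theorem projHom_monomial {L : MvPolynomial (Fin d) ℝ} (hL : L ∈ polyDeg d 1) (e : Space d)
    (α : Fin d →₀ ℕ) :
    projHom L e (monomial α 1) ∈ polyDeg d (∑ i, α i : ℕ) ∧
      ∃ R ∈ polyDeg d ((∑ i, α i : ℕ) - 1), monomial α 1 - projHom L e (monomial α 1) = L * R := by
  have hmul : ∀ {a b : ℤ} {P Q : MvPolynomial (Fin d) ℝ},
      (P ∈ polyDeg d a ∧ projHom L e P ∈ polyDeg d a ∧
        ∃ R ∈ polyDeg d (a - 1), P - projHom L e P = L * R) →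
      (Q ∈ polyDeg d b ∧ projHom L e Q ∈ polyDeg d b ∧
        ∃ R ∈ polyDeg d (b - 1), Q - projHom L e Q = L * R) →
      (P * Q ∈ polyDeg d (a + b) ∧ projHom L e (P * Q) ∈ polyDeg d (a + b) ∧
        ∃ R ∈ polyDeg d (a + b - 1), P * Q - projHom L e (P * Q) = L * R) := by
    rintro a b P Q ⟨h1, h2, R, h3, h4⟩ ⟨h1', h2', R', h3', h4'⟩
    refine ⟨mul_mem_polyDeg h1 h1', by rw [map_mul]; exact mul_mem_polyDeg h2 h2',
      R * Q + projHom L e P * R', ?_, ?_⟩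
    · refine Submodule.add_mem _ ?_ ?_
      · simpa [sub_add_eq_add_sub] using mul_mem_polyDeg h3 h1'
      · simpa [add_sub_assoc] using mul_mem_polyDeg h2 h3'
    · rw [map_mul]
      linear_combination Q * h4 + projHom L e P * h4'
  have hone : (1 : MvPolynomial (Fin d) ℝ) ∈ polyDeg d 0 ∧ projHom L e 1 ∈ polyDeg d 0 ∧
        ∃ R ∈ polyDeg d (0 - 1), 1 - projHom L e 1 = L * R :=
    ⟨one_mem_polyDeg, by rw [map_one]; exact one_mem_polyDeg, 0, Submodule.zero_mem _, by simp⟩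
  have hX : ∀ i, (X i : MvPolynomial (Fin d) ℝ) ∈ polyDeg d 1 ∧ projHom L e (X i) ∈ polyDeg d 1 ∧
        ∃ R ∈ polyDeg d (1 - 1), X i - projHom L e (X i) = L * R := by
    intro i
    refine ⟨X_mem_polyDeg i, ?_, C (e i), C_mem_polyDeg _, ?_⟩
    · rw [projHom, aeval_X]
      exact Submodule.sub_mem _ (X_mem_polyDeg i) (C_mul_mem_polyDeg _ hL)
    · rw [projHom, aeval_X]; ring
  have hpow : ∀ (i : Fin d) (n : ℕ), (X i ^ n : MvPolynomial (Fin d) ℝ) ∈ polyDeg d n ∧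
        projHom L e (X i ^ n) ∈ polyDeg d n ∧
        ∃ R ∈ polyDeg d ((n : ℤ) - 1), X i ^ n - projHom L e (X i ^ n) = L * R := by
    intro i n
    induction n with
    | zero => simpa using hone
    | succ n ih =>
      rw [pow_succ]
      push_cast
      exact hmul ih (hX i)
  have hprod : ∀ s : Finset (Fin d),
      (∏ i ∈ s, X i ^ α i : MvPolynomial (Fin d) ℝ) ∈ polyDeg d (∑ i ∈ s, α i : ℕ) ∧
        projHom L e (∏ i ∈ s, X i ^ α i) ∈ polyDeg d (∑ i ∈ s, α i : ℕ) ∧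
        ∃ R ∈ polyDeg d ((∑ i ∈ s, α i : ℕ) - 1),
          ∏ i ∈ s, X i ^ α i - projHom L e (∏ i ∈ s, X i ^ α i) = L * R := by
    classical
    intro s
    induction s using Finset.induction_on with
    | empty => simpa using hone
    | insert i s hi ih =>
      rw [Finset.prod_insert hi, Finset.sum_insert hi, Nat.cast_add]
      exact hmul (hpow i _) ih
  have e : (monomial α (1 : ℝ) : MvPolynomial (Fin d) ℝ) = ∏ i, X i ^ α i := by
    rw [monomial_eq, Finsupp.prod_fintype _ _ (by simp)]; simp
  rw [e]
  exact (hprod Finset.univ).2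

/-- A polynomial differs from its composition with `x ↦ x - L(x) e` by a multiple of `L`. -/
theorem exists_sub_projHom_eq {L : MvPolynomial (Fin d) ℝ} (hL : L ∈ polyDeg d 1) (e : Space d)
    {ℓ : ℤ} {P : MvPolynomial (Fin d) ℝ} (hP : P ∈ polyDeg d ℓ) :
    ∃ R ∈ polyDeg d (ℓ - 1), P - projHom L e P = L * R := by
  rw [polyDeg, restrictSupport_eq_span] at hP
  induction hP using Submodule.span_induction with
  | mem x hx =>
    obtain ⟨α, hα, rfl⟩ := hx
    obtain ⟨-, R, hR, h⟩ := projHom_monomial hL e α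
    exact ⟨R, polyDeg_mono (sub_le_sub_right hα 1) hR, h⟩
  | zero => exact ⟨0, Submodule.zero_mem _, by simp⟩
  | add x y _ _ hx hy =>
    obtain ⟨R, hR, h⟩ := hx
    obtain ⟨R', hR', h'⟩ := hy
    exact ⟨R + R', Submodule.add_mem _ hR hR', by rw [map_add]; linear_combination h + h'⟩
  | smul c x _ hx =>
    obtain ⟨R, hR, h⟩ := hx
    exact ⟨c • R, Submodule.smul_mem _ c hR, by rw [map_smul, ← smul_sub, h, mul_smul_comm]⟩

end PolynomialAlgebra

section PolynomialFunctions

open MvPolynomial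

variable {d : ℕ}

/-- The function on `ℝ^d` defined by a polynomial. -/
noncomputable def polyEval (P : MvPolynomial (Fin d) ℝ) (x : Space d) : ℝ :=
  MvPolynomial.eval (fun i => x i) P

@[simp] theorem polyEval_add (P Q : MvPolynomial (Fin d) ℝ) (x : Space d) :
    polyEval (P + Q) x = polyEval P x + polyEval Q x := map_add _ _ _

@[simp] theorem polyEval_mul (P Q : MvPolynomial (Fin d) ℝ) (x : Space d) :
    polyEval (P * Q) x = polyEval P x * polyEval Q x := map_mul _ _ _

@[simp] theorem polyEval_C (c : ℝ) (x : Space d) : polyEval (C c) x = c := eval_C _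

@[simp] theorem polyEval_X (i : Fin d) (x : Space d) : polyEval (X i) x = x i := eval_X _

@[simp] theorem polyEval_zero (x : Space d) : polyEval 0 x = 0 := map_zero _

@[simp] theorem polyEval_smul (c : ℝ) (P : MvPolynomial (Fin d) ℝ) (x : Space d) :
    polyEval (c • P) x = c * polyEval P x := smul_eval _ _ _

@[simp] theorem polyEval_sum {ι : Type*} (s : Finset ι) (P : ι → MvPolynomial (Fin d) ℝ)
    (x : Space d) : polyEval (∑ i ∈ s, P i) x = ∑ i ∈ s, polyEval (P i) x := map_sum _ _ _

theorem polyEval_projHom (L : MvPolynomial (Fin d) ℝ) (e : Space d) (P : MvPolynomial (Fin d) ℝ)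
    (x : Space d) : polyEval (projHom L e P) x = polyEval P (x - polyEval L x • e) := by
  induction P using MvPolynomial.induction_on with
  | C c => simp [projHom, polyEval]
  | add p q hp hq => simp only [map_add, polyEval_add, hp, hq]
  | mul_X p i hp =>
    rw [map_mul, polyEval_mul, polyEval_mul, hp, polyEval_X]
    congr 1
    simp [projHom, polyEval, mul_comm]

theorem hasFDerivAt_polyEval (P : MvPolynomial (Fin d) ℝ) (x : Space d) :
    HasFDerivAt (polyEval P)
      (∑ i, polyEval (pderiv i P) x • (EuclideanSpace.proj i : Space d →L[ℝ] ℝ)) x := by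
  classical
  induction P using MvPolynomial.induction_on with
  | C c =>
    have e : polyEval (C c : MvPolynomial (Fin d) ℝ) = fun _ => c := funext fun x => by simp
    rw [e]
    simpa using hasFDerivAt_const c x
  | add p q hp hq =>
    have e : polyEval (p + q) = fun x => polyEval p x + polyEval q x := funext fun x => by simp
    rw [e]
    simp only [map_add, polyEval_add, add_smul, Finset.sum_add_distrib]
    exact hp.add hq
  | mul_X p i hp =>
    have e : polyEval (p * X i) = fun x =>
        polyEval p x * (EuclideanSpace.proj i : Space d →L[ℝ] ℝ) x := funext fun x => by simp
    rw [e]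
    refine (hp.mul (EuclideanSpace.proj i : Space d →L[ℝ] ℝ).hasFDerivAt).congr_fderiv ?_
    ext v
    simp [pderiv_X, Pi.single_apply, Finset.sum_add_distrib, add_mul, Finset.mul_sum]
    congr 1
    · rw [Finset.sum_eq_single i]
      · simp
      · intro j _ hj; simp [hj.symm]
      · simp
    · refine Finset.sum_congr rfl fun j _ => ?_
      ring

theorem contDiff_polyEval (P : MvPolynomial (Fin d) ℝ) {n : ℕ∞ω} : ContDiff ℝ n (polyEval P) := by
  induction P using MvPolynomial.induction_on with
  | C c =>
    have e : polyEval (C c : MvPolynomial (Fin d) ℝ) = fun _ => c := funext fun x => by simp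
    rw [e]; exact contDiff_const
  | add p q hp hq =>
    have e : polyEval (p + q) = fun x => polyEval p x + polyEval q x := funext fun x => by simp
    rw [e]; exact hp.add hq
  | mul_X p i hp =>
    have e : polyEval (p * X i) = fun x =>
        polyEval p x * (EuclideanSpace.proj i : Space d →L[ℝ] ℝ) x := funext fun x => by simp
    rw [e]; exact hp.mul (EuclideanSpace.proj i : Space d →L[ℝ] ℝ).contDiff

@[fun_prop]
theorem continuous_polyEval (P : MvPolynomial (Fin d) ℝ) : Continuous (polyEval P) :=
  (contDiff_polyEval P (n := 0)).continuous

theorem fderiv_polyEval (P : MvPolynomial (Fin d) ℝ) (x v : Space d) :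
    fderiv ℝ (polyEval P) x v = ∑ i, v i * polyEval (pderiv i P) x := by
  rw [(hasFDerivAt_polyEval P x).fderiv]
  simp [mul_comm]

/-- A polynomial that vanishes on a set with interior is zero. -/
theorem eq_zero_of_polyEval_eq_zero {S : Set (Space d)} (hS : (interior S).Nonempty)
    {P : MvPolynomial (Fin d) ℝ} (h : ∀ x ∈ S, polyEval P x = 0) : P = 0 := by
  obtain ⟨x, hx⟩ := hS
  have hU : IsOpen ((fun y : Fin d → ℝ => (WithLp.toLp 2 y : Space d)) ⁻¹' interior S) :=
    isOpen_interior.preimage (PiLp.continuous_toLp 2 _)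
  obtain ⟨ε, hε, hb⟩ := Metric.isOpen_iff.1 hU (fun i => x i) hx
  refine MvPolynomial.funext_set (fun i => Metric.ball (x i) ε) (fun i => ?_) fun y hy => ?_
  · rw [Real.ball_eq_Ioo]
    exact Set.Ioo_infinite (by linarith)
  · rw [map_zero]
    have hy' : y ∈ Metric.ball (fun i => x i) ε := by
      rw [← ball_pi _ hε] at *; exact hy
    exact h _ (interior_subset (hb hy'))

/-- The vector field on `ℝ^d` whose components are the given polynomials. -/
noncomputable def polyField (R : Fin d → MvPolynomial (Fin d) ℝ) (x : Space d) : Space d :=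
  WithLp.toLp 2 fun i => polyEval (R i) x

@[simp] theorem polyField_apply (R : Fin d → MvPolynomial (Fin d) ℝ) (x : Space d) (i : Fin d) :
    polyField R x i = polyEval (R i) x := rfl

theorem contDiff_polyField (R : Fin d → MvPolynomial (Fin d) ℝ) {n : ℕ∞ω} :
    ContDiff ℝ n (polyField R) :=
  (contDiff_euclidean).2 fun i => contDiff_polyEval (R i)

@[fun_prop]
theorem continuous_polyField (R : Fin d → MvPolynomial (Fin d) ℝ) : Continuous (polyField R) :=
  (contDiff_polyField R (n := 0)).continuous

theorem fderiv_apply_coord {u : Space d → Space d} {x : Space d} (hu : DifferentiableAt ℝ u x)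
    (v : Space d) (i : Fin d) : (fderiv ℝ u x v) i = fderiv ℝ (fun y => u y i) x v := by
  have := ((EuclideanSpace.proj i : Space d →L[ℝ] ℝ).hasFDerivAt.comp x hu.hasFDerivAt).fderiv
  have e : (fun y => u y i) = (EuclideanSpace.proj i : Space d →L[ℝ] ℝ) ∘ u := rfl
  rw [e, this]
  rfl

theorem divergence_polyField (R : Fin d → MvPolynomial (Fin d) ℝ) (x : Space d) :
    divergence (polyField R) x = polyEval (∑ i, pderiv i (R i)) x := by
  rw [divergence, polyEval_sum]
  refine Finset.sum_congr rfl fun i _ => ?_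
  rw [fderiv_apply_coord ((contDiff_polyField R (n := 1)).differentiable one_ne_zero x)]
  have : (fun y => polyField R y i) = polyEval (R i) := rfl
  rw [this, fderiv_polyEval, Finset.sum_eq_single i] <;> simp +contextual

theorem divergence_polyEval_smul (Q : MvPolynomial (Fin d) ℝ) {u : Space d → Space d}
    (hu : ContDiff ℝ 1 u) (x : Space d) :
    divergence (fun y => polyEval Q y • u y) x =
      polyEval Q x * divergence u x + inner ℝ (u x) (polyField (fun i => pderiv i Q) x) := by
  have hd := hu.differentiable one_ne_zero x
  have h1 := ((contDiff_polyEval Q (n := 1)).differentiable one_ne_zero x).hasFDerivAt.smul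
    hd.hasFDerivAt
  simp only [divergence]
  have e : fderiv ℝ (fun y => polyEval Q y • u y) x = _ := h1.fderiv
  rw [e, PiLp.inner_apply, Finset.mul_sum, ← Finset.sum_add_distrib]
  refine Finset.sum_congr rfl fun i _ => ?_
  have e2 : fderiv ℝ (polyEval Q) x (EuclideanSpace.single i 1) = polyEval (pderiv i Q) x := by
    rw [fderiv_polyEval, Finset.sum_eq_single i] <;> simp +contextual
  simp [e2]

theorem inner_polyField (R : Fin d → MvPolynomial (Fin d) ℝ) (n x : Space d) :
    inner ℝ (polyField R x) n = polyEval (∑ i, C (n i) * R i) x := by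
  simp [PiLp.inner_apply]

end PolynomialFunctions

/-! ### Polynomial spaces on elements and faces -/

section CellSpaces

open MvPolynomial

variable {d : ℕ}

theorem mem_polySpace_iff {ℓ : ℤ} {Y : Set (Space d)} {f : Y → ℝ} :
    f ∈ polySpace ℓ Y ↔ ∃ P ∈ polyDeg d ℓ, f = fun x : Y => polyEval P x :=
  ⟨fun ⟨P, hP, h⟩ => ⟨P, hP, h.symm⟩, fun ⟨P, hP, h⟩ => ⟨P, hP, h.symm⟩⟩

theorem polyEval_mem_polySpace {ℓ : ℤ} (Y : Set (Space d)) {P : MvPolynomial (Fin d) ℝ}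
    (hP : P ∈ polyDeg d ℓ) : (fun x : Y => polyEval P x) ∈ polySpace ℓ Y :=
  mem_polySpace_iff.2 ⟨P, hP, rfl⟩

theorem continuous_of_mem_polySpace {ℓ : ℤ} {Y : Set (Space d)} {f : Y → ℝ}
    (hf : f ∈ polySpace ℓ Y) : Continuous f := by
  obtain ⟨P, -, rfl⟩ := mem_polySpace_iff.1 hf
  fun_prop

theorem mem_rtnSpace_iff {ℓ : ℤ} {Y : Set (Space d)} {v : Y → Space d} :
    v ∈ rtnSpace ℓ Y ↔ ∃ (P : Fin d → MvPolynomial (Fin d) ℝ) (Q : MvPolynomial (Fin d) ℝ),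
      (∀ i, P i ∈ polyDeg d (ℓ - 1)) ∧ Q ∈ polyDeg d (ℓ - 1) ∧
        v = fun x : Y => polyField (fun i => P i + X i * Q) x := by
  rw [rtnSpace, Submodule.mem_sup]
  constructor
  · rintro ⟨p, hp, -, ⟨q, hq, rfl⟩, rfl⟩
    choose P hP hPe using fun i => mem_polySpace_iff.1 (hp i)
    obtain ⟨Q, hQ, rfl⟩ := mem_polySpace_iff.1 hq
    refine ⟨P, Q, hP, hQ, ?_⟩
    ext x i
    have := congrFun (hPe i) x
    simp only at this
    simp [mulPosition, this, mul_comm]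
  · rintro ⟨P, Q, hP, hQ, rfl⟩
    refine ⟨fun x => polyField P x, fun i => polyEval_mem_polySpace Y (hP i), _,
      ⟨_, polyEval_mem_polySpace Y hQ, rfl⟩, ?_⟩
    ext x i
    simp [mulPosition, mul_comm]

theorem continuous_of_mem_rtnSpace {ℓ : ℤ} {Y : Set (Space d)} {v : Y → Space d}
    (hv : v ∈ rtnSpace ℓ Y) : Continuous v := by
  obtain ⟨P, Q, -, -, rfl⟩ := mem_rtnSpace_iff.1 hv
  fun_prop

instance finiteDimensional_polySpace (ℓ : ℤ) (Y : Set (Space d)) :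
    FiniteDimensional ℝ (polySpace ℓ Y) :=
  inferInstanceAs (FiniteDimensional ℝ ((polyDeg d ℓ).map (restrictPoly Y)))

/-- The pairs `(P, Q)` that represent the fields `P + x Q` of a Raviart--Thomas--Nédélec space. -/
abbrev RTNPair (d : ℕ) (ℓ : ℤ) : Type := (Fin d → polyDeg d ℓ) × polyDeg d ℓ

/-- The components of the polynomial field `P + x Q`. -/
noncomputable def RTNPair.field {ℓ : ℤ} (p : RTNPair d ℓ) (i : Fin d) : MvPolynomial (Fin d) ℝ :=
  (p.1 i : MvPolynomial (Fin d) ℝ) + X i * (p.2 : MvPolynomial (Fin d) ℝ)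

/-- The linear parametrization of the fields `P + x Q` on `Y` by the pairs `(P, Q)`. -/
noncomputable def rtnMap (ℓ : ℤ) (Y : Set (Space d)) : RTNPair d ℓ →ₗ[ℝ] (Y → Space d) where
  toFun p x := polyField p.field x
  map_add' p q := by ext x i; simp [RTNPair.field]; ring
  map_smul' c p := by ext x i; simp [RTNPair.field]; ring

theorem rtnMap_mem (ℓ : ℤ) (Y : Set (Space d)) (p : RTNPair d (ℓ - 1)) :
    rtnMap (ℓ - 1) Y p ∈ rtnSpace ℓ Y :=
  mem_rtnSpace_iff.2 ⟨fun i => p.1 i, p.2, fun i => (p.1 i).2, p.2.2, rfl⟩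

theorem exists_rtnMap_eq {ℓ : ℤ} {Y : Set (Space d)} {v : Y → Space d} (hv : v ∈ rtnSpace ℓ Y) :
    ∃ p, rtnMap (ℓ - 1) Y p = v := by
  obtain ⟨P, Q, hP, hQ, rfl⟩ := mem_rtnSpace_iff.1 hv
  exact ⟨(fun i => ⟨P i, hP i⟩, ⟨Q, hQ⟩), rfl⟩

instance finiteDimensional_rtnSpace (ℓ : ℤ) (Y : Set (Space d)) :
    FiniteDimensional ℝ (rtnSpace ℓ Y) := by
  have : rtnSpace ℓ Y = LinearMap.range (rtnMap (ℓ - 1) Y) := by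
    ext v
    exact ⟨fun hv => exists_rtnMap_eq hv, by rintro ⟨p, rfl⟩; exact rtnMap_mem ℓ Y p⟩
  rw [this]
  infer_instance

theorem integrable_of_continuous_cell {V : Type*} [NormedAddCommGroup V] {F : Finset (Space d)}
    {μ : Measure (cell F)} [IsFiniteMeasure μ] {f : cell F → V} (hf : Continuous f) :
    Integrable f μ :=
  hf.integrable_of_hasCompactSupport (HasCompactSupport.of_compactSpace f)

theorem integrable_mul_of_mem_polySpace {ℓ : ℤ} {F : Finset (Space d)}
    {μ : Measure (cell F)} {q r : cell F → ℝ} (hq : Integrable q μ)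
    (hr : r ∈ polySpace ℓ (cell F)) : Integrable (fun x => q x * r x) μ := by
  have hc := continuous_of_mem_polySpace hr
  obtain ⟨C, hC⟩ := (HasCompactSupport.of_compactSpace r).exists_bound_of_continuous hc
  exact hq.mul_bdd hc.aestronglyMeasurable (Eventually.of_forall hC)

theorem eq_zero_of_integral_mul_self {F : Finset (Space d)} {μ : Measure (cell F)}
    [IsFiniteMeasure μ] [μ.IsOpenPosMeasure] {f : cell F → ℝ} (hf : Continuous f)
    (h : ∫ x, f x * f x ∂μ = 0) : f = 0 := by
  rw [integral_eq_zero_iff_of_nonneg (fun x => mul_self_nonneg (f x))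
    (integrable_of_continuous_cell (hf.mul hf))] at h
  have := (Continuous.ae_eq_iff_eq μ (hf.mul hf) continuous_zero).1 h
  ext x
  exact mul_self_eq_zero.1 (congrFun this x)

theorem eq_zero_of_integral_inner_self {F : Finset (Space d)} {μ : Measure (cell F)}
    [IsFiniteMeasure μ] [μ.IsOpenPosMeasure] {f : cell F → Space d} (hf : Continuous f)
    (h : ∫ x, inner ℝ (f x) (f x) ∂μ = 0) : f = 0 := by
  rw [integral_eq_zero_iff_of_nonneg (fun x => real_inner_self_nonneg)
    (integrable_of_continuous_cell (hf.inner hf))] at h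
  have := (Continuous.ae_eq_iff_eq μ (hf.inner hf) continuous_zero).1 h
  ext1 x
  exact inner_self_eq_zero.1 (congrFun this x)

/-- The moments `r ↦ ∫ q r` of an integrable function against polynomials of degree at most `ℓ`. -/
noncomputable def momentFunctional (ℓ : ℤ) {F : Finset (Space d)} {μ : Measure (cell F)}
    {q : cell F → ℝ} (hq : Integrable q μ) : Module.Dual ℝ (polySpace ℓ (cell F)) where
  toFun r := ∫ x, q x * r.1 x ∂μ
  map_add' r s := by
    simp only [Submodule.coe_add, Pi.add_apply, mul_add]
    exact integral_add (integrable_mul_of_mem_polySpace hq r.2)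
      (integrable_mul_of_mem_polySpace hq s.2)
  map_smul' c r := by
    simp only [Submodule.coe_smul, Pi.smul_apply, smul_eq_mul, RingHom.id_apply,
      ← integral_const_mul]
    congr 1
    ext x
    ring

/-- A bilinear form without isotropic vectors on a finite-dimensional space represents every linear
form. -/
theorem exists_riesz {V : Type*} [AddCommGroup V] [Module ℝ V] [FiniteDimensional ℝ V]
    (B : V →ₗ[ℝ] Module.Dual ℝ V) (hB : ∀ v, B v v = 0 → v = 0) (f : Module.Dual ℝ V) :
    ∃ v, B v = f := by
  have hinj : Function.Injective B := by
    rw [← LinearMap.ker_eq_bot, LinearMap.ker_eq_bot']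
    intro v hv
    exact hB v (by rw [hv]; rfl)
  exact (LinearMap.injective_iff_surjective_of_finrank_eq_finrank
    (Subspace.dual_finrank_eq (K := ℝ) (V := V)).symm).1 hinj f

theorem exists_polySpace_moments (ℓ : ℤ) {F : Finset (Space d)} {μ : Measure (cell F)}
    [IsFiniteMeasure μ] [μ.IsOpenPosMeasure] (f : Module.Dual ℝ (polySpace ℓ (cell F))) :
    ∃ p : polySpace ℓ (cell F), ∀ r : polySpace ℓ (cell F), ∫ x, p.1 x * r.1 x ∂μ = f r := by
  have hi : ∀ p : polySpace ℓ (cell F), Integrable p.1 μ := fun p =>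
    integrable_of_continuous_cell (continuous_of_mem_polySpace p.2)
  let B : polySpace ℓ (cell F) →ₗ[ℝ] Module.Dual ℝ (polySpace ℓ (cell F)) :=
    { toFun := fun p => momentFunctional ℓ (hi p)
      map_add' := fun p q => by
        ext r
        simp only [momentFunctional, LinearMap.coe_mk, AddHom.coe_mk, Submodule.coe_add,
          Pi.add_apply, add_mul, LinearMap.add_apply]
        exact integral_add (integrable_mul_of_mem_polySpace (hi p) r.2)
          (integrable_mul_of_mem_polySpace (hi q) r.2)
      map_smul' := fun c p => by
        ext r
        simp only [momentFunctional, LinearMap.coe_mk, AddHom.coe_mk, Submodule.coe_smul,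
          Pi.smul_apply, smul_eq_mul, LinearMap.smul_apply, RingHom.id_apply, mul_assoc,
          ← integral_const_mul] }
  obtain ⟨p, hp⟩ := exists_riesz B (fun p hp => Subtype.ext
    (eq_zero_of_integral_mul_self (continuous_of_mem_polySpace p.2) hp)) f
  exact ⟨p, fun r => congrArg (fun g => g r) hp⟩

theorem exists_isL2Proj (ℓ : ℤ) {F : Finset (Space d)} {μ : Measure (cell F)}
    [IsFiniteMeasure μ] [μ.IsOpenPosMeasure] {q : cell F → ℝ} (hq : Integrable q μ) :
    ∃ p, IsL2Proj ℓ (cell F) μ q p := by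
  obtain ⟨p, hp⟩ := exists_polySpace_moments ℓ (μ := μ) (momentFunctional ℓ hq)
  exact ⟨p, p.2, fun r hr => hp ⟨r, hr⟩⟩

/-- Projections of functions that agree almost everywhere are equal as functions: polynomials are
continuous and the measure charges open sets. -/
theorem IsL2Proj.unique {ℓ : ℤ} {F : Finset (Space d)} {μ : Measure (cell F)}
    [IsFiniteMeasure μ] [μ.IsOpenPosMeasure] {q q' p p' : cell F → ℝ} (hqq : q =ᵐ[μ] q')
    (h : IsL2Proj ℓ (cell F) μ q p) (h' : IsL2Proj ℓ (cell F) μ q' p') : p = p' := by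
  have hc := continuous_of_mem_polySpace h.1
  have hc' := continuous_of_mem_polySpace h'.1
  have hm := (polySpace ℓ (cell F)).sub_mem h.1 h'.1
  rw [← sub_eq_zero]
  refine eq_zero_of_integral_mul_self (μ := μ) (hc.sub hc') ?_
  have e1 := h.2 _ hm
  have e2 := h'.2 _ hm
  have e3 : ∫ x, q x * (p - p') x ∂μ = ∫ x, q' x * (p - p') x ∂μ := by
    refine integral_congr_ae ?_
    filter_upwards [hqq] with x hx
    rw [hx]
  rw [e3, ← e2, ← sub_eq_zero, ← integral_sub
    (integrable_mul_of_mem_polySpace (integrable_of_continuous_cell hc) hm)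
    (integrable_mul_of_mem_polySpace (integrable_of_continuous_cell hc') hm)] at e1
  simp_rw [← sub_mul] at e1
  exact e1

end CellSpaces

section FaceDivisibility

open MvPolynomial

variable {d : ℕ} {T : Finset (Space d)}

namespace IsSimplex

/-- A barycentric coordinate of a simplex, as a polynomial. -/
noncomputable def coordPoly (hT : IsSimplex T) (a : T) : MvPolynomial (Fin d) ℝ :=
  C (hT.basis.coord a 0) +
    ∑ i, C ((hT.basis.coord a).linear (EuclideanSpace.single i 1)) * X i

theorem coordPoly_mem (hT : IsSimplex T) (a : T) : hT.coordPoly a ∈ polyDeg d 1 :=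
  Submodule.add_mem _ (polyDeg_mono zero_le_one (C_mem_polyDeg _))
    (Submodule.sum_mem _ fun i _ => C_mul_mem_polyDeg _ (X_mem_polyDeg i))

theorem polyEval_coordPoly (hT : IsSimplex T) (a : T) (x : Space d) :
    polyEval (hT.coordPoly a) x = hT.basis.coord a x := by
  have h1 : (hT.basis.coord a).linear x =
      ∑ i, (hT.basis.coord a).linear (EuclideanSpace.single i 1) * x i := by
    conv_lhs => rw [← (EuclideanSpace.basisFun (Fin d) ℝ).sum_repr x]
    simp [mul_comm]
  have h2 := hT.coord_sub a x 0
  rw [sub_zero, h1] at h2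
  rw [coordPoly, polyEval_add, polyEval_C, polyEval_sum]
  simp only [polyEval_mul, polyEval_C, polyEval_X]
  linarith

theorem coordPoly_ne_zero (hT : IsSimplex T) (a : T) : hT.coordPoly a ≠ 0 := by
  intro h
  have h1 := hT.polyEval_coordPoly a a
  rw [hT.coord_apply_self, h, polyEval_zero] at h1
  exact zero_ne_one h1

variable [DecidableEq (Space d)]

theorem mem_face_of_coord_eq_zero (hT : IsSimplex T) (hd : 0 < d) (a : T) {x : Space d}
    (hx : x ∈ cell T) (h0 : hT.basis.coord a x = 0) : x ∈ cell (T.erase (a : Space d)) := by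
  rw [cell_eq_cone a.2] at hx
  obtain ⟨s, -, y, hy, rfl⟩ := exists_of_mem_cone (hT.erase_nonempty hd a.2) hx
  have h1 := inner_eq_of_mem_cell (hT.inner_outwardNormal_sub hd a) hy
  rw [hT.inner_outwardNormal hd] at h1
  have h2 : (hT.basis.coord a).linear (y - a) = -1 := by
    have := hT.height_pos hd a
    field_simp at h1
    linarith
  have h3 := hT.coord_sub a ((a : Space d) + s • (y - a)) a
  rw [h0, hT.coord_apply_self, add_sub_cancel_left, map_smul, h2] at h3
  have hs : s = 1 := by simp at h3; linarith
  rw [hs, one_smul, add_sub_cancel]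
  exact hy

/-- A polynomial that vanishes on the face opposite to the vertex `a` is a multiple of the
barycentric coordinate `λ_a`: for another vertex `b`, the projection `x ↦ x - λ_a(x) (a - b)` maps
the simplex to the face. -/
theorem exists_eq_coordPoly_mul (hT : IsSimplex T) (hd : 0 < d) (a : T) {ℓ : ℤ}
    {P : MvPolynomial (Fin d) ℝ} (hP : P ∈ polyDeg d ℓ)
    (h0 : ∀ y ∈ cell (T.erase (a : Space d)), polyEval P y = 0) :
    ∃ R ∈ polyDeg d (ℓ - 1), P = hT.coordPoly a * R := by
  obtain ⟨b, hb⟩ := hT.erase_nonempty hd a.2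
  have hb' := Finset.mem_erase.1 hb
  obtain ⟨R, hR, h⟩ := exists_sub_projHom_eq (hT.coordPoly_mem a) ((a : Space d) - b) hP
  have hz : projHom (hT.coordPoly a) ((a : Space d) - b) P = 0 := by
    refine eq_zero_of_polyEval_eq_zero hT.interior_nonempty fun x hx => ?_
    rw [polyEval_projHom, polyEval_coordPoly]
    refine h0 _ ?_
    have hc : ∀ i, hT.basis.coord i (x - hT.basis.coord a x • ((a : Space d) - b)) =
        hT.basis.coord i x -
          hT.basis.coord a x * (hT.basis.coord i a - hT.basis.coord i b) := by
      intro i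
      have := hT.coord_sub i (x - hT.basis.coord a x • ((a : Space d) - b)) x
      rw [sub_sub_cancel_left, map_neg, map_smul, ← coord_sub, smul_eq_mul] at this
      linarith
    have hx' := hT.mem_cell_iff.1 hx
    have hab := hT.coord_apply_mem_erase a hb
    refine hT.mem_face_of_coord_eq_zero hd a (hT.mem_cell_iff.2 fun i => ?_) ?_
    · rw [hc]
      by_cases hia : i = a
      · subst hia; rw [hT.coord_apply_self, hab]; linarith
      · have h1 : hT.basis.coord i (a : Space d) = 0 := by
          simpa using hT.basis.coord_apply_ne hia
        have h2 : 0 ≤ hT.basis.coord i b :=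
          hT.mem_cell_iff.1 (subset_convexHull ℝ _ hb'.2) i
        rw [h1]
        nlinarith [hx' i, mul_nonneg (hx' a) h2]
    · rw [hc, hT.coord_apply_self, hab]; ring
  exact ⟨R, hR, by rw [← h, hz, sub_zero]⟩

end IsSimplex

end FaceDivisibility

/-! ### Unisolvence of the Raviart--Thomas--Nédélec space -/

section Unisolvence

open MvPolynomial

variable {d : ℕ} {T F : Finset (Space d)}

theorem IsFace.inner_outwardNormal_const (h : IsFace T F) :
    ∃ c : ℝ, ∀ y ∈ cell F, inner ℝ y (outwardNormal T F) = c := by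
  obtain ⟨y₀, hy₀⟩ : F.Nonempty := by rw [← Finset.card_pos, h.card_eq]; exact h.dim_pos
  refine ⟨inner ℝ y₀ (outwardNormal T F), fun y hy => ?_⟩
  have := inner_eq_of_mem_cell (a := y₀) (h := 0) (fun x hx => h.isOutwardNormal.2.1 x hx y₀ hy₀) hy
  rw [inner_sub_right, sub_eq_zero, real_inner_comm, real_inner_comm y₀] at this
  exact this

/-- On a face, where `x · n` is constant, the normal component of `P + x Q` has the degree of `P`
and `Q`. -/
theorem IsFace.exists_normal_component (h : IsFace T F) {ℓ : ℤ} (p : RTNPair d ℓ) :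
    ∃ S ∈ polyDeg d ℓ, ∀ y ∈ cell F,
      inner ℝ (polyField p.field y) (outwardNormal T F) = polyEval S y := by
  obtain ⟨c, hc⟩ := h.inner_outwardNormal_const
  refine ⟨∑ i, C (outwardNormal T F i) * (p.1 i : MvPolynomial (Fin d) ℝ) +
    C c * (p.2 : MvPolynomial (Fin d) ℝ), Submodule.add_mem _
      (Submodule.sum_mem _ fun i _ => C_mul_mem_polyDeg _ (p.1 i).2) (C_mul_mem_polyDeg _ p.2.2),
    fun y hy => ?_⟩
  rw [inner_polyField, polyEval_add, ← polyEval_C c y, polyEval_C c y, polyEval_mul, polyEval_C,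
    ← hc y hy, PiLp.inner_apply]
  simp only [RTNPair.field, polyEval_sum, polyEval_add, polyEval_mul, polyEval_C, polyEval_X,
    mul_add, Finset.sum_add_distrib, Finset.sum_mul]
  congr 1
  refine Finset.sum_congr rfl fun i _ => ?_
  simp
  ring

variable [DecidableEq (Space d)]

theorem IsSimplex.isFace (hT : IsSimplex T) (hd : 0 < d) (a : T) :
    IsFace T (T.erase (a : Space d)) :=
  ⟨hT, Finset.erase_subset _ _, hT.card_erase a.2, hd⟩

/-- Integration by parts of a smooth field against a polynomial. -/
theorem IsSimplex.green (hT : IsSimplex T) (hd : 0 < d) (Q : MvPolynomial (Fin d) ℝ)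
    {u : Space d → Space d} (hu : ContDiff ℝ 1 u) :
    ∫ x in cell T, polyEval Q x * divergence u x =
      -(∫ x in cell T, inner ℝ (u x) (polyField (fun i => pderiv i Q) x)) +
      ∑ a : T, ∫ y in cell (T.erase (a : Space d)),
        polyEval Q y * inner ℝ (u y) (outwardNormal T (T.erase (a : Space d))) ∂μHE[d - 1] := by
  have h := hT.divergence_theorem hd (u := fun y => polyEval Q y • u y)
    ((contDiff_polyEval Q).smul hu)
  have hcu := hu.continuous
  have hcd := continuous_divergence hu
  simp_rw [divergence_polyEval_smul Q hu, real_inner_smul_left] at h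
  rw [integral_add (Continuous.integrableOn_cell (by fun_prop) T)
    (Continuous.integrableOn_cell (by fun_prop) T)] at h
  rw [← h]
  ring

theorem IsSimplex.eq_zero_of_inner_outwardNormal (hT : IsSimplex T) (hd : 0 < d) {u : Space d}
    (h : ∀ a : T, inner ℝ u (outwardNormal T (T.erase (a : Space d))) = 0) : u = 0 := by
  rw [← hT.sum_linear_coord_smul u 0]
  refine Finset.sum_eq_zero fun a _ => ?_
  have := h a
  rw [real_inner_comm, hT.inner_outwardNormal hd a] at this
  have h2 := hT.height_pos hd a
  rw [(mul_eq_zero.1 this).resolve_left (by linarith), zero_smul]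

/-- A Raviart--Thomas--Nédélec field is zero if its interior and face moments vanish. -/
theorem IsSimplex.field_eq_zero (hT : IsSimplex T) (hd : 0 < d) {k : ℤ} (p : RTNPair d k)
    (hint : ∀ i, ∀ r ∈ polyDeg d (k - 1), ∫ x in cell T, polyEval (p.field i) x * polyEval r x = 0)
    (hface : ∀ a : T, ∀ r ∈ polyDeg d k, ∫ y in cell (T.erase (a : Space d)),
      inner ℝ (polyField p.field y) (outwardNormal T (T.erase (a : Space d))) * polyEval r y
        ∂μHE[d - 1] = 0) :
    p.field = 0 := by
  have hop := hT.isOpenPosMeasure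
  -- the normal components vanish on the faces
  have hn : ∀ a : T, ∀ y ∈ cell (T.erase (a : Space d)),
      inner ℝ (polyField p.field y) (outwardNormal T (T.erase (a : Space d))) = 0 := by
    intro a
    have hF := hT.isFace hd a
    have := hF.isFiniteMeasure
    have := hF.isOpenPosMeasure
    obtain ⟨S, hS, hSe⟩ := hF.exists_normal_component p
    have h1 := hface a S hS
    rw [setIntegral_congr_fun (g := fun y => polyEval S y * polyEval S y) (measurableSet_cell _)
      (fun y hy => by simp only [hSe y hy]), ← integral_surfaceMeasure _
      (fun y => polyEval S y * polyEval S y)] at h1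
    have h2 := eq_zero_of_integral_mul_self (μ := surfaceMeasure (T.erase (a : Space d)))
      (f := fun y => polyEval S y) (by fun_prop) h1
    intro y hy
    rw [hSe y hy]
    exact congrFun h2 ⟨y, hy⟩
  -- the divergence vanishes
  set D := ∑ i, pderiv i (p.field i) with hD
  have hDmem : D ∈ polyDeg d k := by
    refine Submodule.sum_mem _ fun i _ => ?_
    rw [RTNPair.field, map_add]
    refine Submodule.add_mem _ (polyDeg_mono (by linarith) (pderiv_mem_polyDeg i (p.1 i).2)) ?_
    have := pderiv_mem_polyDeg i (X_mul_mem_polyDeg (ℓ := k + 1) i (P := p.2) (by simp))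
    simpa using this
  have hD0 : D = 0 := by
    have h1 := hT.green hd D (contDiff_polyField p.field)
    have h2 : ∀ a : T, ∫ y in cell (T.erase (a : Space d)), polyEval D y *
        inner ℝ (polyField p.field y) (outwardNormal T (T.erase (a : Space d))) ∂μHE[d - 1] =
          0 := by
      intro a
      refine (setIntegral_congr_fun (g := fun _ => (0 : ℝ)) (measurableSet_cell _)
        fun y hy => ?_).trans (integral_zero _ _)
      simp only [hn a y hy, mul_zero]
    have h3 : ∫ x in cell T, inner ℝ (polyField p.field x) (polyField (fun i => pderiv i D) x) =
        0 := by
      simp_rw [PiLp.inner_apply, polyField_apply]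
      rw [integral_finsetSum _ fun i _ => Continuous.integrableOn_cell (by
        simp only [RCLike.inner_apply, conj_trivial]; fun_prop) T]
      refine Finset.sum_eq_zero fun i _ => ?_
      have := hint i _ (pderiv_mem_polyDeg i hDmem)
      rw [← this]
      congr 1
      ext x
      simp [mul_comm]
    simp_rw [h2, h3, divergence_polyField] at h1
    rw [← integral_volumeMeasure T (fun x => polyEval D x * polyEval D x)] at h1
    have h4 := eq_zero_of_integral_mul_self (μ := volumeMeasure T)
      (f := fun y => polyEval D y) (by fun_prop) (by simpa using h1)
    exact eq_zero_of_polyEval_eq_zero hT.interior_nonempty fun x hx => congrFun h4 ⟨x, hx⟩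
  -- so all components have degree at most `k`
  have hQ := mem_polyDeg_of_divergence_eq_zero hd (fun i => (p.1 i).2) p.2.2 hD0
  have hR : ∀ i, p.field i ∈ polyDeg d k := fun i =>
    Submodule.add_mem _ (p.1 i).2 (X_mul_mem_polyDeg i hQ)
  have hzero : ∀ x, polyField p.field x = 0 := by
    intro x
    refine hT.eq_zero_of_inner_outwardNormal hd fun a => ?_
    set n := outwardNormal T (T.erase (a : Space d))
    rw [inner_polyField]
    obtain ⟨S, hS, hSe⟩ := hT.exists_eq_coordPoly_mul hd a (P := ∑ i, C (n i) * p.field i) (ℓ := k)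
      (Submodule.sum_mem _ fun i _ => C_mul_mem_polyDeg _ (hR i))
      (fun y hy => by rw [← inner_polyField]; exact hn a y hy)
    -- the field tested with `S n` gives `∫ λ_a S² = 0`
    have h1 : ∫ x in cell T, polyEval (hT.coordPoly a) x * (polyEval S x * polyEval S x) = 0 := by
      have e : ∀ x, polyEval (hT.coordPoly a) x * (polyEval S x * polyEval S x) =
          ∑ i, n i * (polyEval (p.field i) x * polyEval S x) := by
        intro x
        have := congrArg (fun P => polyEval P x) hSe
        simp only [polyEval_sum, polyEval_mul, polyEval_C] at this
        rw [← mul_assoc, ← this, Finset.sum_mul]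
        exact Finset.sum_congr rfl fun i _ => by ring
      simp_rw [e]
      rw [integral_finsetSum _ fun i _ => Continuous.integrableOn_cell (by fun_prop) T]
      refine Finset.sum_eq_zero fun i _ => ?_
      rw [integral_const_mul, hint i S hS, mul_zero]
    have hc : Continuous fun x : cell T =>
        polyEval (hT.coordPoly a) x * (polyEval S x * polyEval S x) := by fun_prop
    rw [← integral_volumeMeasure T
      (fun x => polyEval (hT.coordPoly a) x * (polyEval S x * polyEval S x)),
      integral_eq_zero_iff_of_nonneg (fun x => mul_nonneg (by
        rw [hT.polyEval_coordPoly]; exact hT.mem_cell_iff.1 x.2 a) (mul_self_nonneg _))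
      (integrable_of_continuous_cell hc)] at h1
    have h2 := (Continuous.ae_eq_iff_eq (volumeMeasure T) hc continuous_zero).1 h1
    have h3 : hT.coordPoly a * (S * S) = 0 := by
      refine eq_zero_of_polyEval_eq_zero hT.interior_nonempty fun x hx => ?_
      simpa using congrFun h2 ⟨x, hx⟩
    have h4 : S = 0 := by
      simpa [hT.coordPoly_ne_zero a] using h3
    rw [hSe, h4, mul_zero, polyEval_zero]
  funext i
  exact eq_zero_of_polyEval_eq_zero hT.interior_nonempty fun x _ =>
    congrArg (fun v : Space d => v i) (hzero x)

end Unisolvence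

section Existence

open MvPolynomial

variable {d : ℕ} {T F : Finset (Space d)}

theorem finrank_polySpace_le (ℓ : ℤ) (Y : Set (Space d)) :
    Module.finrank ℝ (polySpace ℓ Y) ≤ Module.finrank ℝ (polyDeg d ℓ) :=
  Submodule.finrank_map_le (restrictPoly Y) (polyDeg d ℓ)

/-- The polynomials on a face: the kernel of the restriction contains the multiples of a barycentric
coordinate. -/
theorem IsFace.finrank_polySpace_add_le (h : IsFace T F) (ℓ : ℤ) :
    Module.finrank ℝ (polySpace ℓ (cell F)) + Module.finrank ℝ (polyDeg d (ℓ - 1)) ≤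
      Module.finrank ℝ (polyDeg d ℓ) := by
  classical
  obtain ⟨a, rfl⟩ := h.exists_eq_erase
  have hT := h.isSimplex
  let f : polyDeg d ℓ →ₗ[ℝ] polySpace ℓ (cell (T.erase (a : Space d))) :=
    ((restrictPoly (cell (T.erase (a : Space d)))).restrict
      (p := polyDeg d ℓ) (q := polySpace ℓ (cell (T.erase (a : Space d))))
      fun P hP => ⟨P, hP, rfl⟩)
  have hf : LinearMap.range f = ⊤ := by
    rw [LinearMap.range_eq_top]
    rintro ⟨_, P, hP, rfl⟩
    exact ⟨⟨P, hP⟩, rfl⟩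
  have hrn := f.finrank_range_add_finrank_ker
  rw [hf, finrank_top] at hrn
  rw [← hrn]
  have h0 : ∀ y ∈ cell (T.erase (a : Space d)), hT.basis.coord a y = 0 := by
    intro y hy
    have h1 := inner_eq_of_mem_cell (hT.inner_outwardNormal_sub h.dim_pos a) hy
    rw [hT.inner_outwardNormal h.dim_pos] at h1
    have h2 : (hT.basis.coord a).linear (y - a) = -1 := by
      have := hT.height_pos h.dim_pos a
      field_simp at h1
      linarith
    rw [← hT.coord_sub, hT.coord_apply_self] at h2
    linarith
  let g : polyDeg d (ℓ - 1) →ₗ[ℝ] LinearMap.ker f :=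
    { toFun := fun R => ⟨⟨hT.coordPoly a * (R : MvPolynomial (Fin d) ℝ), by
          simpa using mul_mem_polyDeg (hT.coordPoly_mem a) R.2⟩, by
          rw [LinearMap.mem_ker]
          ext y
          change polyEval (hT.coordPoly a * (R : MvPolynomial (Fin d) ℝ)) y = 0
          rw [polyEval_mul, hT.polyEval_coordPoly, h0 y y.2, zero_mul]⟩
      map_add' := fun R S => by ext1; ext1; exact mul_add _ _ _
      map_smul' := fun c R => by ext1; ext1; exact mul_smul_comm _ _ _ }
  have hg : Function.Injective g := by
    intro R S hRS
    have := congrArg (fun z : LinearMap.ker f => ((z : polyDeg d ℓ) : MvPolynomial (Fin d) ℝ)) hRS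
    exact Subtype.ext (mul_left_cancel₀ (hT.coordPoly_ne_zero a) this)
  exact Nat.add_le_add_left (LinearMap.finrank_le_finrank_of_injective hg) _

theorem RTNPair.polyField_add {k : ℤ} (p q : RTNPair d k) (x : Space d) :
    polyField (p + q).field x = polyField p.field x + polyField q.field x := by
  ext i; simp [RTNPair.field]; ring

theorem RTNPair.polyField_smul {k : ℤ} (c : ℝ) (p : RTNPair d k) (x : Space d) :
    polyField (c • p).field x = c • polyField p.field x := by
  ext i; simp [RTNPair.field]; ring

theorem integrable_field {k : ℤ} (T : Finset (Space d)) (p : RTNPair d k) (i : Fin d) :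
    Integrable (fun x : cell T => polyField p.field x i) (volumeMeasure T) :=
  integrable_of_continuous_cell (by fun_prop)

variable [DecidableEq (Space d)]

theorem IsSimplex.integrable_normal (hT : IsSimplex T) (hd : 0 < d) {k : ℤ} (p : RTNPair d k)
    (a : T) : Integrable (fun y : cell (T.erase (a : Space d)) =>
      inner ℝ (polyField p.field y) (outwardNormal T (T.erase (a : Space d))))
      (surfaceMeasure (T.erase (a : Space d))) :=
  have := (hT.isFace hd a).isFiniteMeasure
  integrable_of_continuous_cell (by fun_prop)

/-- The degrees of freedom of the field `P + x Q`: its moments in the element, and those of its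
normal components on the faces, which are indexed by the opposite vertices. -/
noncomputable def IsSimplex.moments (hT : IsSimplex T) (hd : 0 < d) (k : ℤ) :
    RTNPair d k →ₗ[ℝ] (Fin d → Module.Dual ℝ (polySpace (k - 1) (cell T))) ×
      (∀ a : T, Module.Dual ℝ (polySpace k (cell (T.erase (a : Space d))))) where
  toFun := fun p => (fun i => momentFunctional (k - 1) (integrable_field T p i),
    fun a => momentFunctional k (hT.integrable_normal hd p a))
  map_add' := fun p q => by
    refine Prod.ext (funext fun i => ?_) (funext fun a => ?_)
    · ext r
      simp only [momentFunctional, RTNPair.polyField_add, PiLp.add_apply, add_mul,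
        LinearMap.coe_mk, AddHom.coe_mk, Prod.fst_add, Pi.add_apply, LinearMap.add_apply]
      exact integral_add (integrable_mul_of_mem_polySpace (integrable_field T p i) r.2)
        (integrable_mul_of_mem_polySpace (integrable_field T q i) r.2)
    · ext r
      simp only [momentFunctional, RTNPair.polyField_add, inner_add_left, add_mul, LinearMap.coe_mk,
        AddHom.coe_mk, Prod.snd_add, Pi.add_apply, LinearMap.add_apply]
      exact integral_add (integrable_mul_of_mem_polySpace (hT.integrable_normal hd p a) r.2)
        (integrable_mul_of_mem_polySpace (hT.integrable_normal hd q a) r.2)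
  map_smul' := fun c p => by
    refine Prod.ext (funext fun i => ?_) (funext fun a => ?_)
    · ext r
      simp only [momentFunctional, RTNPair.polyField_smul, PiLp.smul_apply, mul_assoc,
        LinearMap.coe_mk, AddHom.coe_mk, Prod.smul_fst, Pi.smul_apply, LinearMap.smul_apply, RingHom.id_apply, smul_eq_mul,
        ← integral_const_mul]
    · ext r
      simp only [momentFunctional, RTNPair.polyField_smul, real_inner_smul_left, mul_assoc,
        LinearMap.coe_mk, AddHom.coe_mk, Prod.smul_snd, Pi.smul_apply, LinearMap.smul_apply, RingHom.id_apply,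
        smul_eq_mul, ← integral_const_mul]

/-- A pair `(P, Q)` without moments represents the zero field. -/
theorem IsSimplex.field_eq_zero_of_moments (hT : IsSimplex T) (hd : 0 < d) {k : ℤ}
    {p : RTNPair d k} (hp : hT.moments hd k p = 0) : p.field = 0 := by
  refine hT.field_eq_zero hd p (fun i r hr => ?_) (fun a r hr => ?_)
  · have := congrArg (fun z => z.1 i ⟨_, polyEval_mem_polySpace (cell T) hr⟩) hp
    rw [← integral_volumeMeasure T (fun x => polyEval (p.field i) x * polyEval r x)]
    exact this
  · have := congrArg (fun z => z.2 a ⟨_, polyEval_mem_polySpace _ hr⟩) hp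
    rw [← integral_surfaceMeasure _ (fun y => inner ℝ (polyField p.field y)
      (outwardNormal T (T.erase (a : Space d))) * polyEval r y)]
    exact this

theorem IsSimplex.finrank_ker_moments_le (hT : IsSimplex T) (hd : 0 < d) (k : ℤ) :
    Module.finrank ℝ (LinearMap.ker (hT.moments hd k)) ≤
      Module.finrank ℝ (polyDeg d (k - 1)) := by
  have hQ : ∀ p : LinearMap.ker (hT.moments hd k),
      (p.1.2 : MvPolynomial (Fin d) ℝ) ∈ polyDeg d (k - 1) := by
    intro p
    have h1 := congrFun (hT.field_eq_zero_of_moments hd p.2) ⟨0, hd⟩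
    refine mem_polyDeg_of_X_mul_mem ⟨0, hd⟩ ?_
    rw [show X ⟨0, hd⟩ * (p.1.2 : MvPolynomial (Fin d) ℝ) =
      -(p.1.1 ⟨0, hd⟩ : MvPolynomial _ ℝ) from eq_neg_of_add_eq_zero_right h1]
    exact Submodule.neg_mem _ (p.1.1 _).2
  let g : LinearMap.ker (hT.moments hd k) →ₗ[ℝ] polyDeg d (k - 1) :=
    LinearMap.codRestrict _ ((polyDeg d k).subtype ∘ₗ LinearMap.snd ℝ _ _ ∘ₗ
      (LinearMap.ker (hT.moments hd k)).subtype) hQ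
  refine LinearMap.finrank_le_finrank_of_injective (f := g) fun p q hpq => ?_
  have hg : ∀ p, (g p : MvPolynomial (Fin d) ℝ) = p.1.2 := fun p => rfl
  have h2 : (p.1.2 : MvPolynomial (Fin d) ℝ) = q.1.2 := by rw [← hg p, hpq, hg]
  have h1 := hT.field_eq_zero_of_moments hd p.2
  have h3 := hT.field_eq_zero_of_moments hd q.2
  refine Subtype.ext (Prod.ext (funext fun i => Subtype.ext ?_) (Subtype.ext h2))
  have h4 := (congrFun h1 i).trans (congrFun h3 i).symm
  rw [RTNPair.field, RTNPair.field, h2] at h4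
  exact add_right_cancel h4

/-- Fields of the Raviart--Thomas--Nédélec space with prescribed interior and face moments exist:
the map to the moments is injective on fields, and the dimensions agree. -/
theorem IsSimplex.exists_moments (hT : IsSimplex T) (hd : 0 < d) (k : ℤ)
    (α : Fin d → Module.Dual ℝ (polySpace (k - 1) (cell T)))
    (β : ∀ a : T, Module.Dual ℝ (polySpace k (cell (T.erase (a : Space d))))) :
    ∃ p : RTNPair d k,
      (∀ i, ∀ r : polySpace (k - 1) (cell T),
        ∫ x : cell T, polyField p.field x i * r.1 x ∂(volumeMeasure T) = α i r) ∧
      ∀ a : T, ∀ r : polySpace k (cell (T.erase (a : Space d))),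
        ∫ y : cell (T.erase (a : Space d)),
          inner ℝ (polyField p.field y) (outwardNormal T (T.erase (a : Space d))) * r.1 y
            ∂(surfaceMeasure (T.erase (a : Space d))) = β a r := by
  have hkerdim := hT.finrank_ker_moments_le hd k
  have hrn := (hT.moments hd k).finrank_range_add_finrank_ker
  have hdom : Module.finrank ℝ (RTNPair d k) = (d + 1) * Module.finrank ℝ (polyDeg d k) := by
    rw [Module.finrank_prod, Module.finrank_pi_fintype]
    simp; ring
  have hcod : Module.finrank ℝ ((Fin d → Module.Dual ℝ (polySpace (k - 1) (cell T))) ×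
      (∀ a : T, Module.Dual ℝ (polySpace k (cell (T.erase (a : Space d)))))) +
      Module.finrank ℝ (polyDeg d (k - 1)) ≤ (d + 1) * Module.finrank ℝ (polyDeg d k) := by
    rw [Module.finrank_prod, Module.finrank_pi_fintype, Module.finrank_pi_fintype]
    simp_rw [Subspace.dual_finrank_eq]
    have h1 := finrank_polySpace_le (k - 1) (cell T)
    have h2 : ∑ a : T, (Module.finrank ℝ (polySpace k (cell (T.erase (a : Space d)))) +
        Module.finrank ℝ (polyDeg d (k - 1))) ≤ ∑ _a : T, Module.finrank ℝ (polyDeg d k) :=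
      Finset.sum_le_sum fun a _ => (hT.isFace hd a).finrank_polySpace_add_le k
    rw [Finset.sum_add_distrib] at h2
    simp only [Finset.sum_const, Finset.card_univ, Fintype.card_coe, hT.card_eq, smul_eq_mul,
      Fintype.card_fin] at h2 ⊢
    nlinarith [Nat.mul_le_mul_left d h1]
  have hsurj : LinearMap.range (hT.moments hd k) = ⊤ := by
    refine Submodule.eq_top_of_finrank_eq (le_antisymm (Submodule.finrank_le _) ?_)
    omega
  obtain ⟨p, hp⟩ := LinearMap.range_eq_top.1 hsurj (α, β)
  exact ⟨p, fun i r => congrArg (fun z => z.1 i r) hp, fun a r => congrArg (fun z => z.2 a r) hp⟩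

end Existence

/-! ### The interpolant on an element -/

section ElementInterpolant

open MvPolynomial

variable {d : ℕ} {T F : Finset (Space d)}

theorem measurePreserving_volumeMeasure (T : Finset (Space d)) :
    MeasurePreserving (Subtype.val : cell T → Space d) (volumeMeasure T)
      (volume.restrict (cell T)) :=
  ⟨measurable_subtype_coe, map_comap_subtype_coe (measurableSet_cell T) _⟩

theorem memLp_volumeMeasure {w : Space d → Space d}
    (hw : MemLp w 2 (volume.restrict (interior (cell T)))) :
    MemLp (fun x : cell T => w x) 2 (volumeMeasure T) := by
  rw [restrict_interior_cell] at hw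
  exact hw.comp_measurePreserving (measurePreserving_volumeMeasure T)

theorem integrable_coord_of_memLp {α : Type*} {mα : MeasurableSpace α} {μ : Measure α}
    [IsFiniteMeasure μ] {f : α → Space d} (hf : MemLp f 2 μ) (i : Fin d) :
    Integrable (fun x => f x i) μ :=
  (EuclideanSpace.proj i : Space d →L[ℝ] ℝ).integrable_comp (hf.integrable one_le_two)

theorem IsRTNInterpolant.interior_moments {k : ℤ} {w : Space d → Space d} {v : cell T → Space d}
    (h : IsRTNInterpolant (k + 1) T w v) (i : Fin d) {r : cell T → ℝ}
    (hr : r ∈ polySpace (k - 1) (cell T)) :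
    ∫ x, v x i * r x ∂(volumeMeasure T) = ∫ x : cell T, w x i * r x ∂(volumeMeasure T) := by
  obtain ⟨-, ⟨p, h1, h2⟩, -⟩ := h
  rw [show k + 1 - 2 = k - 1 by ring] at h1 h2
  rw [← (h1 i).2 r hr, ← (h2 i).2 r hr]

theorem IsRTNInterpolant.face_moments {k : ℤ} {w : Space d → Space d} {v : cell T → Space d}
    (h : IsRTNInterpolant (k + 1) T w v) (hF : IsFace T F) {g : cell F → Space d}
    (hg : IsTrace T F w g) {r : cell F → ℝ} (hr : r ∈ polySpace k (cell F)) :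
    ∫ x, inner ℝ (restrictToFace hF.subset v x) (outwardNormal T F) * r x ∂(surfaceMeasure F) =
      ∫ x, inner ℝ (g x) (outwardNormal T F) * r x ∂(surfaceMeasure F) := by
  obtain ⟨-, -, h3⟩ := h
  obtain ⟨g', hg', h4⟩ := h3 F hF.subset hF.card_eq
  rw [add_sub_cancel_right] at h4
  rw [h4.2 r hr]
  refine integral_congr_ae ?_
  filter_upwards [hF.trace_ae_eq hg' hg] with x hx
  rw [hx]

/-- The interpolant exists: the moments of `w` and of its normal traces are prescribed moments. -/
theorem IsSimplex.exists_isRTNInterpolant (hT : IsSimplex T) (hd : 0 < d) (k : ℤ)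
    {w : Space d → Space d} (hw : MemLp w 2 (volume.restrict (interior (cell T))))
    (hg : ∀ F, IsFace T F → ∃ g, IsTrace T F w g) : ∃ v, IsRTNInterpolant (k + 1) T w v := by
  classical
  have hop := hT.isOpenPosMeasure
  have hfin : ∀ a : T, IsFiniteMeasure (surfaceMeasure (T.erase (a : Space d))) := fun a =>
    (hT.isFace hd a).isFiniteMeasure
  choose g hg using hg
  have hi := fun i => integrable_coord_of_memLp (memLp_volumeMeasure hw) i
  have hb : ∀ a : T, Integrable (fun y => inner ℝ (g _ (hT.isFace hd a) y)
      (outwardNormal T (T.erase (a : Space d)))) (surfaceMeasure (T.erase (a : Space d))) := by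
    intro a
    exact (((hg _ (hT.isFace hd a)).1).integrable one_le_two).inner_const _
  obtain ⟨p, hp1, hp2⟩ := hT.exists_moments hd k (fun i => momentFunctional (k - 1) (hi i))
    (fun a => momentFunctional k (hb a))
  refine ⟨fun x => polyField p.field x, ?_, ?_, ?_⟩
  · rw [mem_rtnSpace_iff, add_sub_cancel_right]
    exact ⟨fun i => p.1 i, p.2, fun i => (p.1 i).2, p.2.2, rfl⟩
  · rw [show k + 1 - 2 = k - 1 by ring]
    choose P hP using fun i => exists_isL2Proj (k - 1) (hi i)
    refine ⟨fun x => WithLp.toLp 2 fun i => P i x, fun i => ⟨(hP i).1, fun r hr => ?_⟩, hP⟩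
    exact ((hP i).2 r hr).trans (hp1 i ⟨r, hr⟩).symm
  · intro F hFT hFc
    rw [add_sub_cancel_right]
    have hF : IsFace T F := ⟨hT, hFT, hFc, hd⟩
    obtain ⟨a, rfl⟩ := hF.exists_eq_erase
    refine ⟨_, hg _ hF, ?_, fun r hr => hp2 a ⟨r, hr⟩⟩
    obtain ⟨S, hS, hSe⟩ := hF.exists_normal_component p
    exact mem_polySpace_iff.2 ⟨S, hS, funext fun x => hSe x x.2⟩

theorem exists_field_eq {k : ℤ} {Y : Set (Space d)} {v : Y → Space d}
    (hv : v ∈ rtnSpace (k + 1) Y) : ∃ p : RTNPair d k, v = fun x : Y => polyField p.field x := by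
  rw [mem_rtnSpace_iff, add_sub_cancel_right] at hv
  obtain ⟨P, Q, hP, hQ, rfl⟩ := hv
  exact ⟨(fun i => ⟨P i, hP i⟩, ⟨Q, hQ⟩), rfl⟩

theorem RTNPair.polyField_sub {k : ℤ} (p q : RTNPair d k) (x : Space d) :
    polyField (p - q).field x = polyField p.field x - polyField q.field x := by
  have := RTNPair.polyField_add (p - q) q x
  rw [sub_add_cancel] at this
  rw [this, add_sub_cancel_right]

/-- The interpolant is unique: the difference of two of them has no moments. -/
theorem IsRTNInterpolant.unique (hT : IsSimplex T) (hd : 0 < d) {k : ℤ}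
    {w : Space d → Space d} {v v' : cell T → Space d} (h : IsRTNInterpolant (k + 1) T w v)
    (h' : IsRTNInterpolant (k + 1) T w v') : v = v' := by
  classical
  obtain ⟨p, rfl⟩ := exists_field_eq h.1
  obtain ⟨p', rfl⟩ := exists_field_eq h'.1
  have hfield : (p - p').field = 0 := by
    refine hT.field_eq_zero hd (p - p') (fun i r hr => ?_) fun a r hr => ?_
    · have h1 := h.interior_moments i (polyEval_mem_polySpace (cell T) hr)
      have h2 := h'.interior_moments i (polyEval_mem_polySpace (cell T) hr)
      rw [← h2, ← sub_eq_zero, ← integral_sub (integrable_of_continuous_cell (by fun_prop))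
        (integrable_of_continuous_cell (by fun_prop))] at h1
      rw [← integral_volumeMeasure T (fun x => polyEval ((p - p').field i) x * polyEval r x), ← h1]
      congr 1
      ext x
      have := congrArg (fun v : Space d => v i) (RTNPair.polyField_sub p p' x)
      simp only [polyField_apply, PiLp.sub_apply] at this
      rw [this]
      simp [sub_mul]
    · have hF := hT.isFace hd a
      have := hF.isFiniteMeasure
      obtain ⟨g, hg, -⟩ := h.2.2 _ hF.subset hF.card_eq
      have h1 := h.face_moments hF hg (polyEval_mem_polySpace _ hr)
      have h2 := h'.face_moments hF hg (polyEval_mem_polySpace _ hr)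
      rw [← h2, ← sub_eq_zero, ← integral_sub
        (integrable_of_continuous_cell (by unfold restrictToFace; fun_prop))
        (integrable_of_continuous_cell (by unfold restrictToFace; fun_prop))] at h1
      rw [← integral_surfaceMeasure _ (fun y => inner ℝ (polyField (p - p').field y)
        (outwardNormal T (T.erase (a : Space d))) * polyEval r y), ← h1]
      congr 1
      ext x
      rw [RTNPair.polyField_sub, inner_sub_left, sub_mul]
      rfl
  ext1 x
  have := RTNPair.polyField_sub p p' x
  rw [hfield] at this
  rw [← sub_eq_zero, ← this]
  ext i
  simp

end ElementInterpolant

/-! ### The pressure gradient -/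

section PressureGradient

open MvPolynomial

variable {d : ℕ} {T F : Finset (Space d)}

/-- The divergence within a simplex of the restriction of a field is the divergence of the field. -/
theorem divergenceOn_eq (hT : IsSimplex T) {u : Space d → Space d} (hu : ContDiff ℝ 1 u)
    (x : cell T) : divergenceOn (cell T) (fun y : cell T => u y) x = divergence u x := by
  have huniq := uniqueDiffOn_convex (convex_convexHull ℝ (T : Set (Space d))) hT.interior_nonempty
  have e : fderivWithin ℝ (Function.extend Subtype.val (fun y : cell T => u y) 0) (cell T) x.1 =
      fderiv ℝ u x := by
    rw [← fderivWithin_eq_fderiv (huniq x x.2) (hu.differentiable one_ne_zero x)]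
    refine fderivWithin_congr (fun y hy => ?_) ?_
    · exact Subtype.val_injective.extend_apply (fun y : cell T => u y) 0 ⟨y, hy⟩
    · exact Subtype.val_injective.extend_apply (fun y : cell T => u y) 0 x
  rw [divergenceOn, divergence, e]

theorem divergenceOn_add (hT : IsSimplex T) {ℓ : ℤ} {v w : cell T → Space d}
    (hv : v ∈ rtnSpace ℓ (cell T)) (hw : w ∈ rtnSpace ℓ (cell T)) (x : cell T) :
    divergenceOn (cell T) (v + w) x = divergenceOn (cell T) v x + divergenceOn (cell T) w x := by
  obtain ⟨P, Q, -, -, rfl⟩ := mem_rtnSpace_iff.1 hv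
  obtain ⟨P', Q', -, -, rfl⟩ := mem_rtnSpace_iff.1 hw
  have h1 := contDiff_polyField (n := 1) fun i => P i + X i * Q
  have h2 := contDiff_polyField (n := 1) fun i => P' i + X i * Q'
  rw [divergenceOn_eq hT h1, divergenceOn_eq hT h2]
  refine (divergenceOn_eq hT (h1.add h2) x).trans ?_
  simp only [divergence]
  rw [fderiv_fun_add (h1.differentiable one_ne_zero x) (h2.differentiable one_ne_zero x),
    ← Finset.sum_add_distrib]
  rfl

theorem divergenceOn_smul (hT : IsSimplex T) {ℓ : ℤ} (c : ℝ) {v : cell T → Space d}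
    (hv : v ∈ rtnSpace ℓ (cell T)) (x : cell T) :
    divergenceOn (cell T) (c • v) x = c * divergenceOn (cell T) v x := by
  obtain ⟨P, Q, -, -, rfl⟩ := mem_rtnSpace_iff.1 hv
  have h1 := contDiff_polyField (n := 1) fun i => P i + X i * Q
  rw [divergenceOn_eq hT h1]
  refine (divergenceOn_eq hT (h1.const_smul c) x).trans ?_
  simp only [divergence]
  rw [fderiv_fun_const_smul (h1.differentiable one_ne_zero x), Finset.mul_sum]
  rfl

theorem continuous_divergenceOn (hT : IsSimplex T) {ℓ : ℤ} {v : cell T → Space d}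
    (hv : v ∈ rtnSpace ℓ (cell T)) : Continuous (divergenceOn (cell T) v) := by
  obtain ⟨P, Q, -, -, rfl⟩ := mem_rtnSpace_iff.1 hv
  have h1 := contDiff_polyField (n := 1) fun i => P i + X i * Q
  have e : divergenceOn (cell T) (fun x => polyField (fun i => P i + X i * Q) x) =
    fun x : cell T => divergence (polyField fun i => P i + X i * Q) x :=
    funext fun x => divergenceOn_eq hT h1 x
  rw [e]
  exact (continuous_divergence h1).comp continuous_subtype_val

theorem continuous_restrictToFace (h : F ⊆ T) {v : cell T → Space d} (hv : Continuous v) :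
    Continuous (restrictToFace h v) := by
  unfold restrictToFace; fun_prop

variable {Ω : Set (Space d)} (M : SimplicialMesh Ω) (k : ℕ)

theorem SimplicialMesh.isSimplex (T : M.elements) : IsSimplex T.1 :=
  ⟨M.card_vertices T.1 T.2, M.affineIndependent T.1 T.2⟩

theorem SimplicialMesh.mem_faces {F : Finset (Space d)} :
    F ∈ M.faces ↔ ∃ T ∈ M.elements, F ⊆ T ∧ F.card = d := by
  simp [SimplicialMesh.faces, Finset.mem_powersetCard]

theorem SimplicialMesh.card_face (F : M.faces) : F.1.card = d := by
  obtain ⟨T, -, -, h⟩ := M.mem_faces.1 F.2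
  exact h

theorem SimplicialMesh.exists_element (F : M.faces) : ∃ T : M.elements, F.1 ⊆ T.1 := by
  obtain ⟨T, hT, h, -⟩ := M.mem_faces.1 F.2
  exact ⟨⟨T, hT⟩, h⟩

theorem SimplicialMesh.isFace (hd : 0 < d) {T : M.elements} {F : M.faces} (h : F.1 ⊆ T.1) :
    IsFace T.1 F.1 := ⟨M.isSimplex T, h, M.card_face F, hd⟩

/-- The faces of an element are indexed by the opposite vertices. -/
theorem SimplicialMesh.sum_facesOf [DecidableEq (Space d)] (T : M.elements)
    (f : Finset (Space d) → ℝ) :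
    ∑ F : M.FacesOf T, f F.1.1 = ∑ a : T.1, f (T.1.erase (a : Space d)) := by
  have hmem : ∀ a : T.1, T.1.erase (a : Space d) ∈ M.faces := fun a =>
    M.mem_faces.2 ⟨T.1, T.2, Finset.erase_subset _ _, (M.isSimplex T).card_erase a.2⟩
  symm
  refine Finset.sum_bij (fun a _ => ⟨⟨T.1.erase (a : Space d), hmem a⟩, Finset.erase_subset _ _⟩)
    (fun _ _ => Finset.mem_univ _) (fun a _ b _ hab => ?_) (fun F _ => ?_) fun _ _ => rfl
  · have h1 : T.1.erase (a : Space d) = T.1.erase (b : Space d) :=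
      congrArg (fun F : M.FacesOf T => F.1.1) hab
    exact Subtype.ext (Finset.erase_injOn T.1 a.2 b.2 h1)
  · obtain ⟨b, hb, hbF⟩ := Finset.exists_of_ssubset (Finset.ssubset_iff_subset_ne.2
      ⟨F.2, fun e => by
        have := M.card_face F.1
        rw [e, (M.isSimplex T).card_eq] at this; omega⟩)
    refine ⟨⟨b, hb⟩, Finset.mem_univ _, ?_⟩
    refine Subtype.ext (Subtype.ext (Finset.eq_of_subset_of_card_le (fun x hx => ?_) ?_).symm)
    · exact Finset.mem_erase.2 ⟨fun e : x = b => hbF (e ▸ hx), F.2 hx⟩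
    · rw [M.card_face F.1, (M.isSimplex T).card_erase hb]

/-- The right-hand side of the definition of the pressure gradient, as a function of the test
field. -/
noncomputable def elementCoupling (T : M.elements) (q : PressureSpace M k)
    (w : rtnSpace (k + 1 : ℤ) (cell T.1)) : ℝ :=
  -(∫ x : cell T.1, (q.1 T).1 x * divergenceOn (cell T.1) w.1 x ∂(volumeMeasure T.1)) +
    ∑ F : M.FacesOf T, ∫ x : cell F.1.1, (q.2 F.1).1 x *
      inner ℝ (restrictToFace F.2 w.1 x) (outwardNormal T.1 F.1.1) ∂(surfaceMeasure F.1.1)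

/-- The pressure gradient represents the linear form `elementCoupling`, so its defining property is
the actual one and not the junk value of the choice. -/
theorem exists_isPressureGradient (hd : 0 < d) (T : M.elements) (q : PressureSpace M k) :
    ∃ g, IsPressureGradient M k T q g := by
  have hT := M.isSimplex T
  have hop := hT.isOpenPosMeasure
  have hfin : ∀ F : M.FacesOf T, IsFiniteMeasure (surfaceMeasure F.1.1) := fun F =>
    (M.isFace hd F.2).isFiniteMeasure
  have hqT := continuous_of_mem_polySpace (q.1 T).2
  have hqF := fun F : M.FacesOf T => continuous_of_mem_polySpace (q.2 F.1).2
  have hi1 : ∀ w : rtnSpace (k + 1 : ℤ) (cell T.1), Integrable (fun x => (q.1 T).1 x *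
      divergenceOn (cell T.1) w.1 x) (volumeMeasure T.1) := fun w =>
    integrable_of_continuous_cell (hqT.mul (continuous_divergenceOn hT w.2))
  have hi2 : ∀ (w : rtnSpace (k + 1 : ℤ) (cell T.1)) (F : M.FacesOf T), Integrable (fun x =>
      (q.2 F.1).1 x * inner ℝ (restrictToFace F.2 w.1 x) (outwardNormal T.1 F.1.1))
      (surfaceMeasure F.1.1) := fun w F =>
    integrable_of_continuous_cell ((hqF F).mul ((continuous_restrictToFace F.2
      (continuous_of_mem_rtnSpace w.2)).inner continuous_const))
  let f : Module.Dual ℝ (rtnSpace (k + 1 : ℤ) (cell T.1)) :=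
    { toFun := elementCoupling M k T q
      map_add' := fun v w => by
        simp only [elementCoupling, Submodule.coe_add, divergenceOn_add hT v.2 w.2, mul_add]
        rw [integral_add (hi1 v) (hi1 w)]
        have : ∀ F : M.FacesOf T, ∫ x : cell F.1.1, (q.2 F.1).1 x *
            inner ℝ (restrictToFace F.2 (v.1 + w.1) x) (outwardNormal T.1 F.1.1)
              ∂(surfaceMeasure F.1.1) = _ := fun F =>
          (integral_congr_ae (Eventually.of_forall fun x => by
            simp only [restrictToFace, Pi.add_apply, inner_add_left, mul_add])).trans
            (integral_add (hi2 v F) (hi2 w F))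
        simp_rw [this, Finset.sum_add_distrib]
        ring
      map_smul' := fun c v => by
        simp only [elementCoupling, Submodule.coe_smul, divergenceOn_smul hT c v.2,
          RingHom.id_apply, smul_eq_mul]
        have : ∀ F : M.FacesOf T, ∫ x : cell F.1.1, (q.2 F.1).1 x *
            inner ℝ (restrictToFace F.2 (c • v.1) x) (outwardNormal T.1 F.1.1)
              ∂(surfaceMeasure F.1.1) = c * ∫ x : cell F.1.1, (q.2 F.1).1 x *
            inner ℝ (restrictToFace F.2 v.1 x) (outwardNormal T.1 F.1.1)
              ∂(surfaceMeasure F.1.1) := fun F => by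
          rw [← integral_const_mul]
          congr 1
          ext x
          simp only [restrictToFace, Pi.smul_apply, real_inner_smul_left]
          ring
        simp_rw [this, mul_left_comm _ c, integral_const_mul, ← Finset.mul_sum]
        ring }
  have hi3 : ∀ v w : rtnSpace (k + 1 : ℤ) (cell T.1),
      Integrable (fun x => inner ℝ (v.1 x) (w.1 x)) (volumeMeasure T.1) := fun v w =>
    integrable_of_continuous_cell ((continuous_of_mem_rtnSpace v.2).inner
      (continuous_of_mem_rtnSpace w.2))
  let B : rtnSpace (k + 1 : ℤ) (cell T.1) →ₗ[ℝ] Module.Dual ℝ (rtnSpace (k + 1 : ℤ) (cell T.1)) :=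
    LinearMap.mk₂ ℝ (fun v w => ∫ x, inner ℝ (v.1 x) (w.1 x) ∂(volumeMeasure T.1))
      (fun v v' w => by
        simp only [Submodule.coe_add, Pi.add_apply, inner_add_left]
        exact integral_add (hi3 v w) (hi3 v' w))
      (fun c v w => by
        simp only [Submodule.coe_smul, Pi.smul_apply, real_inner_smul_left, smul_eq_mul,
          integral_const_mul])
      (fun v w w' => by
        simp only [Submodule.coe_add, Pi.add_apply, inner_add_right]
        exact integral_add (hi3 v w) (hi3 v w'))
      (fun c v w => by
        simp only [Submodule.coe_smul, Pi.smul_apply, real_inner_smul_right, smul_eq_mul,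
          integral_const_mul])
  obtain ⟨g, hg⟩ := exists_riesz B (fun v hv => Subtype.ext
    (eq_zero_of_integral_inner_self (continuous_of_mem_rtnSpace v.2) hv)) f
  exact ⟨g, fun w => congrArg (fun z => z w) hg⟩

/-- The velocity is itself a test field in the definition of the pressure gradient. -/
theorem couplingForm_eq (hd : 0 < d) (v : VelocitySpace M k) (q : PressureSpace M k) :
    couplingForm M k v q = ∑ T : M.elements, elementCoupling M k T q (v.1 T) := by
  refine Finset.sum_congr rfl fun T _ => ?_
  have h : IsPressureGradient M k T q (pressureGradient M k T q) :=
    Classical.epsilon_spec (exists_isPressureGradient M k hd T q)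
  rw [elementCoupling, ← h (v.1 T)]
  simp_rw [real_inner_comm]

end PressureGradient

/-! ### Green's formula for divergence-free functions -/

section DivergenceFree

open MvPolynomial

variable {d : ℕ}

/-- `L^2` convergence passes to the integrals against a bounded field of linear forms. -/
theorem tendsto_integral_clm {α V : Type*} [NormedAddCommGroup V] [NormedSpace ℝ V]
    {mα : MeasurableSpace α} {μ : Measure α} [IsFiniteMeasure μ] {f : ℕ → α → V} {g : α → V}
    (hf : ∀ n, AEStronglyMeasurable (f n) μ) (hg : MemLp g 2 μ)
    (h : Tendsto (fun n => eLpNorm (fun x => f n x - g x) 2 μ) atTop (𝓝 0))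
    {B : α → V →L[ℝ] ℝ} (hB : AEStronglyMeasurable B μ) {C : ℝ} (hC : ∀ᵐ x ∂μ, ‖B x‖ ≤ C) :
    Tendsto (fun n => ∫ x, B x (f n x) ∂μ) atTop (𝓝 (∫ x, B x (g x) ∂μ)) := by
  have hsub : ∀ n, AEStronglyMeasurable (fun x => f n x - g x) μ := fun n =>
    (hf n).sub hg.aestronglyMeasurable
  have hint : Integrable (fun x => B x (g x)) μ := by
    refine ((hg.integrable one_le_two).norm.const_mul C).mono'
      ((ContinuousLinearMap.id ℝ (V →L[ℝ] ℝ)).aestronglyMeasurable_comp₂ hB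
        hg.aestronglyMeasurable) ?_
    filter_upwards [hC] with x hx using (B x).le_of_opNorm_le hx _
  have hev : ∀ᶠ n in atTop, MemLp (f n) 2 μ := by
    filter_upwards [h.eventually (gt_mem_nhds ENNReal.zero_lt_top)] with n hn
    have := (show MemLp (fun x => f n x - g x) 2 μ from ⟨hsub n, hn⟩).add hg
    simpa [Pi.add_def] using this
  refine tendsto_integral_of_L1' _ hint.aestronglyMeasurable ?_ ?_
  · filter_upwards [hev] with n hn
    refine ((hn.integrable one_le_two).norm.const_mul C).mono' ((ContinuousLinearMap.id ℝ
      (V →L[ℝ] ℝ)).aestronglyMeasurable_comp₂ hB (hf n)) ?_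
    filter_upwards [hC] with x hx using (B x).le_of_opNorm_le hx _
  · have hle : ∀ n, eLpNorm ((fun x => B x (f n x)) - fun x => B x (g x)) 1 μ ≤
        ENNReal.ofReal C * (eLpNorm (fun x => f n x - g x) 2 μ *
          μ Set.univ ^ (1 / (1 : ENNReal).toReal - 1 / (2 : ENNReal).toReal)) := by
      intro n
      refine (eLpNorm_le_mul_eLpNorm_of_ae_le_mul (g := fun x => f n x - g x) (c := C) ?_ 1).trans
        (mul_le_mul_right (eLpNorm_le_eLpNorm_mul_rpow_measure_univ one_le_two (hsub n)) _)
      filter_upwards [hC] with x hx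
      rw [Pi.sub_apply, ← map_sub]
      exact (B x).le_of_opNorm_le hx _
    refine tendsto_of_tendsto_of_tendsto_of_le_of_le tendsto_const_nhds ?_ (fun _ => zero_le) hle
    have hpow : μ Set.univ ^ (1 / (1 : ENNReal).toReal - 1 / (2 : ENNReal).toReal) ≠ ⊤ :=
      ENNReal.rpow_ne_top_of_nonneg (by norm_num) (measure_ne_top μ _)
    simpa using ENNReal.Tendsto.const_mul (ENNReal.Tendsto.mul_const h (Or.inr hpow))
      (Or.inr ENNReal.ofReal_ne_top)

theorem IsDivergenceFree.mono {U U' : Set (Space d)} (hU : U ⊆ U') {w : Space d → Space d}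
    (h : IsDivergenceFree U' w) : IsDivergenceFree U w := by
  intro φ hφ
  have e1 : ∀ x ∉ U, fderiv ℝ φ x (w x) = 0 := fun x hx => by
    have : fderiv ℝ φ x = 0 := by
      by_contra hne
      exact hx (hφ.2.2 (support_fderiv_subset ℝ hne))
    simp [this]
  have h1 := h φ (hφ.mono hU)
  rwa [setIntegral_eq_integral_of_forall_compl_eq_zero (fun x hx => e1 x fun h => hx (hU h)),
    ← setIntegral_eq_integral_of_forall_compl_eq_zero e1] at h1

/-- The trace of a linear map, which takes the derivative of a field to its divergence. -/
noncomputable def divergenceCLM (d : ℕ) : (Space d →L[ℝ] Space d) →L[ℝ] ℝ :=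
  ∑ i, (EuclideanSpace.proj i : Space d →L[ℝ] ℝ).comp
    (ContinuousLinearMap.apply ℝ (Space d) (EuclideanSpace.single i 1))

theorem divergenceCLM_apply (A : Space d →L[ℝ] Space d) :
    divergenceCLM d A = ∑ i, A (EuclideanSpace.single i 1) i := by
  simp [divergenceCLM]

theorem divergence_eq_divergenceCLM (u : Space d → Space d) (x : Space d) :
    divergence u x = divergenceCLM d (fderiv ℝ u x) := by
  rw [divergenceCLM_apply, divergence]

/-- The trace of the weak derivative of a divergence-free function vanishes. -/
theorem IsDivergenceFree.ae_eq_zero {U : Set (Space d)} (hU : IsOpen U) (hfin : volume U ≠ ⊤)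
    {w : Space d → Space d} {G : Space d → Space d →L[ℝ] Space d} (hdiv : IsDivergenceFree U w)
    (hw : MemLp w 2 (volume.restrict U)) (hG : MemLp G 2 (volume.restrict U))
    (h : HasWeakFDeriv U w G) : ∀ᵐ x ∂(volume.restrict U), divergenceCLM d (G x) = 0 := by
  have : IsFiniteMeasure (volume.restrict U) := ⟨by simpa using hfin.lt_top⟩
  have iw := hw.integrable one_le_two
  have iG := fun e => ((hG.integrable one_le_two).apply_continuousLinearMap e)
  have iD : Integrable (fun x => divergenceCLM d (G x)) (volume.restrict U) :=
    (divergenceCLM d).integrable_comp (hG.integrable one_le_two)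
  have key := hU.ae_eq_zero_of_integral_contDiff_smul_eq_zero (μ := volume.restrict U)
      (f := fun x => divergenceCLM d (G x)) (iD.locallyIntegrable.locallyIntegrableOn U)
      fun φ hφ hφc hφs => ?_
  · filter_upwards [key, ae_restrict_mem hU.measurableSet] with x hx hxU using hx hxU
  · obtain ⟨C, hC⟩ := hφc.exists_bound_of_continuous hφ.continuous
    have hcd := hφ.continuous_fderiv (by simp)
    obtain ⟨C', hC'⟩ := (hφc.fderiv ℝ).exists_bound_of_continuous hcd
    have h1 : ∀ i, ∫ x in U, fderiv ℝ φ x (EuclideanSpace.single i 1) * w x i =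
        -∫ x in U, φ x * G x (EuclideanSpace.single i 1) i := by
      intro i
      have h2 := congrArg (fun v : Space d => v i) (h φ ⟨hφ, hφc, hφs⟩ (EuclideanSpace.single i 1))
      simp only [PiLp.neg_apply] at h2
      have e1 := (EuclideanSpace.proj i : Space d →L[ℝ] ℝ).integral_comp_comm
        (φ := fun x => fderiv ℝ φ x (EuclideanSpace.single i 1) • w x)
        (μ := volume.restrict U) (iw.bdd_smul (C' * 1)
          (hcd.clm_apply continuous_const).aestronglyMeasurable (Eventually.of_forall fun x =>
            (fderiv ℝ φ x).le_of_opNorm_le_of_le (hC' x) (by simp)))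
      have e2 := (EuclideanSpace.proj i : Space d →L[ℝ] ℝ).integral_comp_comm
        (φ := fun x => φ x • G x (EuclideanSpace.single i 1))
        (μ := volume.restrict U) ((iG _).bdd_smul C
          hφ.continuous.aestronglyMeasurable (Eventually.of_forall hC))
      simp only [map_smul, smul_eq_mul, PiLp.proj_apply] at e1 e2
      rw [e1, e2, h2]
    have h3 := hdiv φ ⟨hφ, hφc, hφs⟩
    have h4 : ∀ x, fderiv ℝ φ x (w x) =
        ∑ i, fderiv ℝ φ x (EuclideanSpace.single i 1) * w x i := by
      intro x
      conv_lhs => rw [← (EuclideanSpace.basisFun (Fin d) ℝ).sum_repr (w x), map_sum]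
      simp [mul_comm]
    simp_rw [h4] at h3
    rw [integral_finsetSum _ fun i _ => ?_] at h3
    · simp_rw [h1] at h3
      simp_rw [divergenceCLM_apply, smul_eq_mul, Finset.mul_sum]
      rw [integral_finsetSum _ fun i _ => ?_]
      · rw [Finset.sum_neg_distrib] at h3; linarith
      · exact ((EuclideanSpace.proj i : Space d →L[ℝ] ℝ).integrable_comp (iG _)).bdd_mul
          hφ.continuous.aestronglyMeasurable (Eventually.of_forall hC)
    · exact ((EuclideanSpace.proj i : Space d →L[ℝ] ℝ).integrable_comp iw).bdd_mul (c := C' * 1)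
          (hcd.clm_apply continuous_const).aestronglyMeasurable (Eventually.of_forall fun x =>
            (fderiv ℝ φ x).le_of_opNorm_le_of_le (hC' x) (by simp))

variable {T F : Finset (Space d)}

theorem exists_norm_le_on_cell {V : Type*} [NormedAddCommGroup V] {f : Space d → V}
    (hf : Continuous f) (T : Finset (Space d)) : ∃ C, ∀ x ∈ cell T, ‖f x‖ ≤ C :=
  (isCompact_cell T).exists_bound_of_continuousOn hf.continuousOn

/-- Green's formula with a polynomial for a divergence-free function and its traces: the limit of
the formula for smooth functions. -/
theorem IsSimplex.green_of_isDivergenceFree [DecidableEq (Space d)] (hT : IsSimplex T) (hd : 0 < d)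
    {w : Space d → Space d} (hdiv : IsDivergenceFree (interior (cell T)) w)
    {φ : ℕ → Space d → Space d} (hφ : ∀ n, ContDiff ℝ ∞ (φ n))
    (hw : IsH1Limit (interior (cell T)) φ w)
    {g : ∀ a : T, cell (T.erase (a : Space d)) → Space d}
    (hg : ∀ a : T, MemLp (g a) 2 (surfaceMeasure (T.erase (a : Space d))))
    (hlim : ∀ a : T, Tendsto (fun n => eLpNorm (fun x : cell (T.erase (a : Space d)) =>
      φ n x - g a x) 2 (surfaceMeasure (T.erase (a : Space d)))) atTop (𝓝 0))
    (Q : MvPolynomial (Fin d) ℝ) :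
    ∫ x in cell T, inner ℝ (w x) (polyField (fun i => pderiv i Q) x) =
      ∑ a : T, ∫ y : cell (T.erase (a : Space d)), polyEval Q y *
        inner ℝ (g a y) (outwardNormal T (T.erase (a : Space d)))
          ∂(surfaceMeasure (T.erase (a : Space d))) := by
  have hfin : ∀ a : T, IsFiniteMeasure (surfaceMeasure (T.erase (a : Space d))) := fun a =>
    (hT.isFace hd a).isFiniteMeasure
  obtain ⟨G, h1, h2, h3, h4, h5⟩ := hw
  have h0 := hdiv.ae_eq_zero isOpen_interior
    ((measure_mono interior_subset).trans_lt (isCompact_cell T).measure_lt_top).ne h1 h2 h3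
  rw [restrict_interior_cell] at h0 h1 h2 h4 h5
  have : IsFiniteMeasure ((volume : Measure (Space d)).restrict (cell T)) :=
    ⟨by simpa using (isCompact_cell T).measure_lt_top⟩
  have bd : ∀ {V : Type} [NormedAddCommGroup V] {f : Space d → V}, Continuous f →
      ∃ C, ∀ᵐ x ∂((volume : Measure (Space d)).restrict (cell T)), ‖f x‖ ≤ C := fun hf => by
    obtain ⟨C, hC⟩ := exists_norm_le_on_cell hf T
    exact ⟨C, by filter_upwards [ae_restrict_mem (measurableSet_cell T)] with x hx using hC x hx⟩
  -- the divergence term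
  have t1 : Tendsto (fun n => ∫ x in cell T, polyEval Q x * divergence (φ n) x) atTop (𝓝 0) := by
    have hB : Continuous fun x : Space d => polyEval Q x • divergenceCLM d := by fun_prop
    obtain ⟨C, hC⟩ := bd (V := (Space d →L[ℝ] Space d) →L[ℝ] ℝ) hB
    have := tendsto_integral_clm (fun n => ((hφ n).continuous_fderiv
      (by simp)).aestronglyMeasurable) h2 h5 hB.aestronglyMeasurable hC
    simp only [smul_apply, smul_eq_mul, ← divergence_eq_divergenceCLM] at this
    rwa [integral_eq_zero_of_ae (by filter_upwards [h0] with x hx; simp [hx])] at this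
  -- the gradient term
  have t2 : Tendsto (fun n => ∫ x in cell T, inner ℝ (φ n x) (polyField (fun i => pderiv i Q) x))
      atTop (𝓝 (∫ x in cell T, inner ℝ (w x) (polyField (fun i => pderiv i Q) x))) := by
    have hB : Continuous fun x : Space d => innerSL ℝ (polyField (fun i => pderiv i Q) x) := by
      fun_prop
    obtain ⟨C, hC⟩ := bd (V := Space d →L[ℝ] ℝ) hB
    have := tendsto_integral_clm (fun n => (hφ n).continuous.aestronglyMeasurable) h1 h4
      hB.aestronglyMeasurable hC
    simpa only [innerSL_apply_apply, real_inner_comm] using this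
  -- the face terms
  have t3 : ∀ a : T, Tendsto (fun n => ∫ y in cell (T.erase (a : Space d)), polyEval Q y *
      inner ℝ (φ n y) (outwardNormal T (T.erase (a : Space d))) ∂μHE[d - 1]) atTop
      (𝓝 (∫ y : cell (T.erase (a : Space d)), polyEval Q y *
        inner ℝ (g a y) (outwardNormal T (T.erase (a : Space d)))
          ∂(surfaceMeasure (T.erase (a : Space d))))) := by
    intro a
    have hB : Continuous fun x : cell (T.erase (a : Space d)) =>
        polyEval Q x • innerSL ℝ (outwardNormal T (T.erase (a : Space d))) := by fun_prop
    obtain ⟨C, hC⟩ := isCompact_univ.exists_bound_of_continuousOn hB.continuousOn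
    have := tendsto_integral_clm (fun n => ((hφ n).continuous.comp
      continuous_subtype_val).aestronglyMeasurable) (hg a) (hlim a)
      hB.aestronglyMeasurable (Eventually.of_forall fun x => hC x trivial)
    simp only [smul_apply, smul_eq_mul, innerSL_apply_apply,
      Function.comp_apply] at this
    simp_rw [fun v => real_inner_comm (outwardNormal T (T.erase (a : Space d))) v]
    exact this.congr fun n => integral_surfaceMeasure (T.erase (a : Space d)) (fun y =>
      polyEval Q y * inner ℝ (outwardNormal T (T.erase (a : Space d))) (φ n y))
  have t4 := t2.neg.add (tendsto_finsetSum Finset.univ fun a _ => t3 a)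
  have t5 := tendsto_nhds_unique t1 (t4.congr fun n =>
    (hT.green hd Q ((hφ n).of_le (by simp))).symm)
  linarith

end DivergenceFree

/-! ### Jumps across faces -/

section Jumps

variable {d : ℕ}

theorem integral_divergence_eq_zero {u : Space d → Space d} (hu : ContDiff ℝ 1 u)
    (hc : HasCompactSupport u) : ∫ x, divergence u x = 0 := by
  have hd := hu.differentiable one_ne_zero
  have hcd := hu.continuous_fderiv one_ne_zero
  have hi : ∀ i : Fin d, Integrable
      (fun x => fderiv ℝ u x (EuclideanSpace.single i 1)) (volume : Measure (Space d)) := fun i =>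
    (hcd.clm_apply continuous_const).integrable_of_hasCompactSupport
      ((hc.fderiv ℝ).mono' fun x hx => subset_tsupport _ fun h => hx (by simp [h]))
  have h0 : ∀ i : Fin d, ∫ x, fderiv ℝ u x (EuclideanSpace.single i 1) = 0 := by
    intro i
    have := integral_smul_fderiv_eq_neg_fderiv_smul_of_integrable (𝕜 := ℝ)
      (μ := (volume : Measure (Space d))) (f := fun _ => (1 : ℝ)) (g := u)
      (v := EuclideanSpace.single i 1) (by simp) (by simpa using hi i)
      (by simpa using hu.continuous.integrable_of_hasCompactSupport hc) (by simp) fun x _ => hd x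
    simpa using this
  refine (integral_finsetSum _ fun i _ =>
    (EuclideanSpace.proj i : Space d →L[ℝ] ℝ).integrable_comp (hi i)).trans
    (Finset.sum_eq_zero fun i _ => ?_)
  have := (EuclideanSpace.proj i : Space d →L[ℝ] ℝ).integral_comp_comm (hi i)
  rw [h0 i, map_zero] at this
  exact this

variable {Ω : Set (Space d)} (M : SimplicialMesh Ω)

namespace SimplicialMesh

theorem iUnion_cell : ⋃ T : M.elements, cell T.1 = closure Ω := by
  rw [← M.iUnion_eq]
  exact Set.iUnion_subtype (· ∈ M.elements) fun T => cell T.1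

theorem cell_subset_closure (T : M.elements) : cell T.1 ⊆ closure Ω := by
  rw [← M.iUnion_cell]
  exact Set.subset_iUnion (fun T : M.elements => cell T.1) T

theorem interior_cell_subset (hΩreg : interior (closure Ω) = Ω) (T : M.elements) :
    interior (cell T.1) ⊆ Ω :=
  (interior_mono (M.cell_subset_closure T)).trans hΩreg.subset

/-- Two elements meet in a proper face of both, which has no volume. -/
theorem pairwise_aedisjoint :
    Pairwise (Function.onFun (AEDisjoint (volume : Measure (Space d)))
      fun T : M.elements => cell T.1) := by
  classical
  intro T T' hne
  have h : cell T.1 ∩ cell T'.1 = cell (T.1 ∩ T'.1) := by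
    rw [M.inter_eq T.1 T.2 T'.1 T'.2, cell, Finset.coe_inter]
  rw [Function.onFun, AEDisjoint, h]
  refine (M.isSimplex T).volume_cell_eq_zero_of_ssubset
    (Finset.ssubset_iff_subset_ne.2 ⟨Finset.inter_subset_left, fun e => hne (Subtype.ext ?_)⟩)
  exact Finset.eq_of_subset_of_card_le (Finset.inter_eq_left.1 e)
    (by rw [(M.isSimplex T).card_eq, (M.isSimplex T').card_eq])

/-- Summation over faces of elements, and over elements adjacent to faces. -/
theorem sum_facesOf_comm (f : M.elements → M.faces → ℝ) :
    ∑ T : M.elements, ∑ F : M.FacesOf T, f T F.1 =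
      ∑ F : M.faces, ∑ T : M.elements with F.1 ⊆ T.1, f T F := by
  simp_rw [Finset.sum_filter]
  rw [Finset.sum_comm]
  refine Finset.sum_congr rfl fun T _ => ?_
  rw [← Finset.sum_filter]
  exact (Finset.sum_subtype _ (by simp) _).symm

/-- The sum of the outward normals to `F` of the elements with face `F`. -/
noncomputable def normalSum (F : M.faces) : Space d :=
  ∑ T : M.elements with F.1 ⊆ T.1, outwardNormal T.1 F.1

/-- Two faces meet in the simplex spanned by their common vertices, also when they belong to
different elements. -/
theorem cell_face_inter_subset [DecidableEq (Space d)] (F F' : M.faces) :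
    cell F.1 ∩ cell F'.1 ⊆ cell (F.1 ∩ F'.1) := by
  obtain ⟨T, hT⟩ := M.exists_element F
  obtain ⟨T', hT'⟩ := M.exists_element F'
  have hTi := M.affineIndependent T.1 T.2
  have hTi' := M.affineIndependent T'.1 T'.2
  have sub : ∀ {S S' : Finset (Space d)}, S ⊆ S' → (S : Set (Space d)) ⊆ S' := fun h =>
    Finset.coe_subset.2 h
  rintro x ⟨hx, hx'⟩
  have h1 : x ∈ cell (T.1 ∩ T'.1) := by
    rw [cell, Finset.coe_inter, ← M.inter_eq T.1 T.2 T'.1 T'.2]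
    exact ⟨convexHull_mono (sub hT) hx, convexHull_mono (sub hT') hx'⟩
  have h2 : x ∈ cell (F.1 ∩ (T.1 ∩ T'.1)) := by
    rw [cell, Finset.coe_inter, AffineIndependent.convexHull_inter (s := T.1) hTi hT
      Finset.inter_subset_left]
    exact ⟨hx, h1⟩
  have h3 : x ∈ cell (F'.1 ∩ (T.1 ∩ T'.1)) := by
    rw [cell, Finset.coe_inter, AffineIndependent.convexHull_inter (s := T'.1) hTi' hT'
      Finset.inter_subset_right]
    exact ⟨hx', h1⟩
  have h4 : x ∈ cell (F.1 ∩ (T.1 ∩ T'.1) ∩ (F'.1 ∩ (T.1 ∩ T'.1))) := by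
    rw [cell, Finset.coe_inter, AffineIndependent.convexHull_inter (s := T.1) hTi
      (Finset.inter_subset_left.trans hT)
      (Finset.inter_subset_right.trans Finset.inter_subset_left)]
    exact ⟨h2, h3⟩
  refine convexHull_mono (sub fun y hy => ?_) h4
  simp only [Finset.mem_inter] at hy ⊢
  exact ⟨hy.1.1, hy.2.1⟩

theorem measure_face_inter_eq_zero (hd : 0 < d) {F F' : M.faces} (h : F ≠ F') :
    μHE[d - 1] (cell F.1 ∩ cell F'.1) = 0 := by
  classical
  obtain ⟨T, hT⟩ := M.exists_element F
  refine measure_mono_null (M.cell_face_inter_subset F F') ?_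
  refine (M.isFace hd hT).measure_eq_zero_of_ssubset
    (Finset.ssubset_iff_subset_ne.2 ⟨Finset.inter_subset_left, fun e => h (Subtype.ext ?_)⟩)
  exact Finset.eq_of_subset_of_card_le (Finset.inter_eq_left.1 e)
    (by rw [M.card_face F, M.card_face F'])

/-- The divergence theorem on all elements, for a test function: the contributions of the faces
cancel. -/
theorem sum_integral_normalSum_eq_zero (hd : 0 < d) {φ : Space d → Space d}
    (hφ : IsTestFunction Ω φ) :
    ∑ F : M.faces, ∫ y in cell F.1, inner ℝ (φ y) (M.normalSum F) ∂μHE[d - 1] = 0 := by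
  classical
  have hφ1 : ContDiff ℝ 1 φ := hφ.1.of_le (by simp)
  have hzero : ∀ x ∉ ⋃ T : M.elements, cell T.1, divergence φ x = 0 := by
    intro x hx
    rw [M.iUnion_cell] at hx
    have : fderiv ℝ φ x = 0 := by
      by_contra hne
      exact hx (subset_closure (hφ.2.2 (support_fderiv_subset ℝ hne)))
    simp [divergence, this]
  have h1 := integral_divergence_eq_zero hφ1 hφ.2.1
  rw [← setIntegral_eq_integral_of_forall_compl_eq_zero hzero] at h1
  have hsum := integral_iUnion_ae (f := divergence φ) (s := fun T : M.elements => cell T.1)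
    (fun T => (measurableSet_cell T.1).nullMeasurableSet) M.pairwise_aedisjoint
    (integrableOn_finite_iUnion.2 fun T => (continuous_divergence hφ1).integrableOn_cell T.1)
  rw [h1, tsum_fintype] at hsum
  have h2 : ∀ T : M.elements, ∫ x in cell T.1, divergence φ x = ∑ F : M.FacesOf T,
      ∫ y in cell F.1.1, inner ℝ (φ y) (outwardNormal T.1 F.1.1) ∂μHE[d - 1] := by
    intro T
    rw [(M.isSimplex T).divergence_theorem hd hφ1, M.sum_facesOf T fun F =>
      ∫ y in cell F, inner ℝ (φ y) (outwardNormal T.1 F) ∂μHE[d - 1]]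
  simp_rw [h2] at hsum
  rw [M.sum_facesOf_comm fun T F => ∫ y in cell F.1,
    inner ℝ (φ y) (outwardNormal T.1 F.1) ∂μHE[d - 1]] at hsum
  rw [hsum]
  refine Finset.sum_congr rfl fun F _ => ?_
  obtain ⟨T, hT⟩ := M.exists_element F
  have := (M.isFace hd hT).isFiniteMeasure
  have hc := hφ.1.continuous
  simp_rw [normalSum, inner_sum]
  rw [← integral_surfaceMeasure F.1 (fun y => ∑ T : M.elements with F.1 ⊆ T.1,
    inner ℝ (φ y) (outwardNormal T.1 F.1)), integral_finsetSum _ fun T _ =>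
    integrable_of_continuous_cell (by fun_prop)]
  exact Finset.sum_congr rfl fun T _ => integral_surfaceMeasure F.1
    fun y => inner ℝ (φ y) (outwardNormal T.1 F.1)

/-- The normals of the elements adjacent to a face cancel, unless the face has no surface in `Ω`:
test functions localize the divergence theorem to the relative interior of a face. -/
theorem normalSum_eq_zero_or (hΩ : IsOpen Ω) (hd : 0 < d) (F : M.faces) :
    M.normalSum F = 0 ∨ μHE[d - 1] (cell F.1 ∩ Ω) = 0 := by
  obtain ⟨T, hT⟩ := M.exists_element F
  have hF := M.isFace hd hT
  have hfin := hF.isFiniteMeasure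
  have hop := hF.isOpenPosMeasure
  -- the other faces; a test function supported in `Ω \ K` only sees the face `F`
  set K : Set (Space d) := ⋃ F' : {F' : M.faces // F' ≠ F}, cell F'.1.1 with hK
  have hKc : IsClosed K := isClosed_iUnion_of_finite fun F' => (isCompact_cell _).isClosed
  by_cases hne : ((Ω \ K) ∩ cell F.1).Nonempty
  · left
    obtain ⟨x, hxU, hxF⟩ := hne
    by_contra hc
    obtain ⟨ψ, hψs, hψc, hψ, hψr, hψx⟩ := exists_contDiff_tsupport_subset (n := ⊤)
      ((hΩ.sdiff hKc).mem_nhds hxU)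
    have hψz : ∀ y ∉ Ω \ K, ψ y = 0 := fun y hy => by
      by_contra h
      exact hy (hψs (subset_tsupport _ h))
    have htest : IsTestFunction Ω fun y => ψ y • M.normalSum F := by
      refine ⟨hψ.smul contDiff_const, hψc.smul_right, ?_⟩
      exact (closure_mono (Function.support_smul_subset_left _ _)).trans
        (hψs.trans Set.sdiff_subset)
    have h1 := M.sum_integral_normalSum_eq_zero hd htest
    rw [Finset.sum_eq_single F] at h1
    · rw [← integral_surfaceMeasure F.1 (fun y => inner ℝ (ψ y • M.normalSum F)
        (M.normalSum F))] at h1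
      simp_rw [real_inner_smul_left, integral_mul_const] at h1
      have h2 := (mul_eq_zero.1 h1).resolve_right (by simpa using hc)
      have hcont : Continuous fun y : cell F.1 => ψ y := hψ.continuous.comp continuous_subtype_val
      rw [integral_eq_zero_iff_of_nonneg (fun y => (hψr ⟨y.1, rfl⟩).1)
        (integrable_of_continuous_cell hcont)] at h2
      have h3 := congrFun ((Continuous.ae_eq_iff_eq (surfaceMeasure F.1) hcont
        continuous_zero).1 h2) ⟨x, hxF⟩
      rw [hψx] at h3
      exact one_ne_zero h3
    · intro F' _ hF'
      refine (setIntegral_congr_fun (g := fun _ => (0 : ℝ)) (measurableSet_cell _)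
        fun y hy => ?_).trans (integral_zero _ _)
      simp [hψz y fun h => h.2 (Set.mem_iUnion.2 ⟨⟨F', hF'⟩, hy⟩)]
    · simp
  · right
    rw [Set.not_nonempty_iff_eq_empty] at hne
    refine measure_mono_null (t := ⋃ F' : {F' : M.faces // F' ≠ F}, cell F.1 ∩ cell F'.1.1) ?_
      (measure_iUnion_null fun F' => M.measure_face_inter_eq_zero hd F'.2.symm)
    rintro y ⟨hyF, hyΩ⟩
    rw [← Set.inter_iUnion]
    refine ⟨hyF, ?_⟩
    by_contra hyK
    exact Set.eq_empty_iff_forall_notMem.1 hne y ⟨⟨hyΩ, hyK⟩, hyF⟩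

end SimplicialMesh

/-- The traces of a limit of test functions vanish on faces without surface in `Ω`. -/
theorem trace_ae_eq_zero {F : Finset (Space d)} {Ω : Set (Space d)}
    (hF : μHE[d - 1] (cell F ∩ Ω) = 0) {φ : ℕ → Space d → Space d}
    (hφ : ∀ n, IsTestFunction Ω (φ n)) {g : cell F → Space d}
    (hg : AEStronglyMeasurable g (surfaceMeasure F))
    (h : Tendsto (fun n => eLpNorm (fun x : cell F => φ n x - g x) 2 (surfaceMeasure F))
      atTop (𝓝 0)) : g =ᵐ[surfaceMeasure F] 0 := by
  have h0 : ∀ᵐ x : cell F ∂(surfaceMeasure F), (x : Space d) ∉ Ω := by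
    rw [ae_iff, surfaceMeasure, comap_subtype_coe_apply (measurableSet_cell F)]
    convert hF using 2
    ext x
    simp [and_comm]
  have h1 : ∀ n, eLpNorm (fun x : cell F => φ n x - g x) 2 (surfaceMeasure F) =
      eLpNorm g 2 (surfaceMeasure F) := by
    intro n
    rw [← eLpNorm_neg g]
    refine eLpNorm_congr_ae ?_
    filter_upwards [h0] with x hx
    have : φ n x = 0 := by
      by_contra hne
      exact hx ((hφ n).2.2 (subset_tsupport _ hne))
    simp [this]
  simp_rw [h1] at h
  exact (eLpNorm_eq_zero_iff hg two_ne_zero).1 (tendsto_nhds_unique tendsto_const_nhds h)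

end Jumps

/-! ### The hybrid interpolant -/

section HybridInterpolant

open MvPolynomial

variable {d : ℕ} {Ω : Set (Space d)} (M : SimplicialMesh Ω) (k : ℕ)

/-- The interpolant of a divergence-free function is divergence free. -/
theorem IsRTNInterpolant.integral_mul_divergenceOn_eq_zero {T : Finset (Space d)}
    (hT : IsSimplex T) (hd : 0 < d) {k : ℤ} {w : Space d → Space d} {v : cell T → Space d}
    (h : IsRTNInterpolant (k + 1) T w v) (hdiv : IsDivergenceFree (interior (cell T)) w)
    {φ : ℕ → Space d → Space d} (hφ : ∀ n, ContDiff ℝ ∞ (φ n))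
    (hw : IsH1Limit (interior (cell T)) φ w) {q : cell T → ℝ} (hq : q ∈ polySpace k (cell T)) :
    ∫ x, q x * divergenceOn (cell T) v x ∂(volumeMeasure T) = 0 := by
  classical
  obtain ⟨Q, hQ, rfl⟩ := mem_polySpace_iff.1 hq
  obtain ⟨p, rfl⟩ := exists_field_eq h.1
  have hp : ContDiff ℝ 1 (polyField p.field) := contDiff_polyField p.field
  choose g hg hlim using fun a : T => (hT.isFace hd a).exists_trace hφ hw
  have hw2 := memLp_volumeMeasure hw.choose_spec.1
  have h1 := hT.green hd Q hp
  have h2 := hT.green_of_isDivergenceFree hd hdiv hφ hw hg hlim Q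
  simp_rw [divergenceOn_eq hT hp]
  rw [integral_volumeMeasure T fun x => polyEval Q x * divergence (polyField p.field) x, h1]
  -- the interior moments of the two fields agree, and so do those of their normal components
  have h3 : ∫ x in cell T, inner ℝ (polyField p.field x) (polyField (fun i => pderiv i Q) x) =
      ∫ x in cell T, inner ℝ (w x) (polyField (fun i => pderiv i Q) x) := by
    rw [← integral_volumeMeasure T fun x => inner ℝ (polyField p.field x)
      (polyField (fun i => pderiv i Q) x), ← integral_volumeMeasure T fun x => inner ℝ (w x)
      (polyField (fun i => pderiv i Q) x)]
    have e : ∀ u v : Space d, inner ℝ u v = ∑ i, u i * v i := fun u v => by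
      simp [PiLp.inner_apply, mul_comm]
    simp_rw [e, polyField_apply (fun i => pderiv i Q)]
    have hr := fun i => polyEval_mem_polySpace (cell T) (pderiv_mem_polyDeg i hQ)
    have hm := fun i => h.interior_moments i (hr i)
    rw [integral_finsetSum _ fun i _ =>
      integrable_mul_of_mem_polySpace (integrable_field T p i) (hr i),
      integral_finsetSum _ fun i _ =>
      integrable_mul_of_mem_polySpace (integrable_coord_of_memLp hw2 i) (hr i)]
    exact Finset.sum_congr rfl fun i _ => hm i
  have h4 : ∀ a : T, ∫ y in cell (T.erase (a : Space d)), polyEval Q y *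
      inner ℝ (polyField p.field y) (outwardNormal T (T.erase (a : Space d))) ∂μHE[d - 1] =
      ∫ y : cell (T.erase (a : Space d)), polyEval Q y *
        inner ℝ (g a y) (outwardNormal T (T.erase (a : Space d)))
          ∂(surfaceMeasure (T.erase (a : Space d))) := by
    intro a
    have hm := h.face_moments (hT.isFace hd a) ⟨hg a, φ, hφ, hw, hlim a⟩
      (polyEval_mem_polySpace _ hQ)
    rw [← integral_surfaceMeasure (T.erase (a : Space d)) fun y => polyEval Q y *
      inner ℝ (polyField p.field y) (outwardNormal T (T.erase (a : Space d)))]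
    simp_rw [mul_comm (polyEval Q _)]
    exact hm
  rw [h3, h2, Finset.sum_congr rfl fun a _ => h4 a, neg_add_cancel]

variable {M k}

theorem IsHybridInterpolant.unique (hd : 0 < d) {w : Space d → Space d} {v v' : VelocitySpace M k}
    (h : IsHybridInterpolant M k w v) (h' : IsHybridInterpolant M k w v') : v = v' := by
  refine Prod.ext (funext fun T => Subtype.ext ?_) (funext fun F => Subtype.ext ?_)
  · exact (h.1 T).unique (M.isSimplex T) hd (h'.1 T)
  · obtain ⟨T, hT⟩ := M.exists_element F
    have hF := M.isFace hd hT
    have hfin := hF.isFiniteMeasure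
    have hop := hF.isOpenPosMeasure
    obtain ⟨g, hg, hp⟩ := h.2 F
    obtain ⟨g', hg', hp'⟩ := h'.2 F
    have hgg := hF.trace_ae_eq (hg T hT) (hg' T hT)
    ext x i
    refine congrFun (IsL2Proj.unique ?_ (hp i) (hp' i)) x
    filter_upwards [hgg] with y hy
    rw [hy]

/-- If the traces are the limits of one sequence, they are the traces from all adjacent elements. -/
theorem SimplicialMesh.exists_traces (M : SimplicialMesh Ω) (hΩreg : interior (closure Ω) = Ω)
    (hd : 0 < d) {φ : ℕ → Space d → Space d} {w : Space d → Space d}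
    (hφ : ∀ n, ContDiff ℝ ∞ (φ n)) (hw : IsH1Limit Ω φ w) :
    ∃ g : ∀ F : M.faces, cell F.1 → Space d,
      (∀ F, MemLp (g F) 2 (surfaceMeasure F.1)) ∧
      (∀ F, Tendsto (fun n => eLpNorm (fun x : cell F.1 => φ n x - g F x) 2
        (surfaceMeasure F.1)) atTop (𝓝 0)) ∧
      ∀ (F : M.faces) (T : M.elements), F.1 ⊆ T.1 → IsTrace T.1 F.1 w (g F) := by
  have hwT := fun T : M.elements => hw.mono (M.interior_cell_subset hΩreg T)
  have hex : ∀ F : M.faces, ∃ g : cell F.1 → Space d, MemLp g 2 (surfaceMeasure F.1) ∧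
      Tendsto (fun n => eLpNorm (fun x : cell F.1 => φ n x - g x) 2
        (surfaceMeasure F.1)) atTop (𝓝 0) := fun F => by
    obtain ⟨T, hT⟩ := M.exists_element F
    exact (M.isFace hd hT).exists_trace hφ (hwT T)
  choose g hg hlim using hex
  exact ⟨g, hg, hlim, fun F T _ => ⟨hg F, φ, hφ, hwT T, hlim F⟩⟩

theorem exists_isHybridInterpolant (M : SimplicialMesh Ω) (k : ℕ)
    (hΩreg : interior (closure Ω) = Ω) (hd : 0 < d)
    {φ : ℕ → Space d → Space d} {w : Space d → Space d} (hφ : ∀ n, ContDiff ℝ ∞ (φ n))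
    (hw : IsH1Limit Ω φ w) : ∃ v : VelocitySpace M k, IsHybridInterpolant M k w v := by
  obtain ⟨g, hg, -, htr⟩ := M.exists_traces hΩreg hd hφ hw
  have hT : ∀ T : M.elements, ∃ v, IsRTNInterpolant (k + 1 : ℤ) T.1 w v := fun T => by
    have hwT := hw.mono (M.interior_cell_subset hΩreg T)
    refine (M.isSimplex T).exists_isRTNInterpolant hd k hwT.choose_spec.1 fun F hF => ?_
    exact ⟨_, htr ⟨F, M.mem_faces.2 ⟨T.1, T.2, hF.subset, hF.card_eq⟩⟩ T hF.subset⟩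
  have hF : ∀ F : M.faces, ∃ v, IsL2ProjVec (k : ℤ) (cell F.1) (surfaceMeasure F.1) (g F) v :=
    fun F => by
    obtain ⟨T, hT⟩ := M.exists_element F
    have hfin := (M.isFace hd hT).isFiniteMeasure
    have hop := (M.isFace hd hT).isOpenPosMeasure
    choose P hP using fun i => exists_isL2Proj (k : ℤ) (integrable_coord_of_memLp (hg F) i)
    exact ⟨fun x => WithLp.toLp 2 fun i => P i x, hP⟩
  choose vT hvT using hT
  choose vF hvF using hF
  exact ⟨⟨fun T => ⟨vT T, (hvT T).1⟩, fun F => ⟨vF F, fun i => (hvF F i).1⟩⟩, hvT,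
    fun F => ⟨g F, fun T => htr F T, hvF F⟩⟩

/-- The trace vanishes on boundary faces. -/
theorem IsHybridInterpolant.mem_velocitySpaceZero (hΩ : IsOpen Ω)
    (hΩreg : interior (closure Ω) = Ω) (hd : 0 < d) {w : Space d → Space d} (hw : MemH10 Ω w)
    {v : VelocitySpace M k} (h : IsHybridInterpolant M k w v) : v ∈ velocitySpaceZero M k := by
  obtain ⟨φ, hφ, hw⟩ := hw
  obtain ⟨g, hg, hlim, htr⟩ := M.exists_traces hΩreg hd (fun n => (hφ n).1) hw
  intro F hF
  obtain ⟨T, hT⟩ := M.exists_element F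
  have hFT := M.isFace hd hT
  have hfin := hFT.isFiniteMeasure
  have hop := hFT.isOpenPosMeasure
  -- a boundary face does not meet the open set `Ω`
  have hempty : cell F.1 ∩ Ω = ∅ := by
    rw [SimplicialMesh.IsBoundaryFace, hΩ.frontier_eq] at hF
    exact Set.eq_empty_iff_forall_notMem.2 fun x hx => (hF hx.1).2 hx.2
  have h0 := trace_ae_eq_zero (by rw [hempty, measure_empty]) hφ (hg F).aestronglyMeasurable
    (hlim F)
  obtain ⟨g', hg', hp⟩ := h.2 F
  have hgg := hFT.trace_ae_eq (hg' T hT) (htr F T hT)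
  refine Subtype.ext ?_
  ext x i
  refine congrFun (IsL2Proj.unique (p' := fun _ => 0) (q' := fun _ => 0) ?_ (hp i)
    ⟨Submodule.zero_mem _, fun r _ => rfl⟩) x
  filter_upwards [hgg, h0] with y hy hy0
  rw [hy, hy0]
  rfl

/-- The terms of the elements vanish since the interpolants are divergence free, and the terms of
the faces since the normals cancel where the trace is not zero. -/
theorem IsHybridInterpolant.couplingForm_eq_zero (hΩ : IsOpen Ω)
    (hΩreg : interior (closure Ω) = Ω) (hd : 0 < d) {w : Space d → Space d} (hw : MemH10 Ω w)
    (hdiv : IsDivergenceFree Ω w) {v : VelocitySpace M k} (h : IsHybridInterpolant M k w v)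
    (q : PressureSpace M k) : couplingForm M k v q = 0 := by
  obtain ⟨φ, hφ, hw⟩ := hw
  obtain ⟨g, hg, hlim, htr⟩ := M.exists_traces hΩreg hd (fun n => (hφ n).1) hw
  have hel : ∀ T : M.elements, elementCoupling M k T q (v.1 T) = ∑ F : M.FacesOf T,
      ∫ x : cell F.1.1, inner ℝ (g F.1 x) (outwardNormal T.1 F.1.1) * (q.2 F.1).1 x
        ∂(surfaceMeasure F.1.1) := by
    intro T
    have hU := M.interior_cell_subset hΩreg T
    rw [elementCoupling, (h.1 T).integral_mul_divergenceOn_eq_zero (M.isSimplex T) hd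
      (hdiv.mono hU) (fun n => (hφ n).1) (hw.mono hU) (q.1 T).2, neg_zero, zero_add]
    refine Finset.sum_congr rfl fun F _ => ?_
    rw [← (h.1 T).face_moments (M.isFace hd F.2) (htr F.1 T F.2) (q.2 F.1).2]
    simp_rw [mul_comm ((q.2 F.1).1 _)]
  rw [couplingForm_eq M k hd, Finset.sum_congr rfl fun T _ => hel T,
    M.sum_facesOf_comm fun T F => ∫ x : cell F.1, inner ℝ (g F x) (outwardNormal T.1 F.1) *
      (q.2 F).1 x ∂(surfaceMeasure F.1)]
  refine Finset.sum_eq_zero fun F _ => ?_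
  obtain ⟨T, hT⟩ := M.exists_element F
  have hfin := (M.isFace hd hT).isFiniteMeasure
  rw [← integral_finsetSum _ fun T _ => integrable_mul_of_mem_polySpace
    (((hg F).integrable one_le_two).inner_const _) (q.2 F).2]
  simp_rw [← Finset.sum_mul, ← inner_sum]
  change ∫ x, inner ℝ (g F x) (M.normalSum F) * (q.2 F).1 x ∂(surfaceMeasure F.1) = 0
  obtain h0 | h0 := M.normalSum_eq_zero_or hΩ hd F
  · simp [h0]
  · refine integral_eq_zero_of_ae ?_
    filter_upwards [trace_ae_eq_zero h0 hφ (hg F).aestronglyMeasurable (hlim F)] with x hx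
    simp [hx]

end HybridInterpolant

/-! ### Constant pressures -/

section ConstantPressure

open MvPolynomial

variable {d : ℕ} {Ω : Set (Space d)} (M : SimplicialMesh Ω) (k : ℕ)

theorem const_mem_polySpace (c : ℝ) (Y : Set (Space d)) :
    (fun _ => c) ∈ polySpace (k : ℤ) Y := by
  have h := polyEval_mem_polySpace Y (polyDeg_mono (by positivity : (0 : ℤ) ≤ k) (C_mem_polyDeg c))
  simpa using h

/-- The pressure that is equal to `c` on all elements and faces. -/
def constPressure (c : ℝ) : PressureSpace M k :=
  (fun _ => ⟨fun _ => c, const_mem_polySpace k c _⟩,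
    fun _ => ⟨fun _ => c, const_mem_polySpace k c _⟩)

/-- The divergence theorem for the fields of the Raviart--Thomas--Nédélec space. -/
theorem elementCoupling_constPressure (hd : 0 < d) (T : M.elements) (c : ℝ)
    (w : rtnSpace (k + 1 : ℤ) (cell T.1)) :
    elementCoupling M k T (constPressure M k c) w = 0 := by
  classical
  have hT := M.isSimplex T
  obtain ⟨w, hw⟩ := w
  obtain ⟨p, rfl⟩ := exists_field_eq hw
  have hp : ContDiff ℝ 1 (polyField p.field) := contDiff_polyField p.field
  have h1 := hT.divergence_theorem hd hp
  simp only [elementCoupling, constPressure, divergenceOn_eq hT hp, integral_const_mul,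
    ← Finset.mul_sum]
  rw [integral_volumeMeasure T.1 (divergence (polyField p.field)), h1, ← M.sum_facesOf T fun F =>
    ∫ y in cell F, inner ℝ (polyField p.field y) (outwardNormal T.1 F) ∂μHE[d - 1]]
  simp_rw [← integral_surfaceMeasure _ fun y => inner ℝ (polyField p.field y)
    (outwardNormal T.1 _)]
  exact neg_add_cancel _

theorem elementCoupling_add (hd : 0 < d) (T : M.elements) (q r : PressureSpace M k)
    (w : rtnSpace (k + 1 : ℤ) (cell T.1)) :
    elementCoupling M k T (q + r) w = elementCoupling M k T q w + elementCoupling M k T r w := by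
  have hT := M.isSimplex T
  have hfin : ∀ F : M.FacesOf T, IsFiniteMeasure (surfaceMeasure F.1.1) := fun F =>
    (M.isFace hd F.2).isFiniteMeasure
  have hi1 : ∀ q : PressureSpace M k, Integrable (fun x => (q.1 T).1 x *
      divergenceOn (cell T.1) w.1 x) (volumeMeasure T.1) := fun q =>
    integrable_of_continuous_cell ((continuous_of_mem_polySpace (q.1 T).2).mul
      (continuous_divergenceOn hT w.2))
  have hi2 : ∀ (q : PressureSpace M k) (F : M.FacesOf T), Integrable (fun x =>
      (q.2 F.1).1 x * inner ℝ (restrictToFace F.2 w.1 x) (outwardNormal T.1 F.1.1))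
      (surfaceMeasure F.1.1) := fun q F =>
    integrable_of_continuous_cell ((continuous_of_mem_polySpace (q.2 F.1).2).mul
      ((continuous_restrictToFace F.2 (continuous_of_mem_rtnSpace w.2)).inner continuous_const))
  simp only [elementCoupling, Prod.fst_add, Prod.snd_add, Pi.add_apply, Submodule.coe_add, add_mul]
  rw [integral_add (hi1 q) (hi1 r), Finset.sum_congr rfl fun F _ =>
    integral_add (hi2 q F) (hi2 r F), Finset.sum_add_distrib]
  ring

theorem couplingForm_add_constPressure (hd : 0 < d) (v : VelocitySpace M k)
    (q : PressureSpace M k) (c : ℝ) :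
    couplingForm M k v (q + constPressure M k c) = couplingForm M k v q := by
  simp_rw [couplingForm_eq M k hd, elementCoupling_add M k hd,
    elementCoupling_constPressure M k hd, add_zero]

/-- Every pressure can be shifted to mean value zero. -/
theorem exists_add_constPressure_mem (q : PressureSpace M k) :
    ∃ c, q + constPressure M k c ∈ pressureSpaceZero M k := by
  have hi : ∀ T : M.elements, Integrable (q.1 T).1 (volumeMeasure T.1) := fun T =>
    integrable_of_continuous_cell (continuous_of_mem_polySpace (q.1 T).2)
  have key : ∀ c, ∑ T : M.elements, ∫ x : cell T.1, ((q + constPressure M k c).1 T).1 x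
      ∂(volumeMeasure T.1) = ∑ T : M.elements, ∫ x, (q.1 T).1 x ∂(volumeMeasure T.1) +
        (∑ T : M.elements, (volumeMeasure T.1).real Set.univ) * c := by
    intro c
    rw [Finset.sum_mul, ← Finset.sum_add_distrib]
    refine Finset.sum_congr rfl fun T _ => ?_
    refine (integral_add (hi T) (integrable_const c)).trans ?_
    rw [integral_const, smul_eq_mul]
  simp_rw [pressureSpaceZero, Set.mem_ofPred_eq, key]
  cases isEmpty_or_nonempty M.elements
  · exact ⟨0, by simp⟩
  · have hpos : 0 < ∑ T : M.elements, (volumeMeasure T.1).real Set.univ := by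
      refine Finset.sum_pos (fun T _ => ?_) Finset.univ_nonempty
      have hT := M.isSimplex T
      have hop := hT.isOpenPosMeasure
      obtain ⟨x, hx⟩ := hT.interior_nonempty
      have : Nonempty (cell T.1) := ⟨⟨x, interior_subset hx⟩⟩
      exact ENNReal.toReal_pos (isOpen_univ.measure_ne_zero _ Set.univ_nonempty)
        (measure_ne_top _ _)
    exact ⟨-(∑ T : M.elements, ∫ x, (q.1 T).1 x ∂(volumeMeasure T.1)) /
      ∑ T : M.elements, (volumeMeasure T.1).real Set.univ, by field_simp; ring⟩

end ConstantPressure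

theorem proposition4 {d : ℕ} (hd : d = 2 ∨ d = 3)
    (Ω : Set (Space d)) (hΩ : IsOpen Ω) (hΩreg : interior (closure Ω) = Ω)
    (M : SimplicialMesh Ω) (k : ℕ)
    (w : Space d → Space d) (hw : MemH10 Ω w) (hdiv : IsDivergenceFree Ω w) :
    (∃! v : VelocitySpace M k, IsHybridInterpolant M k w v) ∧
    (∀ v : VelocitySpace M k, IsHybridInterpolant M k w v →
      v ∈ discreteDivFree M k ∧ ∀ q ∈ pressureSpaceZero M k, couplingForm M k v q = 0) ∧
    (∀ v ∈ velocitySpaceZero M k,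
      v ∈ discreteDivFree M k ↔ ∀ q ∈ pressureSpaceZero M k, couplingForm M k v q = 0) := by
  have hd0 : 0 < d := by omega
  refine ⟨?_, fun v hv => ?_, fun v hv => ⟨fun h q _ => h.2 q, fun h => ⟨hv, fun q => ?_⟩⟩⟩
  · obtain ⟨φ, hφ, hlim⟩ := hw
    obtain ⟨v, hv⟩ := exists_isHybridInterpolant M k hΩreg hd0 (fun n => (hφ n).1) hlim
    exact ⟨v, hv, fun v' hv' => hv'.unique hd0 hv⟩
  · have h := hv.couplingForm_eq_zero hΩ hΩreg hd0 hw hdiv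
    exact ⟨⟨hv.mem_velocitySpaceZero hΩ hΩreg hd0 hw, h⟩, fun q _ => h q⟩
  · obtain ⟨c, hc⟩ := exists_add_constPressure_mem M k q
    rw [← couplingForm_add_constPressure M k hd0 v q c]
    exact h _ hc
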